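/- **Model.** Let the subjects $i=0,1,2,\dots$ be i.i.d., with covariates $Z_i\in\mathbb R^r$ of finite second moment, latent predictors $\xi_i\in\mathbb R^q$, indicators $X_i\in\mathbb R^h$, latent outcomes $\eta_i\in\mathbb R^p$ and outcomes $Y_i\in\mathbb R^m$ satisfying $$\xi_i=\tilde\alpha+\tilde B\xi_i+\tilde\Gamma Z_i+\tilde\zeta_i,\qquad X_i=\tilde\nu+\tilde\Lambda\xi_i+\tilde KZ_i+\tilde\varepsilon_i,$$ $$\eta_i=\alpha+B\varphi(\xi_i)+\Gamma Z_i+\zeta_i,\qquad Y_i=\nu+\Lambda\eta_i+KZ_i+LX_i+\varepsilon_i ,$$ where $\varphi:\mathbb R^q\to\mathbb R^l$ is measurable; $Z_i,\tilde\zeta_i,\tilde\varepsilon_i,\zeta_i,\varepsilon_i$ are independent; $\tilde\zeta_i\sim N(0,\tilde\Psi)$ and $\tilde\varepsilon_i\sim N(0,\tilde\Omega)$; and $\zeta_i,\varepsilon_i$ have mean $0$ and finite covariance matrices $\Psi,\Omega$ (not necessarily normal). The matrix $L$ holds the direct effects of the stage-1 indicators. Write $\theta_1=(\tilde\alpha,\tilde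 B,\tilde\Gamma,\tilde\Psi,\tilde\nu,\tilde\Lambda,\tilde K,\tilde\Omega)$, $\theta_2=(\alpha,B,\Gamma,\Psi,\nu,\Lambda,K,L,\Omega)$ for the true parameters, and $\varphi^*_i=E[\varphi(\xi_i)\mid X_i,Z_i]$. **Estimator.** Let $\Theta_1\ni\theta_1$ and $\Theta_2\ni\theta_2$ be parameter sets. In stage 1, $\hat\theta_{1,n}$ maximises over $\Theta_1$ the normal likelihood of $X_i$ given $Z_i$, $i<n$. For a stage-1 parameter $\theta$ let $\varphi^*_\theta(x,z)=E_\theta[\varphi(\xi)\mid X=x,Z=z]$ be the mean of $\varphi$ under the normal conditional law of $\xi$ given $(X,Z)=(x,z)$ in the stage-1 model. In stage 2, $\hat\theta_{2,n}$ maximises over $\Theta_2$ the normal likelihood of the linear structural equation model $$\eta_i=\alpha+B\,\varphi^*_{\hat\theta_{1,n}}(X_i,Z_i)+\Gamma Z_i+\zeta_i,\qquad Y_i=\nu+\Lambda\eta_i+KZ_i+LX_i+\varepsilon_i,$$ given the covariates $Z_i$, $X_i$ and $\varphi^*_{\hat\theta_{1,n}}(X_i,Z_i)$; thus $X_i$ is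 included as an additional covariate. It is enough that, almost surely, this holds for all sufficiently large $n$. **Regularity and identification.** 1. $\Theta_1$ is compact, and for each of its elements $\tilde B$ has zero diagonal, $I-\tilde B$ is invertible, and $\tilde\Psi,\tilde\Omega$ are positive definite. Only $\theta_1$ in $\Theta_1$ gives the true conditional mean (almost surely) and covariance of $X$ given $Z$. 2. There are a neighbourhood $U$ of $\theta_1$ in $\Theta_1$ and a function $G$ with $E\,|G(X_0,Z_0)|<\infty$ such that almost surely $E_\theta[\|\varphi(\xi)\|^2\mid X=X_0,Z=Z_0]\le G(X_0,Z_0)$ for all $\theta\in U$. 3. Call a stage-2 parameter admissible if $\Psi,\Omega$ are positive semidefinite and $\Lambda\Psi\Lambda^t+\Omega$ is positive definite. All elements of $\Theta_2$ are admissible, $\Theta_2$ is relatively closed in the set of admissible parameters, and the intercepts and regression coefficients $(\alpha,B,\Gamma,\nu,\Lambda,K,L)$ are bounded on $\Theta_2$. Each latent outcome has a reference indicator, which loads on it with coefficient $1$ and on no other latent outcome. The covariance matrix $\Psi$ is unrestricted: replacing $\Psi$ in an element of $\Theta_2$ by any positive semidefinite matrix gives an element of $\Theta_2$ if the result is admissible.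 4. Let $\theta_2^*$ be $\theta_2$ with $\Psi$ replaced by $\Psi+B\,\mathrm{Var}[\varphi(\xi_0)-\varphi^*_0]\,B^t$. The linear stage-2 model with covariates $Z_0,X_0,\varphi^*_0$ is identified at $\theta_2^*$: only $\theta_2^*$ in $\Theta_2$ gives the same modelled conditional mean (almost surely) and covariance of $Y_0$ given these covariates. **Conclusion.** Almost surely $\hat\theta_{1,n}\to\theta_1$ and $\hat\theta_{2,n}\to\theta_2^*$ as $n\to\infty$. That is, the two-stage estimator is consistent for all parameters, including $L$, except for the residual covariance $\Psi$ of the latent outcomes, whose estimator converges to $\Psi+B\,\mathrm{Var}[\varphi(\xi_0)-\varphi^*_0]\,B^t$. Moreover, for every $i$, $\varphi^*_{\theta_1}(X_i,Z_i)=E[\varphi(\xi_i)\mid X_i,Z_i]$ almost surely, the prediction error $\varphi(\xi_i)-E[\varphi(\xi_i)\mid X_i,Z_i]$ and $X_i$ have finite second moments, and the prediction error is uncorrelated with $X_i$. -/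

import Mathlib

open MeasureTheory ProbabilityTheory Filter Topology
open scoped Matrix

noncomputable section

/-- The normal law with mean `m` and covariance matrix `S` on plain coordinate vectors. -/
def normalLaw {k : ℕ} (m : Fin k → ℝ) (S : Matrix (Fin k) (Fin k) ℝ) : Measure (Fin k → ℝ) :=
  (multivariateGaussian (WithLp.toLp 2 m) S).map WithLp.ofLp

/-- Logarithm of the density of the centred normal law with (positive definite) covariance matrix
`S` at the point `e`. -/
def gaussianLogDensity {k : ℕ} (S : Matrix (Fin k) (Fin k) ℝ) (e : Fin k → ℝ) : ℝ :=
  -(1 / 2) * (Real.log ((2 * Real.pi) • S).det + e ⬝ᵥ (S⁻¹ *ᵥ e))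

/-! ### The stage-one model `ξ = α + B ξ + Γ Z + ζ'`, `X = ν + Λ ξ + K Z + ε'`,
with `Cov ζ' = Ψ` and `Cov ε' = Ω` -/

/-- Parameters of the stage-one linear structural equation model
(`r` covariates `Z`, `q` latent predictors `ξ`, `h` indicators `X`). -/
@[ext] structure Stage1Param (r q h : ℕ) where
  α : Fin q → ℝ
  B : Matrix (Fin q) (Fin q) ℝ
  Γ : Matrix (Fin q) (Fin r) ℝ
  Ψ : Matrix (Fin q) (Fin q) ℝ
  ν : Fin h → ℝ
  Λ : Matrix (Fin h) (Fin q) ℝ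
  K : Matrix (Fin h) (Fin r) ℝ
  Ω : Matrix (Fin h) (Fin h) ℝ

namespace Stage1Param

variable {r q h : ℕ}

/-- The topology of entrywise convergence. -/
instance : TopologicalSpace (Stage1Param r q h) :=
  TopologicalSpace.induced (fun θ => (θ.α, θ.B, θ.Γ, θ.Ψ, θ.ν, θ.Λ, θ.K, θ.Ω)) inferInstance

/-- `B` has zero diagonal, the structural equation can be solved for `ξ`, and the residual
covariance matrices are positive definite. -/
structure Admissible (θ : Stage1Param r q h) : Prop where
  diag_zero : ∀ a, θ.B a a = 0
  solvable : IsUnit (1 - θ.B).det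
  psi_posDef : θ.Ψ.PosDef
  omega_posDef : θ.Ω.PosDef

/-- `E[ξ | Z = z]`. -/
def meanXi (θ : Stage1Param r q h) (z : Fin r → ℝ) : Fin q → ℝ :=
  (1 - θ.B)⁻¹ *ᵥ (θ.α + θ.Γ *ᵥ z)

/-- `Var(ξ | Z)`. -/
def covXi (θ : Stage1Param r q h) : Matrix (Fin q) (Fin q) ℝ :=
  (1 - θ.B)⁻¹ * θ.Ψ * ((1 - θ.B)⁻¹)ᵀ

/-- `E[X | Z = z]`. -/
def meanX (θ : Stage1Param r q h) (z : Fin r → ℝ) : Fin h → ℝ :=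
  θ.ν + θ.Λ *ᵥ θ.meanXi z + θ.K *ᵥ z

/-- `Var(X | Z)`. -/
def covX (θ : Stage1Param r q h) : Matrix (Fin h) (Fin h) ℝ :=
  θ.Λ * θ.covXi * θ.Λᵀ + θ.Ω

/-- `Cov(ξ, X | Z)`. -/
def covXiX (θ : Stage1Param r q h) : Matrix (Fin q) (Fin h) ℝ :=
  θ.covXi * θ.Λᵀ

/-- `E[ξ | X = x, Z = z]`. -/
def postMean (θ : Stage1Param r q h) (x : Fin h → ℝ) (z : Fin r → ℝ) : Fin q → ℝ :=
  θ.meanXi z + (θ.covXiX * θ.covX⁻¹) *ᵥ (x - θ.meanX z)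

/-- `Var(ξ | X, Z)`. -/
def postCov (θ : Stage1Param r q h) : Matrix (Fin q) (Fin q) ℝ :=
  θ.covXi - θ.covXiX * θ.covX⁻¹ * θ.covXiXᵀ

/-- The conditional law of `ξ` given `X = x` and `Z = z` in the normal stage-one model. -/
def postLaw (θ : Stage1Param r q h) (x : Fin h → ℝ) (z : Fin r → ℝ) : Measure (Fin q → ℝ) :=
  normalLaw (θ.postMean x z) θ.postCov

/-- The prediction `E_θ[φ(ξ) | X = x, Z = z]`. -/
def predict {l : ℕ} (φ : (Fin q → ℝ) → Fin l → ℝ) (θ : Stage1Param r q h)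
    (x : Fin h → ℝ) (z : Fin r → ℝ) : Fin l → ℝ :=
  fun c => ∫ u, φ u c ∂(θ.postLaw x z)

end Stage1Param

/-! ### The stage-two model `η = α + B φ + Γ Z + ζ`, `Y = ν + Λ η + K Z + L X + ε`,
with `Cov ζ = Ψ` and `Cov ε = Ω` -/

/-- Parameters of the stage-two model (`l` non-linear terms, `p` latent outcomes `η`, `m` observed
outcomes `Y`); `L` holds the direct effects of the stage-one indicators `X`. -/
@[ext] structure Stage2Param (r h l p m : ℕ) where
  α : Fin p → ℝ
  B : Matrix (Fin p) (Fin l) ℝ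
  Γ : Matrix (Fin p) (Fin r) ℝ
  Ψ : Matrix (Fin p) (Fin p) ℝ
  ν : Fin m → ℝ
  Λ : Matrix (Fin m) (Fin p) ℝ
  K : Matrix (Fin m) (Fin r) ℝ
  L : Matrix (Fin m) (Fin h) ℝ
  Ω : Matrix (Fin m) (Fin m) ℝ

namespace Stage2Param

variable {r h l p m : ℕ}

/-- The topology of entrywise convergence. -/
instance : TopologicalSpace (Stage2Param r h l p m) :=
  TopologicalSpace.induced
    (fun θ => (θ.α, θ.B, θ.Γ, θ.Ψ, θ.ν, θ.Λ, θ.K, θ.L, θ.Ω)) inferInstance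

/-- The intercepts and regression coefficients, i.e. all parameters but `Ψ` and `Ω`. -/
def coef (θ : Stage2Param r h l p m) :
    (Fin p → ℝ) × Matrix (Fin p) (Fin l) ℝ × Matrix (Fin p) (Fin r) ℝ × (Fin m → ℝ) ×
      Matrix (Fin m) (Fin p) ℝ × Matrix (Fin m) (Fin r) ℝ × Matrix (Fin m) (Fin h) ℝ :=
  (θ.α, θ.B, θ.Γ, θ.ν, θ.Λ, θ.K, θ.L)

/-- Modelled mean of `Y` given `Z = z`, `X = x` and the value `f` of the (predicted) non-linear
terms. -/
def meanY (θ : Stage2Param r h l p m) (z : Fin r → ℝ) (x : Fin h → ℝ) (f : Fin l → ℝ) :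
    Fin m → ℝ :=
  θ.ν + θ.Λ *ᵥ (θ.α + θ.B *ᵥ f + θ.Γ *ᵥ z) + θ.K *ᵥ z + θ.L *ᵥ x

/-- Modelled covariance matrix of `Y` given the covariates. -/
def covY (θ : Stage2Param r h l p m) : Matrix (Fin m) (Fin m) ℝ :=
  θ.Λ * θ.Ψ * θ.Λᵀ + θ.Ω

/-- `Ψ` and `Ω` are covariance matrices and the modelled law of `Y` is non-degenerate. -/
structure Admissible (θ : Stage2Param r h l p m) : Prop where
  psi_posSemidef : θ.Ψ.PosSemidef
  omega_posSemidef : θ.Ω.PosSemidef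
  covY_posDef : θ.covY.PosDef

/-- The parameter sets allowed in stage two. Further identifying restrictions (intercepts,
zero loadings, zero direct effects, diagonal `Ω`, ...) are encoded in the choice of `Θ`. -/
structure IsParameterSpace (Θ : Set (Stage2Param r h l p m)) : Prop where
  admissible : ∀ θ ∈ Θ, θ.Admissible
  /-- `Θ` is relatively closed in the set of admissible parameters. -/
  closed : ∀ θ ∈ closure Θ, θ.Admissible → θ ∈ Θ
  /-- The intercepts and regression coefficients range in a bounded set. -/
  coef_bounded : ∃ C, IsCompact C ∧ ∀ θ ∈ Θ, θ.coef ∈ C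
  /-- Every latent outcome has a reference indicator, which loads on it with coefficient `1`
  and on no other latent outcome. -/
  reference : ∃ ref : Fin p → Fin m, ∀ θ ∈ Θ, ∀ a b, θ.Λ (ref a) b = if a = b then 1 else 0
  /-- The residual covariance matrix of the latent outcomes is unrestricted. -/
  psi_unrestricted : ∀ θ ∈ Θ, ∀ Ψ' : Matrix (Fin p) (Fin p) ℝ, Ψ'.PosSemidef →
    ({θ with Ψ := Ψ'} : Stage2Param r h l p m).Admissible →
      ({θ with Ψ := Ψ'} : Stage2Param r h l p m) ∈ Θ

end Stage2Param

/-! ### Data -/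

/-- The observed and latent variables and the residuals of all subjects `i = 0, 1, 2, ...`, on a
sample space `S`. -/
structure SEMVariables (S : Type*) (r q h p m : ℕ) where
  Z : ℕ → S → Fin r → ℝ
  ξ : ℕ → S → Fin q → ℝ
  X : ℕ → S → Fin h → ℝ
  η : ℕ → S → Fin p → ℝ
  Y : ℕ → S → Fin m → ℝ
  /-- Residual of the stage-one structural equation. -/
  ζ' : ℕ → S → Fin q → ℝ
  /-- Error of the stage-one measurement model. -/
  ε' : ℕ → S → Fin h → ℝ
  /-- Residual of the stage-two structural equation. -/
  ζ : ℕ → S → Fin p → ℝ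
  /-- Error of the stage-two measurement model. -/
  ε : ℕ → S → Fin m → ℝ

namespace SEMVariables

variable {S : Type*} {r q h l p m : ℕ}

/-- The data follow the non-linear structural equation model with parameters `θ₁`, `θ₂`, with
direct effects of `X` on `Y`. The subjects are independent and identically distributed; for each
subject, `Z` and the four residuals are independent; the stage-one residuals are normal, the
stage-two residuals are centred with finite variance. -/
structure Follows [MeasurableSpace S] (V : SEMVariables S r q h p m) (μ : Measure S)
    (φ : (Fin q → ℝ) → Fin l → ℝ)
    (θ₁ : Stage1Param r q h) (θ₂ : Stage2Param r h l p m) : Prop where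
  latent_predictor : ∀ i ω,
    V.ξ i ω = θ₁.α + θ₁.B *ᵥ V.ξ i ω + θ₁.Γ *ᵥ V.Z i ω + V.ζ' i ω
  indicator : ∀ i ω, V.X i ω = θ₁.ν + θ₁.Λ *ᵥ V.ξ i ω + θ₁.K *ᵥ V.Z i ω + V.ε' i ω
  latent_outcome : ∀ i ω,
    V.η i ω = θ₂.α + θ₂.B *ᵥ φ (V.ξ i ω) + θ₂.Γ *ᵥ V.Z i ω + V.ζ i ω
  outcome : ∀ i ω,
    V.Y i ω = θ₂.ν + θ₂.Λ *ᵥ V.η i ω + θ₂.K *ᵥ V.Z i ω + θ₂.L *ᵥ V.X i ω + V.ε i ω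
  measurable_Z : ∀ i, Measurable (V.Z i)
  measurable_ζ' : ∀ i, Measurable (V.ζ' i)
  measurable_ε' : ∀ i, Measurable (V.ε' i)
  measurable_ζ : ∀ i, Measurable (V.ζ i)
  measurable_ε : ∀ i, Measurable (V.ε i)
  subjects_indep :
    iIndepFun (fun i ω => (V.Z i ω, V.ζ' i ω, V.ε' i ω, V.ζ i ω, V.ε i ω)) μ
  law : ∀ i, HasLaw (fun ω => (V.Z i ω, V.ζ' i ω, V.ε' i ω, V.ζ i ω, V.ε i ω))
    ((μ.map (V.Z 0)).prod ((normalLaw 0 θ₁.Ψ).prod ((normalLaw 0 θ₁.Ω).prod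
      ((μ.map (V.ζ 0)).prod (μ.map (V.ε 0)))))) μ
  memLp_Z : MemLp (V.Z 0) 2 μ
  memLp_ζ : MemLp (V.ζ 0) 2 μ
  memLp_ε : MemLp (V.ε 0) 2 μ
  mean_ζ : ∀ a, ∫ ω, V.ζ 0 ω a ∂μ = 0
  mean_ε : ∀ a, ∫ ω, V.ε 0 ω a ∂μ = 0
  cov_ζ : ∀ a b, ∫ ω, V.ζ 0 ω a * V.ζ 0 ω b ∂μ = θ₂.Ψ a b
  cov_ε : ∀ a b, ∫ ω, V.ε 0 ω a * V.ε 0 ω b ∂μ = θ₂.Ω a b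

/-- Stage-one log-likelihood of the first `n` subjects: normal model for `X` given `Z`. -/
def logLik1 (V : SEMVariables S r q h p m) (n : ℕ) (ω : S) (θ : Stage1Param r q h) : ℝ :=
  ∑ i ∈ Finset.range n, gaussianLogDensity θ.covX (V.X i ω - θ.meanX (V.Z i ω))

/-- Stage-two log-likelihood of the first `n` subjects: normal linear structural equation model for
`Y` given the covariates `Z`, the additional covariates `X`, and the predictions
`E_{θ₁}[φ(ξ) | X, Z]` in place of `φ(ξ)`. -/
def logLik2 (V : SEMVariables S r q h p m) (φ : (Fin q → ℝ) → Fin l → ℝ)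
    (θ₁ : Stage1Param r q h) (n : ℕ) (ω : S) (θ : Stage2Param r h l p m) : ℝ :=
  ∑ i ∈ Finset.range n, gaussianLogDensity θ.covY
    (V.Y i ω - θ.meanY (V.Z i ω) (V.X i ω) (θ₁.predict φ (V.X i ω) (V.Z i ω)))

/-- `(T₁ n, T₂ n)`, `n = 0, 1, 2, ...`, is the two-stage estimator with `X` included as additional
covariate in stage two: almost surely, for all sufficiently large `n`, `T₁ n` maximises the
stage-one likelihood of the first `n` subjects, and `T₂ n` maximises their stage-two likelihood
based on the predictions from `T₁ n`. -/
def IsTwoStageEstimator [MeasurableSpace S] (V : SEMVariables S r q h p m) (μ : Measure S)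
    (φ : (Fin q → ℝ) → Fin l → ℝ)
    (Θ₁ : Set (Stage1Param r q h)) (Θ₂ : Set (Stage2Param r h l p m))
    (T₁ : ℕ → S → Stage1Param r q h) (T₂ : ℕ → S → Stage2Param r h l p m) : Prop :=
  ∀ᵐ ω ∂μ, ∀ᶠ n in atTop,
    (T₁ n ω ∈ Θ₁ ∧ IsMaxOn (V.logLik1 n ω) Θ₁ (T₁ n ω)) ∧
    (T₂ n ω ∈ Θ₂ ∧ IsMaxOn (V.logLik2 φ (T₁ n ω) n ω) Θ₂ (T₂ n ω))

/-- The conditional expectation `E[φ(ξ_i) | X_i, Z_i]`. -/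
def condPhi [MeasurableSpace S] (V : SEMVariables S r q h p m) (μ : Measure S)
    (φ : (Fin q → ℝ) → Fin l → ℝ) (i : ℕ) (ω : S) : Fin l → ℝ :=
  fun c => (μ[fun ω' => φ (V.ξ i ω') c |
    MeasurableSpace.comap (fun ω' => (V.X i ω', V.Z i ω')) inferInstance]) ω

/-- The prediction error `φ(ξ_i) - E[φ(ξ_i) | X_i, Z_i]`. -/
def predError [MeasurableSpace S] (V : SEMVariables S r q h p m) (μ : Measure S)
    (φ : (Fin q → ℝ) → Fin l → ℝ) (i : ℕ) (ω : S) : Fin l → ℝ :=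
  φ (V.ξ i ω) - V.condPhi μ φ i ω

/-- The covariance matrix of the prediction error. -/
def covPredError [MeasurableSpace S] (V : SEMVariables S r q h p m) (μ : Measure S)
    (φ : (Fin q → ℝ) → Fin l → ℝ) : Matrix (Fin l) (Fin l) ℝ :=
  Matrix.of fun c d =>
    cov[fun ω => V.predError μ φ 0 ω c, fun ω => V.predError μ φ 0 ω d; μ]

/-- Near `θ₁`, the second moments of `φ(ξ)` given `X`, `Z` are dominated by an integrable function
of the data; in particular `φ(ξ)` has finite variance. -/
def LocallyDominated [MeasurableSpace S] (V : SEMVariables S r q h p m) (μ : Measure S)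
    (φ : (Fin q → ℝ) → Fin l → ℝ) (Θ₁ : Set (Stage1Param r q h)) (θ₁ : Stage1Param r q h) :
    Prop :=
  ∃ U ∈ 𝓝[Θ₁] θ₁, ∃ G : (Fin h → ℝ) × (Fin r → ℝ) → ℝ,
    Integrable G (μ.map fun ω => (V.X 0 ω, V.Z 0 ω)) ∧
    ∀ᵐ w ∂(μ.map fun ω => (V.X 0 ω, V.Z 0 ω)), ∀ θ ∈ U,
      ∫⁻ u, ‖φ u‖ₑ ^ 2 ∂(θ.postLaw w.1 w.2) ≤ ENNReal.ofReal (G w)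

end SEMVariables

/-- The stage-one model is identified at `θ₁`: no other parameter in `Θ₁` gives the same
conditional mean and covariance of `X` given `Z`. -/
def Stage1Identified {S : Type*} [MeasurableSpace S] {r q h p m : ℕ}
    (V : SEMVariables S r q h p m) (μ : Measure S)
    (Θ₁ : Set (Stage1Param r q h)) (θ₁ : Stage1Param r q h) : Prop :=
  ∀ θ ∈ Θ₁, θ.covX = θ₁.covX → (∀ᵐ ω ∂μ, θ.meanX (V.Z 0 ω) = θ₁.meanX (V.Z 0 ω)) → θ = θ₁

/-- The linear stage-two model with covariates `Z`, `X` and `E[φ(ξ) | X, Z]` is identified at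
`θ₂`: no other parameter in `Θ₂` gives the same modelled mean and covariance of `Y` given the
covariates. -/
def Stage2Identified {S : Type*} [MeasurableSpace S] {r q h l p m : ℕ}
    (V : SEMVariables S r q h p m) (μ : Measure S) (φ : (Fin q → ℝ) → Fin l → ℝ)
    (Θ₂ : Set (Stage2Param r h l p m)) (θ₂ : Stage2Param r h l p m) : Prop :=
  ∀ θ ∈ Θ₂, θ.covY = θ₂.covY →
    (∀ᵐ ω ∂μ, θ.meanY (V.Z 0 ω) (V.X 0 ω) (V.condPhi μ φ 0 ω) =
      θ₂.meanY (V.Z 0 ω) (V.X 0 ω) (V.condPhi μ φ 0 ω)) → θ = θ₂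

end

/-! ### Positive definite matrices and the normal likelihood criterion -/

namespace Matrix

variable {n : Type*} [Fintype n] [DecidableEq n]

/-! Both stages are minimum contrast estimation from second moments. The residual of either model is
`C v`, where `v` is the regression vector, containing the constant `1`, and the design matrix `C`
depends on the parameter. Up to constants, `-2/n` times the log-likelihood is therefore `log det S +
tr (S⁻¹ C Mₙ Cᵀ)`, with `S` the modelled covariance and `Mₙ` the empirical moment matrix of `v`
(`sum_gaussianLogDensity`). Once `Mₙ → M₀` is known at a sample point, consistency there is
deterministic: the contrast is jointly continuous in parameter and moments, so every cluster point
of the estimators in a compact set minimises the limit contrast. That contrast splits by Pythagoras,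
because the true residual is orthogonal to the regressors; Gibbs' inequality then makes the true
covariance and regression function its only minimiser (`eq_of_normalContrast_le`), and
identification gives the parameter. Normality of the stage-two errors plays no role.

The bias in `Ψ` comes from writing `φ(ξ) = φ* + δ` with `φ* = E[φ(ξ) | X, Z]`. The prediction error
`δ` is orthogonal to every square integrable function of `(X, Z)` and to the errors `ζ, ε`. Hence
`Y` obeys the linear model with `φ*` in place of `φ(ξ)` and with latent residual `B δ + ζ`, of
covariance `Ψ + B Var(δ) Bᵀ`. Since the conditioning includes `X`, this residual is also orthogonal
to `X`, so `X` may enter as a covariate and `L` is estimated consistently.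

In stage one `Θ₁` is compact and the strong law gives `Mₙ → M₀`. Stage two has three further
difficulties. First, the predictor at the true parameter must be the conditional expectation: `ξ`
minus its linear prediction is Gaussian and independent of `(X, Z)`, so the postulated posterior is
the true conditional law (`condPhi_ae_eq`). Second, the covariate is built from an estimated
parameter: Scheffé's lemma makes predictions continuous in the parameter, and a uniform law of large
numbers with the integrable bound makes the mean squared change in the predictions vanish
(`ae_tendsto_average_zero_of_dominated`). Third, `Θ₂` is not compact: bounded coefficients keep the
residual moments away from singularity, which confines the modelled covariance to a compact set of
invertible matrices, and the reference indicators then bound `Ψ` and `Ω`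
(`isCompact_setOf_covY_mem`). -/

theorem PosDef.log_det_eq_sum {Q : Matrix n n ℝ} (hQ : Q.PosDef) :
    Real.log Q.det = ∑ i, Real.log (hQ.isHermitian.eigenvalues i) := by
  rw [hQ.isHermitian.det_eq_prod_eigenvalues]
  simp only [RCLike.ofReal_real_eq_id, id_eq]
  exact Real.log_prod fun i _ => (hQ.eigenvalues_pos i).ne'

theorem IsHermitian.trace_eq_sum {Q : Matrix n n ℝ} (hQ : Q.IsHermitian) :
    Q.trace = ∑ i, hQ.eigenvalues i := by
  simpa using hQ.trace_eq_sum_eigenvalues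

/-- Sum `log t ≤ t - 1` over the eigenvalues. -/
theorem PosDef.card_add_log_det_le_trace {Q : Matrix n n ℝ} (hQ : Q.PosDef) :
    Fintype.card n + Real.log Q.det ≤ Q.trace := by
  rw [hQ.log_det_eq_sum, hQ.isHermitian.trace_eq_sum]
  have : (Fintype.card n : ℝ) = ∑ _i : n, (1 : ℝ) := by simp
  rw [this, ← Finset.sum_add_distrib]
  refine Finset.sum_le_sum fun i _ => ?_
  linarith [Real.log_le_sub_one_of_pos (hQ.eigenvalues_pos i)]

/-- Equality in `log t ≤ t - 1` forces every eigenvalue to be `1`, and the spectral theorem does the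
rest. -/
theorem PosDef.eq_one_of_trace_le {Q : Matrix n n ℝ} (hQ : Q.PosDef)
    (h : Q.trace ≤ Fintype.card n + Real.log Q.det) : Q = 1 := by
  have hev : ∀ i, hQ.isHermitian.eigenvalues i = 1 := by
    by_contra! hne
    obtain ⟨i, hi⟩ := hne
    rw [hQ.log_det_eq_sum, hQ.isHermitian.trace_eq_sum] at h
    have hc : (Fintype.card n : ℝ) = ∑ _i : n, (1 : ℝ) := by simp
    rw [hc, ← Finset.sum_add_distrib] at h
    refine absurd h (not_le.2 (Finset.sum_lt_sum (fun j _ => ?_) ⟨i, Finset.mem_univ i, ?_⟩))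
    · linarith [Real.log_le_sub_one_of_pos (hQ.eigenvalues_pos j)]
    · linarith [Real.log_lt_sub_one_of_pos (hQ.eigenvalues_pos i) hi]
  have h1 := hQ.isHermitian.spectral_theorem
  have h2 : diagonal (RCLike.ofReal ∘ hQ.isHermitian.eigenvalues : n → ℝ) = 1 := by
    rw [← diagonal_one]; congr 1; ext i; simp [hev]
  rw [h2, map_one] at h1
  exact h1

theorem PosDef.exists_transpose_mul_self {S : Matrix n n ℝ} (hS : S.PosDef) :
    ∃ B : Matrix n n ℝ, S = Bᵀ * B ∧ IsUnit B := by
  obtain ⟨B, hB⟩ : ∃ B : Matrix n n ℝ, S = Bᵀ * B := by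
    open scoped MatrixOrder in
    obtain ⟨B, hB⟩ := CStarAlgebra.nonneg_iff_eq_star_mul_self.1 hS.posSemidef.nonneg
    exact ⟨B, by simpa [star_eq_conjTranspose] using hB⟩
  refine ⟨B, hB, ?_⟩
  have := hS.isUnit
  rw [hB, isUnit_iff_isUnit_det, det_mul] at this
  exact (isUnit_iff_isUnit_det _).2 (isUnit_of_mul_isUnit_right this)

/-- Gibbs' inequality for centred normal laws. -/
theorem PosDef.log_det_add_card_le {S S₀ : Matrix n n ℝ} (hS : S.PosDef) (hS₀ : S₀.PosDef) :
    Real.log S₀.det + Fintype.card n ≤ Real.log S.det + (S⁻¹ * S₀).trace ∧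
      (Real.log S.det + (S⁻¹ * S₀).trace ≤ Real.log S₀.det + Fintype.card n → S = S₀) := by
  obtain ⟨B, hB, hBu⟩ := hS₀.exists_transpose_mul_self
  have hBd := (isUnit_iff_isUnit_det _).1 hBu
  -- Congruence by the factor of `S₀` merges both matrices into one positive definite `Q` with trace
  -- `tr (S⁻¹ S₀)` and determinant `det S₀ / det S`, so the eigenvalue inequality applies to `Q`.
  have hQ : (B * S⁻¹ * Bᵀ).PosDef := by
    have := hS.inv.mul_mul_conjTranspose_same (B := B) (vecMul_injective_of_isUnit hBu)
    simpa using this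
  have htr : (B * S⁻¹ * Bᵀ).trace = (S⁻¹ * S₀).trace := by
    rw [hB, Matrix.mul_assoc, trace_mul_comm, Matrix.mul_assoc]
  have hlog : Real.log (B * S⁻¹ * Bᵀ).det = Real.log S₀.det - Real.log S.det := by
    have : (B * S⁻¹ * Bᵀ).det = S₀.det / S.det := by
      rw [hB, det_mul, det_mul, det_mul, det_transpose, det_nonsing_inv, Ring.inverse_eq_inv']
      ring
    rw [this, Real.log_div hS₀.det_pos.ne' hS.det_pos.ne']
  refine ⟨?_, fun h => ?_⟩
  · have := hQ.card_add_log_det_le_trace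
    linarith
  · have h1 : B * S⁻¹ * Bᵀ = 1 := hQ.eq_one_of_trace_le (by linarith)
    have hBT : Bᵀ.det ≠ 0 := by rw [det_transpose]; exact hBd.ne_zero
    have hSu := hS.isUnit
    have h2 : S⁻¹ * S₀ = 1 := by
      rw [Matrix.mul_assoc] at h1
      have h3 := mul_eq_one_comm.1 h1
      rw [hB, ← Matrix.mul_assoc]; exact h3
    calc S = S * (S⁻¹ * S₀) := by rw [h2, Matrix.mul_one]
      _ = S₀ := by
        rw [← Matrix.mul_assoc, Matrix.mul_nonsing_inv _ ((isUnit_iff_isUnit_det _).1 hSu),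
          Matrix.one_mul]

/-- With `R = Bᵀ B` the trace is that of the positive semidefinite matrix `B P Bᵀ`. -/
theorem PosSemidef.trace_mul_nonneg {P R : Matrix n n ℝ} (hP : P.PosSemidef)
    (hR : R.PosSemidef) : 0 ≤ (P * R).trace := by
  obtain ⟨B, hB⟩ : ∃ B : Matrix n n ℝ, R = Bᵀ * B := by
    open scoped MatrixOrder in
    obtain ⟨B, hB⟩ := CStarAlgebra.nonneg_iff_eq_star_mul_self.1 hR.nonneg
    exact ⟨B, by simpa [star_eq_conjTranspose] using hB⟩
  have : (P * R).trace = (B * P * Bᵀ).trace := by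
    rw [hB, Matrix.mul_assoc, trace_mul_comm B, Matrix.mul_assoc]
  rw [this]
  exact (by simpa using hP.mul_mul_conjTranspose_same B : (B * P * Bᵀ).PosSemidef).trace_nonneg

theorem isClosed_setOf_posSemidef {n : Type*} [Fintype n] :
    IsClosed {S : Matrix n n ℝ | S.PosSemidef} := by
  have : {S : Matrix n n ℝ | S.PosSemidef} =
      {S | Sᵀ = S} ∩ ⋂ x : n → ℝ, {S | 0 ≤ x ⬝ᵥ (S *ᵥ x)} := by
    ext S
    simp [posSemidef_iff_dotProduct_mulVec, IsHermitian]
  rw [this]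
  refine (isClosed_eq (by fun_prop) (by fun_prop)).inter
    (isClosed_iInter fun x => isClosed_le (by fun_prop) (by fun_prop))

theorem isCompact_setOf_forall_abs_le {m n : Type*} (t : ℝ) :
    IsCompact {P : Matrix m n ℝ | ∀ i j, |P i j| ≤ t} := by
  have : IsCompact (Set.univ.pi fun _ => Set.univ.pi fun _ => Set.Icc (-t) t : Set (m → n → ℝ)) :=
    isCompact_univ_pi fun _ => isCompact_univ_pi fun _ => isCompact_Icc
  have e : {P : Matrix m n ℝ | ∀ i j, |P i j| ≤ t} =
      (Set.univ.pi fun _ => Set.univ.pi fun _ => Set.Icc (-t) t : Set (m → n → ℝ)) := by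
    ext P
    exact ⟨fun h i _ j _ => abs_le.1 (h i j), fun h i j => abs_le.2 (h i trivial j trivial)⟩
  rw [e]
  exact this

theorem PosSemidef.abs_apply_le_trace {S : Matrix n n ℝ} (hS : S.PosSemidef) (i j : n) :
    |S i j| ≤ S.trace := by
  have hsymm : S j i = S i j := by simpa using congrFun (congrFun hS.isHermitian i) j
  -- The quadratic form at `e_i + s e_j`, used for the two signs `s = ±1`.
  have key : ∀ s : ℝ, s ^ 2 = 1 → 0 ≤ S i i + S j j + 2 * s * S i j := fun s hs => by
    have h := hS.dotProduct_mulVec_nonneg (Pi.single i 1 + s • Pi.single j 1)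
    simp only [star_trivial, mulVec_add, mulVec_smul, add_dotProduct, dotProduct_add,
      smul_dotProduct, dotProduct_smul, mulVec_single_one, single_dotProduct, one_mul, col_apply,
      smul_eq_mul, hsymm] at h
    linear_combination h + S j j * hs
  have hd : ∀ a, S a a ≤ S.trace := fun a =>
    Finset.single_le_sum (f := fun a => S a a) (fun b _ => hS.diag_nonneg) (Finset.mem_univ a)
  have h1 := key 1 (by norm_num)
  have h2 := key (-1) (by norm_num)
  rw [abs_le]
  constructor <;> linarith [hd i, hd j]

end Matrix

/-- A compact set of positive definite matrices contains all `S` at which the normal criterion is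
at most `b` for some residual moment matrix `R ≥ c`. -/
theorem exists_isCompact_of_logdet_add_trace_le {n : Type*} [Fintype n] [DecidableEq n] {c : ℝ}
    (hc : 0 < c) (b : ℝ) :
    ∃ C : Set (Matrix n n ℝ), IsCompact C ∧ (∀ S ∈ C, S.det ≠ 0) ∧
      ∀ S R : Matrix n n ℝ, S.PosDef → (R - c • (1 : Matrix n n ℝ)).PosSemidef →
        Real.log S.det + (S⁻¹ * R).trace ≤ b → S ∈ C := by
  set N : ℝ := (Fintype.card n : ℝ) with hN
  -- The compact set is described through `P = S⁻¹`, which satisfies `c tr P - log det P ≤ b`.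
  -- Bounding `log det P` by half of the trace term leaves the trace bound; dropping the trace term
  -- leaves the determinant bound.
  set D : Set (Matrix n n ℝ) := {P | P.PosSemidef} ∩
    ({P | c / 2 * P.trace ≤ b - N * (1 + Real.log (c / 2))} ∩
      {P | Real.exp (-b) ≤ P.det})
  have hDc : IsCompact D := by
    have hcl : IsClosed D := Matrix.isClosed_setOf_posSemidef.inter
      ((isClosed_le (by fun_prop) (by fun_prop)).inter (isClosed_le (by fun_prop) (by fun_prop)))
    set t : ℝ := (b - N * (1 + Real.log (c / 2))) / (c / 2)
    refine (Matrix.isCompact_setOf_forall_abs_le t).of_isClosed_subset hcl fun P hP i j => ?_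
    have h1 := hP.1.abs_apply_le_trace i j
    have h2 : P.trace ≤ t := by
      rw [le_div_iff₀ (by positivity)]; linarith [hP.2.1.out]
    exact h1.trans h2
  have hdet : ∀ P ∈ D, P.det ≠ 0 := fun P hP => ((Real.exp_pos _).trans_le hP.2.2).ne'
  refine ⟨(fun P : Matrix n n ℝ => P⁻¹) '' D, hDc.image_of_continuousOn fun P hP => ?_, ?_, ?_⟩
  · have : ContinuousAt (fun P : Matrix n n ℝ => (P.det)⁻¹ • P.adjugate) P := by
      refine ContinuousAt.smul (ContinuousAt.inv₀ ?_ (hdet P hP)) ?_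
      · exact (by fun_prop : Continuous fun P : Matrix n n ℝ => P.det).continuousAt
      · exact (by fun_prop : Continuous fun P : Matrix n n ℝ => P.adjugate).continuousAt
    refine this.continuousWithinAt.congr (fun Q _ => ?_) ?_ <;>
      simp [Matrix.inv_def, Ring.inverse_eq_inv']
  · rintro _ ⟨P, hP, rfl⟩
    simpa [Matrix.det_nonsing_inv, Ring.inverse_eq_inv'] using hdet P hP
  · intro S R hS hR hb
    have hP := hS.inv
    have hlog : Real.log S⁻¹.det = -Real.log S.det := by
      rw [Matrix.det_nonsing_inv, Ring.inverse_eq_inv', Real.log_inv]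
    have htr : c * S⁻¹.trace ≤ (S⁻¹ * R).trace := by
      have := hP.posSemidef.trace_mul_nonneg hR
      rw [Matrix.mul_sub, Matrix.trace_sub, Matrix.mul_smul, Matrix.trace_smul, Matrix.mul_one,
        smul_eq_mul] at this
      linarith
    have htr0 := hP.posSemidef.trace_nonneg
    refine ⟨S⁻¹, ⟨hP.posSemidef, ?_, ?_⟩, ?_⟩
    -- Scaling by `c / 2` makes the inequality for `log det` consume exactly half of `c tr P`.
    · have h := (hP.smul (half_pos hc)).card_add_log_det_le_trace
      rw [Matrix.det_smul, Real.log_mul (by positivity) hP.det_pos.ne', Real.log_pow,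
        Matrix.trace_smul, smul_eq_mul, ← hN] at h
      change c / 2 * S⁻¹.trace ≤ b - N * (1 + Real.log (c / 2))
      linarith
    · change Real.exp (-b) ≤ S⁻¹.det
      rw [← Real.le_log_iff_exp_le hP.det_pos, hlog]
      nlinarith
    · exact Matrix.nonsing_inv_nonsing_inv _ ((Matrix.isUnit_iff_isUnit_det _).1 hS.isUnit)

/-! ### Minimum contrast estimation -/

/-- At a cluster point of `T`, joint continuity passes the inequality `f (T n) (M n) ≤ f θ₀ (M n)`
to the limit. Since the sample acts only through the moments `M n`, continuity in the pair takes the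
place of a uniform law of large numbers. Membership of `θ₀` in `K` is not needed. -/
theorem tendsto_of_eventually_le_of_unique {P E : Type*} [TopologicalSpace P] [TopologicalSpace E]
    {K : Set P} (hK : IsCompact K) {f : P → E → ℝ} {M : ℕ → E} {M₀ : E}
    (hM : Tendsto M atTop (𝓝 M₀)) {T : ℕ → P} (hT : ∀ᶠ n in atTop, T n ∈ K) {θ₀ : P}
    (hf : ∀ θ ∈ K, ContinuousAt (Function.uncurry f) (θ, M₀)) (hf₀ : ContinuousAt (f θ₀) M₀)
    (hmin : ∀ᶠ n in atTop, f (T n) (M n) ≤ f θ₀ (M n))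
    (huniq : ∀ θ ∈ K, f θ M₀ ≤ f θ₀ M₀ → θ = θ₀) :
    Tendsto T atTop (𝓝 θ₀) := by
  refine hK.tendsto_nhds_of_unique_mapClusterPt hT fun θ hθ hcl => huniq θ hθ ?_
  by_contra! hlt
  obtain ⟨c, hc₁, hc₂⟩ := exists_between hlt
  have h1 : ∀ᶠ x in 𝓝 θ ×ˢ 𝓝 M₀, c < Function.uncurry f x := by
    rw [← nhds_prod_eq]
    exact (hf θ hθ).eventually_const_lt hc₂
  obtain ⟨pa, ha, pb, hb, hab⟩ := eventually_prod_iff.1 h1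
  have h2 := hM.eventually hb
  have h3 := (hf₀.tendsto.comp hM).eventually_lt_const hc₁
  obtain ⟨n, hn, h4, h5, h6⟩ := ((hcl.frequently ha).and_eventually (h2.and (h3.and hmin))).exists
  have := hab hn h4
  simp only [Function.uncurry_apply_pair, Function.comp_apply] at this h5
  linarith

/-! ### The normal likelihood of linear residuals -/

/-- The normal contrast (up to constants, `-2/n` times the log-likelihood) of `n` residuals with
second moment matrix `R` under the covariance matrix `S`. -/
noncomputable def normalContrast {k : Type*} [Fintype k] [DecidableEq k] (S R : Matrix k k ℝ) : ℝ :=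
  Real.log S.det + (S⁻¹ * R).trace

/-- The matrix of empirical second moments of the first `n` vectors of a sequence. -/
noncomputable def empMoment {ι : Type*} (v : ℕ → ι → ℝ) (n : ℕ) : Matrix ι ι ℝ :=
  Matrix.of fun a b => (∑ i ∈ Finset.range n, v i a * v i b) / n

theorem transpose_empMoment {ι : Type*} (v : ℕ → ι → ℝ) (n : ℕ) :
    (empMoment v n)ᵀ = empMoment v n := by
  ext a b
  simp [empMoment, mul_comm]

/-- Makes the quadratic form linear in `v vᵀ`, so that a sum over subjects acts on the moment matrix
alone. -/
theorem dotProduct_mulVec_mulVec_eq_trace {k ι : Type*} [Fintype k] [DecidableEq k] [Fintype ι]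
    (P : Matrix k k ℝ) (C : Matrix k ι ℝ) (v : ι → ℝ) :
    (C *ᵥ v) ⬝ᵥ (P *ᵥ (C *ᵥ v)) = (P * (C * Matrix.vecMulVec v v * Cᵀ)).trace := by
  have : C * Matrix.vecMulVec v v * Cᵀ = Matrix.vecMulVec (C *ᵥ v) (C *ᵥ v) := by
    rw [Matrix.mul_vecMulVec, Matrix.vecMulVec_mul, Matrix.vecMul_transpose]
  rw [this, Matrix.mul_vecMulVec, Matrix.trace_vecMulVec, dotProduct_comm]

/-- The reduction of the likelihood to second moments. The empty sample is excluded because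
`empMoment` divides by `n`. -/
theorem sum_gaussianLogDensity {k : ℕ} {ι : Type*} [Fintype ι] {S : Matrix (Fin k) (Fin k) ℝ}
    (hS : 0 < S.det) (C : Matrix (Fin k) ι ℝ) (v : ℕ → ι → ℝ) {n : ℕ} (hn : n ≠ 0) :
    ∑ i ∈ Finset.range n, gaussianLogDensity S (C *ᵥ v i) =
      -(n / 2) * (k * Real.log (2 * Real.pi) +
        normalContrast S (C * empMoment v n * Cᵀ)) := by
  have hn' : (n : ℝ) ≠ 0 := by exact_mod_cast hn
  have hM : empMoment v n = (n : ℝ)⁻¹ • ∑ i ∈ Finset.range n, Matrix.vecMulVec (v i) (v i) := by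
    ext a b
    simp [empMoment, Matrix.sum_apply, Matrix.vecMulVec_apply, div_eq_inv_mul]
  have hlog : Real.log ((2 * Real.pi) • S).det = k * Real.log (2 * Real.pi) + Real.log S.det := by
    rw [Matrix.det_smul, Fintype.card_fin, Real.log_mul (by positivity) hS.ne', Real.log_pow]
  have htr : (S⁻¹ * (C * empMoment v n * Cᵀ)).trace =
      (n : ℝ)⁻¹ * ∑ i ∈ Finset.range n, (C *ᵥ v i) ⬝ᵥ (S⁻¹ *ᵥ (C *ᵥ v i)) := by
    simp_rw [dotProduct_mulVec_mulVec_eq_trace]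
    rw [hM, Matrix.mul_smul, Matrix.smul_mul, Matrix.mul_smul, Matrix.trace_smul, smul_eq_mul,
      Matrix.mul_sum, Matrix.sum_mul, Matrix.mul_sum, Matrix.trace_sum]
  simp only [gaussianLogDensity, hlog, normalContrast, htr]
  rw [← Finset.mul_sum, Finset.sum_add_distrib, Finset.sum_const, Finset.card_range, nsmul_eq_mul]
  field_simp
  ring

theorem normalContrast_le_of_sum_le {k : ℕ} {ι : Type*} [Fintype ι]
    {S S' : Matrix (Fin k) (Fin k) ℝ} (hS : 0 < S.det) (hS' : 0 < S'.det)
    (C C' : Matrix (Fin k) ι ℝ) (v : ℕ → ι → ℝ) {n : ℕ} (hn : n ≠ 0)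
    (h : ∑ i ∈ Finset.range n, gaussianLogDensity S' (C' *ᵥ v i) ≤
      ∑ i ∈ Finset.range n, gaussianLogDensity S (C *ᵥ v i)) :
    normalContrast S (C * empMoment v n * Cᵀ) ≤ normalContrast S' (C' * empMoment v n * C'ᵀ) := by
  rw [sum_gaussianLogDensity hS _ _ hn, sum_gaussianLogDensity hS' _ _ hn] at h
  have hn' : (0 : ℝ) < n := by exact_mod_cast Nat.pos_of_ne_zero hn
  nlinarith

theorem ContinuousAt.normalContrast {P : Type*} [TopologicalSpace P] {k : Type*} [Fintype k]
    [DecidableEq k] {S R : P → Matrix k k ℝ} {x : P} (hS : ContinuousAt S x)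
    (hR : ContinuousAt R x) (hx : (S x).det ≠ 0) :
    ContinuousAt (fun y => _root_.normalContrast (S y) (R y)) x := by
  have hdet : ContinuousAt (fun y => (S y).det) x :=
    (by fun_prop : Continuous fun P : Matrix k k ℝ => P.det).continuousAt.comp hS
  have hinv : ContinuousAt (fun y => (S y)⁻¹) x := by
    simp only [Matrix.inv_def, Ring.inverse_eq_inv']
    exact (hdet.inv₀ hx).smul
      ((by fun_prop : Continuous fun P : Matrix k k ℝ => P.adjugate).continuousAt.comp hS)
  have hmul : ContinuousAt (fun y => (S y)⁻¹ * R y) x :=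
    (by fun_prop : Continuous fun p : Matrix k k ℝ × Matrix k k ℝ => p.1 * p.2).continuousAt.comp
      (hinv.prodMk hR)
  exact (hdet.log hx).add
    ((by fun_prop : Continuous fun P : Matrix k k ℝ => P.trace).continuousAt.comp hmul)

/-- Factor `D = Bᵀ B`: the trace is the sum of the quadratic form of `P` over the rows of `B`, and
each summand is positive unless its row vanishes. -/
theorem Matrix.PosSemidef.eq_zero_of_trace_mul_le {k : Type*} [Fintype k] [DecidableEq k]
    {P D : Matrix k k ℝ} (hP : P.PosDef) (hD : D.PosSemidef) (h : (P * D).trace ≤ 0) : D = 0 := by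
  obtain ⟨B, hB⟩ : ∃ B : Matrix k k ℝ, D = Bᵀ * B := by
    open scoped MatrixOrder in
    obtain ⟨B, hB⟩ := CStarAlgebra.nonneg_iff_eq_star_mul_self.1 hD.nonneg
    exact ⟨B, by simpa [Matrix.star_eq_conjTranspose] using hB⟩
  have htr : (P * D).trace = ∑ i, B i ⬝ᵥ (P *ᵥ B i) := by
    rw [hB, ← Matrix.mul_assoc, Matrix.trace_mul_comm, ← Matrix.mul_assoc]
    refine Finset.sum_congr rfl fun i _ => ?_
    simp [Matrix.mul_apply, dotProduct, Matrix.mulVec, Finset.sum_mul, Finset.mul_sum]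
    rw [Finset.sum_comm]
    exact Finset.sum_congr rfl fun a _ => Finset.sum_congr rfl fun b _ => by ring
  have hnn : ∀ i, 0 ≤ B i ⬝ᵥ (P *ᵥ B i) := fun i => by
    simpa using hP.posSemidef.dotProduct_mulVec_nonneg (B i)
  have hB0 : B = 0 := by
    ext i j
    by_contra hne
    have hi : B i ≠ 0 := fun h0 => hne (by rw [h0]; rfl)
    have h1 : 0 < B i ⬝ᵥ (P *ᵥ B i) := by simpa using hP.dotProduct_mulVec_pos hi
    have h2 := Finset.single_le_sum (fun i _ => hnn i) (Finset.mem_univ i)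
    rw [← htr] at h2
    linarith
  rw [hB, hB0, Matrix.mul_zero]

/-! ### The limit contrast and its compact sublevel sets -/

section Population

variable {k ι : Type*} [Fintype k] [DecidableEq k] [Fintype ι]

/-- Pythagoras for residual moments: `hcross` says that the residual under `C₀` is orthogonal to the
change in the regression function. -/
theorem mul_mul_transpose_eq_add {k ι : Type*} [Fintype ι] {C C₀ : Matrix k ι ℝ} {M : Matrix ι ι ℝ}
    (hM : Mᵀ = M)
    (hcross : C₀ * M * (C - C₀)ᵀ = 0) :
    C * M * Cᵀ = C₀ * M * C₀ᵀ + (C - C₀) * M * (C - C₀)ᵀ := by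
  have hcross' : (C - C₀) * M * C₀ᵀ = 0 := by
    have := congrArg Matrix.transpose hcross
    simpa [Matrix.transpose_mul, hM, Matrix.mul_assoc] using this
  have : C * M * Cᵀ = C₀ * M * C₀ᵀ + (C - C₀) * M * (C - C₀)ᵀ + C₀ * M * (C - C₀)ᵀ +
      (C - C₀) * M * C₀ᵀ := by
    simp only [Matrix.transpose_sub, Matrix.mul_sub, Matrix.sub_mul]
    abel
  rw [this, hcross, hcross', add_zero, add_zero]

theorem Matrix.PosSemidef.mul_mul_transpose_same {k ι : Type*} [Fintype k] [Fintype ι]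
    {M : Matrix ι ι ℝ} (hM : M.PosSemidef)
    (C : Matrix k ι ℝ) : (C * M * Cᵀ).PosSemidef := by
  simpa using hM.mul_mul_conjTranspose_same C

/-- The population contrast is uniquely minimised at the true covariance matrix and the true
regression coefficients. -/
theorem eq_of_normalContrast_le {S S₀ : Matrix k k ℝ} (hS : S.PosDef) (hS₀ : S₀.PosDef)
    {C C₀ : Matrix k ι ℝ} {M : Matrix ι ι ℝ} (hM : M.PosSemidef)
    (hcov : C₀ * M * C₀ᵀ = S₀) (hcross : C₀ * M * (C - C₀)ᵀ = 0)
    (h : normalContrast S (C * M * Cᵀ) ≤ normalContrast S₀ (C₀ * M * C₀ᵀ)) :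
    S = S₀ ∧ (C - C₀) * M * (C - C₀)ᵀ = 0 := by
  have hM' : Mᵀ = M := (by simpa using hM.isHermitian : M.IsSymm)
  -- The contrast becomes the Gibbs term for `S` against `S₀` plus the nonnegative trace of `S⁻¹`
  -- times the misfit. The hypothesis forces equality in both.
  rw [mul_mul_transpose_eq_add hM' hcross, hcov] at h
  have hD := hM.mul_mul_transpose_same (C - C₀)
  have hD0 := hS.inv.posSemidef.trace_mul_nonneg hD
  have hS₀u : IsUnit S₀.det := (Matrix.isUnit_iff_isUnit_det _).1 hS₀.isUnit
  simp only [normalContrast, Matrix.mul_add, Matrix.trace_add, Matrix.nonsing_inv_mul _ hS₀u,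
    Matrix.trace_one] at h
  obtain ⟨h1, h2⟩ := hS.log_det_add_card_le hS₀
  refine ⟨h2 (by linarith), ?_⟩
  exact Matrix.PosSemidef.eq_zero_of_trace_mul_le hS.inv hD (by linarith)

/-- `|xᵀ E x| ≤ δ (∑ |xᵢ|)²`, and Cauchy–Schwarz bounds the squared sum by the dimension times
`|x|²`. -/
theorem smul_one_add_posSemidef_of_abs_le {E : Matrix k k ℝ} (hE : Eᵀ = E) {δ : ℝ}
    (hδ : ∀ i j, |E i j| ≤ δ) :
    ((δ * Fintype.card k) • (1 : Matrix k k ℝ) + E).PosSemidef := by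
  refine Matrix.PosSemidef.of_dotProduct_mulVec_nonneg ?_ fun x => ?_
  · simp [Matrix.IsHermitian, hE, Matrix.transpose_smul]
  · have h1 : |x ⬝ᵥ (E *ᵥ x)| ≤ δ * (∑ i, |x i|) ^ 2 := by
      simp only [dotProduct, Matrix.mulVec, Finset.mul_sum]
      rw [sq, Finset.sum_mul_sum, Finset.mul_sum]
      refine (Finset.abs_sum_le_sum_abs _ _).trans (Finset.sum_le_sum fun i _ => ?_)
      rw [Finset.mul_sum]
      refine (Finset.abs_sum_le_sum_abs _ _).trans (Finset.sum_le_sum fun j _ => ?_)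
      rw [abs_mul, abs_mul]
      have := mul_le_mul_of_nonneg_right (hδ i j) (mul_nonneg (abs_nonneg (x i)) (abs_nonneg (x j)))
      linarith
    have h2 : (∑ i, |x i|) ^ 2 ≤ Fintype.card k * (x ⬝ᵥ x) := by
      have := sq_sum_le_card_mul_sum_sq (s := Finset.univ) (f := fun i => |x i|)
      simpa [dotProduct, sq] using this
    rcases isEmpty_or_nonempty k with hk | ⟨⟨i⟩⟩
    · simp [dotProduct]
    · have hδ0 : 0 ≤ δ := (abs_nonneg _).trans (hδ i i)
      simp only [star_trivial, Matrix.add_mulVec, Matrix.smul_mulVec, Matrix.one_mulVec,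
        dotProduct_add, dotProduct_smul, smul_eq_mul]
      nlinarith [abs_le.1 h1, mul_le_mul_of_nonneg_left h2 hδ0]

/-- With `S = Bᵀ B`, `|x|² = |B⁻¹ B x|² ≤ F xᵀ S x`, where `F` is the squared Frobenius norm of
`B⁻¹`. The constant `1 / (F + 1)` stays meaningful when `F = 0`, the case of dimension zero. -/
theorem exists_sub_smul_one_posSemidef {S : Matrix k k ℝ} (hS : S.PosDef) :
    ∃ c : ℝ, 0 < c ∧ (S - c • (1 : Matrix k k ℝ)).PosSemidef := by
  obtain ⟨B, hB, hBu⟩ := hS.exists_transpose_mul_self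
  have hBd := (Matrix.isUnit_iff_isUnit_det _).1 hBu
  set F : ℝ := ∑ i, ∑ j, (B⁻¹ i j) ^ 2
  have hF : 0 ≤ F := Finset.sum_nonneg fun i _ => Finset.sum_nonneg fun j _ => sq_nonneg _
  refine ⟨(F + 1)⁻¹, by positivity, Matrix.PosSemidef.of_dotProduct_mulVec_nonneg ?_ fun x => ?_⟩
  · simpa [Matrix.IsHermitian, Matrix.transpose_smul] using hS.isHermitian
  · have h1 : x ⬝ᵥ x ≤ F * ((B *ᵥ x) ⬝ᵥ (B *ᵥ x)) := by
      have hx : x = B⁻¹ *ᵥ (B *ᵥ x) := by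
        rw [Matrix.mulVec_mulVec, Matrix.nonsing_inv_mul _ hBd, Matrix.one_mulVec]
      have h2 : ∀ i, x i * x i ≤ (∑ j, (B⁻¹ i j) ^ 2) * ((B *ᵥ x) ⬝ᵥ (B *ᵥ x)) := fun i => by
        have := Finset.sum_mul_sq_le_sq_mul_sq Finset.univ (B⁻¹ i) (B *ᵥ x)
        calc x i * x i = (∑ j, B⁻¹ i j * (B *ᵥ x) j) ^ 2 := by
              rw [sq]; congr 1 <;> exact congrFun hx i
          _ ≤ _ := this
          _ = _ := by simp only [dotProduct, sq]
      rw [Finset.sum_mul]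
      exact Finset.sum_le_sum fun i _ => h2 i
    have h3 : x ⬝ᵥ (S *ᵥ x) = (B *ᵥ x) ⬝ᵥ (B *ᵥ x) := by
      rw [hB, ← Matrix.mulVec_mulVec, Matrix.dotProduct_mulVec, Matrix.vecMul_transpose]
    have h4 : 0 ≤ (B *ᵥ x) ⬝ᵥ (B *ᵥ x) := Finset.sum_nonneg fun i _ => mul_self_nonneg _
    simp only [star_trivial, Matrix.sub_mulVec, Matrix.smul_mulVec, Matrix.one_mulVec,
      dotProduct_sub, dotProduct_smul, smul_eq_mul, h3]
    rw [sub_nonneg, inv_mul_le_iff₀ (by positivity)]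
    linarith

/-- The substitute for compactness of the covariance parameters. Bounded designs make `C Mₙ Cᵀ`
uniformly close to `C M₀ Cᵀ ≥ S₀ ≥ c`, so eventually the residual moments are at least `c / 2`,
whatever the estimator does. -/
theorem exists_isCompact_of_normalContrast_le {S₀ : Matrix k k ℝ} (hS₀ : S₀.PosDef)
    {M : ℕ → Matrix ι ι ℝ} {M₀ : Matrix ι ι ℝ} (hM : Tendsto M atTop (𝓝 M₀))
    (hMs : ∀ n, (M n)ᵀ = M n) {C : ℕ → Matrix k ι ℝ} {t : ℝ}
    (hC : ∀ᶠ n in atTop, ∀ i j, |C n i j| ≤ t)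
    (hlow : ∀ᶠ n in atTop, (C n * M₀ * (C n)ᵀ - S₀).PosSemidef) (b : ℝ) :
    ∃ K : Set (Matrix k k ℝ), IsCompact K ∧ (∀ S ∈ K, S.det ≠ 0) ∧
      ∀ᶠ n in atTop, ∀ S : Matrix k k ℝ, S.PosDef →
        normalContrast S (C n * M n * (C n)ᵀ) ≤ b → S ∈ K := by
  obtain ⟨c, hc, hcS⟩ := exists_sub_smul_one_posSemidef hS₀
  obtain ⟨K, hK, hK0, hKmem⟩ := exists_isCompact_of_logdet_add_trace_le (n := k) (half_pos hc) b
  refine ⟨K, hK, hK0, ?_⟩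
  -- Chosen so that `δ` times the dimension is at most `c / 2`, also in dimension zero.
  set δ : ℝ := c / 2 / (Fintype.card k + 1) with hδ
  have hδ0 : 0 < δ := by positivity
  have hM₀s : M₀ᵀ = M₀ := by
    refine tendsto_nhds_unique ?_ hM
    have := ((by fun_prop : Continuous fun A : Matrix ι ι ℝ => Aᵀ).tendsto M₀).comp hM
    exact this.congr fun n => hMs n
  have hsmall : ∀ᶠ n in atTop, t ^ 2 * ∑ a, ∑ b, |(M n - M₀) a b| < δ := by
    have h1 : Tendsto (fun n => t ^ 2 * ∑ a, ∑ b, |(M n - M₀) a b|) atTop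
        (𝓝 (t ^ 2 * ∑ a, ∑ b, |(M₀ - M₀) a b|)) :=
      ((by fun_prop : Continuous fun A : Matrix ι ι ℝ =>
        t ^ 2 * ∑ a, ∑ b, |(A - M₀) a b|).tendsto M₀).comp hM
    refine h1.eventually_lt_const ?_
    simpa using hδ0
  filter_upwards [hC, hlow, hsmall] with n hCn hlown hsmalln S hS hle
  refine hKmem S _ hS ?_ hle
  set E := C n * (M n - M₀) * (C n)ᵀ with hE
  have hEs : Eᵀ = E := by
    simp [hE, Matrix.transpose_mul, Matrix.transpose_sub, hMs, hM₀s, Matrix.mul_assoc]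
  have hEb : ∀ i j, |E i j| ≤ δ := fun i j => by
    refine le_trans ?_ hsmalln.le
    simp only [hE, Matrix.mul_apply, Matrix.transpose_apply, Finset.sum_mul]
    rw [Finset.sum_comm, Finset.mul_sum]
    refine (Finset.abs_sum_le_sum_abs _ _).trans (Finset.sum_le_sum fun a _ => ?_)
    rw [Finset.mul_sum]
    refine (Finset.abs_sum_le_sum_abs _ _).trans (Finset.sum_le_sum fun b _ => ?_)
    rw [abs_mul, abs_mul, sq]
    have h1 : |C n i a| * |C n j b| ≤ t * t :=
      mul_le_mul (hCn i a) (hCn j b) (abs_nonneg _) ((abs_nonneg _).trans (hCn i a))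
    have := mul_le_mul_of_nonneg_right h1 (abs_nonneg ((M n - M₀) a b))
    linarith
  have hE1 := smul_one_add_posSemidef_of_abs_le hEs hEb
  have hrest : ((c / 2 - δ * Fintype.card k) • (1 : Matrix k k ℝ)).PosSemidef := by
    refine Matrix.PosSemidef.one.smul ?_
    have : δ * (Fintype.card k + 1) = c / 2 := by rw [hδ]; field_simp
    nlinarith
  -- `C Mₙ Cᵀ - (c/2) I` as a sum of four positive semidefinite matrices: `C M₀ Cᵀ - S₀`, `S₀ - c
  -- I`, `δ|k| I + E` and `(c/2 - δ|k|) I`.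
  have hsum := ((hlown.add hcS).add hE1).add hrest
  convert hsum using 1
  rw [hE, Matrix.mul_sub, Matrix.sub_mul]
  ext i j
  simp only [Matrix.sub_apply, Matrix.add_apply, Matrix.smul_apply, smul_eq_mul]
  ring

end Population

/-! ### Continuity of matrix expressions, and the compact case of minimum contrast estimation -/

section ContinuousAt

variable {X m n k : Type*} [TopologicalSpace X] [Fintype n] {x : X}

theorem ContinuousAt.matrix_mul {A : X → Matrix m n ℝ} {B : X → Matrix n k ℝ}
    (hA : ContinuousAt A x) (hB : ContinuousAt B x) : ContinuousAt (fun y => A y * B y) x :=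
  ContinuousAt.comp₂ (f := fun p : Matrix m n ℝ × Matrix n k ℝ => p.1 * p.2)
    (continuous_fst.matrix_mul continuous_snd).continuousAt hA hB

theorem ContinuousAt.matrix_mulVec {A : X → Matrix m n ℝ} {v : X → n → ℝ}
    (hA : ContinuousAt A x) (hv : ContinuousAt v x) : ContinuousAt (fun y => A y *ᵥ v y) x :=
  ContinuousAt.comp₂ (f := fun p : Matrix m n ℝ × (n → ℝ) => p.1 *ᵥ p.2)
    (continuous_fst.matrix_mulVec continuous_snd).continuousAt hA hv

theorem ContinuousAt.matrix_transpose {A : X → Matrix m k ℝ} (hA : ContinuousAt A x) :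
    ContinuousAt (fun y => (A y)ᵀ) x :=
  ContinuousAt.comp (g := fun A : Matrix m k ℝ => Aᵀ)
    continuous_id.matrix_transpose.continuousAt hA

theorem ContinuousAt.matrix_inv [DecidableEq n] {A : X → Matrix n n ℝ} (hA : ContinuousAt A x)
    (hx : (A x).det ≠ 0) : ContinuousAt (fun y => (A y)⁻¹) x := by
  simp only [Matrix.inv_def, Ring.inverse_eq_inv']
  exact ((ContinuousAt.comp (g := fun A : Matrix n n ℝ => A.det)
    continuous_id.matrix_det.continuousAt hA).inv₀ hx).smul
    (ContinuousAt.comp (g := fun A : Matrix n n ℝ => A.adjugate)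
    continuous_id.matrix_adjugate.continuousAt hA)

theorem ContinuousAt.fromCols {n₁ n₂ : Type*} {A : X → Matrix m n₁ ℝ} {B : X → Matrix m n₂ ℝ}
    (hA : ContinuousAt A x) (hB : ContinuousAt B x) :
    ContinuousAt (fun y => Matrix.fromCols (A y) (B y)) x := by
  refine ContinuousAt.comp₂ (f := fun p : Matrix m n₁ ℝ × Matrix m n₂ ℝ =>
    Matrix.fromCols p.1 p.2) (Continuous.continuousAt (continuous_matrix fun i j => ?_)) hA hB
  rcases j with j | j
  · exact continuous_fst.matrix_elem i j
  · exact continuous_snd.matrix_elem i j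

theorem ContinuousAt.replicateCol {ι : Type*} {v : X → m → ℝ} (hv : ContinuousAt v x) :
    ContinuousAt (fun y => Matrix.replicateCol ι (v y)) x :=
  ContinuousAt.comp (g := fun v : m → ℝ => Matrix.replicateCol ι v)
    (Continuous.continuousAt (continuous_matrix fun i _ => continuous_apply i)) hv

end ContinuousAt

theorem Matrix.replicateCol_mulVec_one {m : Type*} (v : m → ℝ) :
    Matrix.replicateCol Unit v *ᵥ (fun _ => (1 : ℝ)) = v := by
  ext i; simp [Matrix.mulVec, dotProduct]

/-- Consistency of minimum contrast estimation in a regression model with compact parameter set. -/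
theorem tendsto_of_normalContrast_le {P k ι : Type*} [TopologicalSpace P] [Fintype k]
    [DecidableEq k] [Fintype ι] {K : Set P} (hK : IsCompact K) {S : P → Matrix k k ℝ}
    {C : P → Matrix k ι ℝ} (hSc : ∀ θ ∈ K, ContinuousAt S θ) (hCc : ∀ θ ∈ K, ContinuousAt C θ)
    (hS : ∀ θ ∈ K, (S θ).PosDef) {θ₀ : P} (hS₀ : (S θ₀).PosDef)
    {M : ℕ → Matrix ι ι ℝ} {M₀ : Matrix ι ι ℝ} (hM : Tendsto M atTop (𝓝 M₀))
    (hM₀ : M₀.PosSemidef) (hcov : C θ₀ * M₀ * (C θ₀)ᵀ = S θ₀)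
    (hcross : ∀ θ ∈ K, C θ₀ * M₀ * (C θ - C θ₀)ᵀ = 0) {T : ℕ → P}
    (hT : ∀ᶠ n in atTop, T n ∈ K)
    (hmin : ∀ᶠ n in atTop, normalContrast (S (T n)) (C (T n) * M n * (C (T n))ᵀ) ≤
      normalContrast (S θ₀) (C θ₀ * M n * (C θ₀)ᵀ))
    (huniq : ∀ θ ∈ K, S θ = S θ₀ → (C θ - C θ₀) * M₀ * (C θ - C θ₀)ᵀ = 0 → θ = θ₀) :
    Tendsto T atTop (𝓝 θ₀) := by
  refine tendsto_of_eventually_le_of_unique hK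
    (f := fun θ M => normalContrast (S θ) (C θ * M * (C θ)ᵀ)) hM hT (fun θ hθ => ?_) ?_ hmin ?_
  · have hC1 : ContinuousAt (fun p : P × Matrix ι ι ℝ => C p.1) (θ, M₀) :=
      (hCc θ hθ).comp (x := (θ, M₀)) (f := Prod.fst) continuousAt_fst
    refine ContinuousAt.normalContrast (P := P × Matrix ι ι ℝ) (S := fun p => S p.1)
      (R := fun p => C p.1 * p.2 * (C p.1)ᵀ) ?_ ?_ (hS θ hθ).det_pos.ne'
    · exact (hSc θ hθ).comp (x := (θ, M₀)) (f := Prod.fst) continuousAt_fst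
    · exact (hC1.matrix_mul continuousAt_snd).matrix_mul hC1.matrix_transpose
  · exact ContinuousAt.normalContrast continuousAt_const
      ((continuousAt_const.matrix_mul continuousAt_id).matrix_mul continuousAt_const)
      hS₀.det_pos.ne'
  · intro θ hθ hle
    obtain ⟨h1, h2⟩ := eq_of_normalContrast_le (hS θ hθ) hS₀ hM₀ hcov (hcross θ hθ) hle
    exact huniq θ hθ h1 h2

/-! ### The stage-one model as a regression on `(x, 1, z)` -/

namespace Stage1Param

variable {r q h : ℕ}

theorem isInducing : Topology.IsInducing
    fun θ : Stage1Param r q h => (θ.α, θ.B, θ.Γ, θ.Ψ, θ.ν, θ.Λ, θ.K, θ.Ω) := ⟨rfl⟩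

theorem continuous_α : Continuous fun θ : Stage1Param r q h => θ.α :=
  isInducing.continuous.fst

theorem continuous_B : Continuous fun θ : Stage1Param r q h => θ.B :=
  isInducing.continuous.snd.fst

theorem continuous_Γ : Continuous fun θ : Stage1Param r q h => θ.Γ :=
  isInducing.continuous.snd.snd.fst

theorem continuous_Ψ : Continuous fun θ : Stage1Param r q h => θ.Ψ :=
  isInducing.continuous.snd.snd.snd.fst

theorem continuous_ν : Continuous fun θ : Stage1Param r q h => θ.ν :=
  isInducing.continuous.snd.snd.snd.snd.fst

theorem continuous_Λ : Continuous fun θ : Stage1Param r q h => θ.Λ :=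
  isInducing.continuous.snd.snd.snd.snd.snd.fst

theorem continuous_K : Continuous fun θ : Stage1Param r q h => θ.K :=
  isInducing.continuous.snd.snd.snd.snd.snd.snd.fst

theorem continuous_Ω : Continuous fun θ : Stage1Param r q h => θ.Ω :=
  isInducing.continuous.snd.snd.snd.snd.snd.snd.snd

theorem continuousAt_inv {θ : Stage1Param r q h} (hθ : θ.Admissible) :
    ContinuousAt (fun θ : Stage1Param r q h => (1 - θ.B)⁻¹) θ :=
  (continuous_const.sub continuous_B).continuousAt.matrix_inv hθ.solvable.ne_zero

theorem continuousAt_meanXi {θ : Stage1Param r q h} (hθ : θ.Admissible) (z : Fin r → ℝ) :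
    ContinuousAt (fun θ : Stage1Param r q h => θ.meanXi z) θ :=
  (continuousAt_inv hθ).matrix_mulVec
    (continuous_α.continuousAt.add (continuous_Γ.continuousAt.matrix_mulVec continuousAt_const))

theorem continuousAt_covXi {θ : Stage1Param r q h} (hθ : θ.Admissible) :
    ContinuousAt (fun θ : Stage1Param r q h => θ.covXi) θ :=
  ((continuousAt_inv hθ).matrix_mul continuous_Ψ.continuousAt).matrix_mul
    (continuousAt_inv hθ).matrix_transpose

theorem continuousAt_covX {θ : Stage1Param r q h} (hθ : θ.Admissible) :
    ContinuousAt (fun θ : Stage1Param r q h => θ.covX) θ :=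
  ((continuous_Λ.continuousAt.matrix_mul (continuousAt_covXi hθ)).matrix_mul
    continuous_Λ.continuousAt.matrix_transpose).add continuous_Ω.continuousAt

/-- The coefficients of the residual `x - E[X | Z = z]` as a linear function of `(x, 1, z)`. -/
noncomputable def design (θ : Stage1Param r q h) : Matrix (Fin h) (Fin h ⊕ Unit ⊕ Fin r) ℝ :=
  Matrix.fromCols 1 (Matrix.fromCols (-Matrix.replicateCol Unit (θ.ν + θ.Λ *ᵥ θ.meanXi 0))
    (-(θ.Λ * ((1 - θ.B)⁻¹ * θ.Γ) + θ.K)))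

/-- The regression vector `(x, 1, z)`. -/
def dataVec (x : Fin h → ℝ) (z : Fin r → ℝ) : Fin h ⊕ Unit ⊕ Fin r → ℝ :=
  Sum.elim x (Sum.elim (fun _ => 1) z)

theorem design_mulVec (θ : Stage1Param r q h) (x : Fin h → ℝ) (z : Fin r → ℝ) :
    θ.design *ᵥ dataVec x z = x - θ.meanX z := by
  simp only [design, dataVec, Matrix.fromCols_mulVec_sumElim, Matrix.one_mulVec,
    Matrix.neg_mulVec, Matrix.replicateCol_mulVec_one, meanX, meanXi, Matrix.add_mulVec,
    Matrix.mulVec_add, Matrix.mulVec_zero, add_zero, ← Matrix.mulVec_mulVec]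
  abel

theorem continuousAt_design {θ : Stage1Param r q h} (hθ : θ.Admissible) :
    ContinuousAt (fun θ : Stage1Param r q h => θ.design) θ := by
  refine continuousAt_const.fromCols (ContinuousAt.fromCols ?_ ?_)
  · exact (continuous_ν.continuousAt.add
      (continuous_Λ.continuousAt.matrix_mulVec (continuousAt_meanXi hθ 0))).replicateCol.neg
  · exact ((continuous_Λ.continuousAt.matrix_mul ((continuousAt_inv hθ).matrix_mul
      continuous_Γ.continuousAt)).add continuous_K.continuousAt).neg

theorem Admissible.covXi_posDef {θ : Stage1Param r q h} (hθ : θ.Admissible) :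
    θ.covXi.PosDef := by
  have hu : IsUnit (1 - θ.B)⁻¹ :=
    (Matrix.isUnit_nonsing_inv_iff).2 ((Matrix.isUnit_iff_isUnit_det _).2 hθ.solvable)
  simpa [covXi] using hθ.psi_posDef.mul_mul_conjTranspose_same
    (Matrix.vecMul_injective_of_isUnit hu)

theorem Admissible.covX_posDef {θ : Stage1Param r q h} (hθ : θ.Admissible) : θ.covX.PosDef :=
  hθ.omega_posDef.posSemidef_add (hθ.covXi_posDef.posSemidef.mul_mul_transpose_same θ.Λ)

end Stage1Param

/-! ### The stage-two model as a regression, and compactness in its parameter space -/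

namespace Stage2Param

variable {r h l p m : ℕ}

theorem isInducing : Topology.IsInducing fun θ : Stage2Param r h l p m =>
    (θ.α, θ.B, θ.Γ, θ.Ψ, θ.ν, θ.Λ, θ.K, θ.L, θ.Ω) := ⟨rfl⟩

theorem continuous_α : Continuous fun θ : Stage2Param r h l p m => θ.α :=
  isInducing.continuous.fst

theorem continuous_B : Continuous fun θ : Stage2Param r h l p m => θ.B :=
  isInducing.continuous.snd.fst

theorem continuous_Γ : Continuous fun θ : Stage2Param r h l p m => θ.Γ :=
  isInducing.continuous.snd.snd.fst

theorem continuous_Ψ : Continuous fun θ : Stage2Param r h l p m => θ.Ψ :=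
  isInducing.continuous.snd.snd.snd.fst

theorem continuous_ν : Continuous fun θ : Stage2Param r h l p m => θ.ν :=
  isInducing.continuous.snd.snd.snd.snd.fst

theorem continuous_Λ : Continuous fun θ : Stage2Param r h l p m => θ.Λ :=
  isInducing.continuous.snd.snd.snd.snd.snd.fst

theorem continuous_K : Continuous fun θ : Stage2Param r h l p m => θ.K :=
  isInducing.continuous.snd.snd.snd.snd.snd.snd.fst

theorem continuous_L : Continuous fun θ : Stage2Param r h l p m => θ.L :=
  isInducing.continuous.snd.snd.snd.snd.snd.snd.snd.fst

theorem continuous_Ω : Continuous fun θ : Stage2Param r h l p m => θ.Ω :=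
  isInducing.continuous.snd.snd.snd.snd.snd.snd.snd.snd

theorem continuous_covY : Continuous fun θ : Stage2Param r h l p m => θ.covY :=
  ((continuous_Λ.matrix_mul continuous_Ψ).matrix_mul continuous_Λ.matrix_transpose).add
    continuous_Ω

/-- The parameter with given coefficients and covariance matrices. -/
def ofCoef (c : (Fin p → ℝ) × Matrix (Fin p) (Fin l) ℝ × Matrix (Fin p) (Fin r) ℝ ×
    (Fin m → ℝ) × Matrix (Fin m) (Fin p) ℝ × Matrix (Fin m) (Fin r) ℝ × Matrix (Fin m) (Fin h) ℝ)
    (Ψ : Matrix (Fin p) (Fin p) ℝ) (Ω : Matrix (Fin m) (Fin m) ℝ) : Stage2Param r h l p m :=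
  ⟨c.1, c.2.1, c.2.2.1, Ψ, c.2.2.2.1, c.2.2.2.2.1, c.2.2.2.2.2.1, c.2.2.2.2.2.2, Ω⟩

theorem continuous_ofCoef : Continuous fun x : ((Fin p → ℝ) × Matrix (Fin p) (Fin l) ℝ ×
    Matrix (Fin p) (Fin r) ℝ × (Fin m → ℝ) × Matrix (Fin m) (Fin p) ℝ ×
    Matrix (Fin m) (Fin r) ℝ × Matrix (Fin m) (Fin h) ℝ) × Matrix (Fin p) (Fin p) ℝ ×
    Matrix (Fin m) (Fin m) ℝ =>
    (ofCoef x.1 x.2.1 x.2.2 : Stage2Param r h l p m) := by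
  rw [isInducing.continuous_iff]
  exact continuous_fst.fst.prodMk (continuous_fst.snd.fst.prodMk
    (continuous_fst.snd.snd.fst.prodMk (continuous_snd.fst.prodMk
    (continuous_fst.snd.snd.snd.fst.prodMk (continuous_fst.snd.snd.snd.snd.fst.prodMk
    (continuous_fst.snd.snd.snd.snd.snd.fst.prodMk (continuous_fst.snd.snd.snd.snd.snd.snd.prodMk
    continuous_snd.snd)))))))

/-- The coefficients of the residual `y - E[Y | Z = z, X = x, f]` as a linear function of
`(y, 1, z, x, f)`. -/
noncomputable def design (θ : Stage2Param r h l p m) :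
    Matrix (Fin m) (Fin m ⊕ Unit ⊕ Fin r ⊕ Fin h ⊕ Fin l) ℝ :=
  Matrix.fromCols 1 (Matrix.fromCols (-Matrix.replicateCol Unit (θ.ν + θ.Λ *ᵥ θ.α))
    (Matrix.fromCols (-(θ.Λ * θ.Γ + θ.K)) (Matrix.fromCols (-θ.L) (-(θ.Λ * θ.B)))))

/-- The regression vector `(y, 1, z, x, f)`. -/
def dataVec (y : Fin m → ℝ) (z : Fin r → ℝ) (x : Fin h → ℝ) (f : Fin l → ℝ) :
    Fin m ⊕ Unit ⊕ Fin r ⊕ Fin h ⊕ Fin l → ℝ :=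
  Sum.elim y (Sum.elim (fun _ => 1) (Sum.elim z (Sum.elim x f)))

theorem design_mulVec (θ : Stage2Param r h l p m) (y : Fin m → ℝ) (z : Fin r → ℝ)
    (x : Fin h → ℝ) (f : Fin l → ℝ) :
    θ.design *ᵥ dataVec y z x f = y - θ.meanY z x f := by
  simp only [design, dataVec, Matrix.fromCols_mulVec_sumElim, Matrix.one_mulVec,
    Matrix.neg_mulVec, Matrix.replicateCol_mulVec_one, meanY, Matrix.add_mulVec,
    Matrix.mulVec_add, ← Matrix.mulVec_mulVec]
  abel

theorem continuous_design : Continuous fun θ : Stage2Param r h l p m => θ.design := by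
  refine continuous_iff_continuousAt.2 fun θ => continuousAt_const.fromCols
    (ContinuousAt.fromCols ?_ (ContinuousAt.fromCols ?_ (ContinuousAt.fromCols ?_ ?_)))
  · exact (continuous_ν.continuousAt.add
      (continuous_Λ.continuousAt.matrix_mulVec continuous_α.continuousAt)).replicateCol.neg
  · exact ((continuous_Λ.continuousAt.matrix_mul continuous_Γ.continuousAt).add
      continuous_K.continuousAt).neg
  · exact continuous_L.continuousAt.neg
  · exact (continuous_Λ.continuousAt.matrix_mul continuous_B.continuousAt).neg

theorem exists_design_bound {C : Set _} (hC : IsCompact C) :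
    ∃ t : ℝ, ∀ θ : Stage2Param r h l p m, θ.coef ∈ C → ∀ i j, |θ.design i j| ≤ t := by
  -- The design does not involve `Ψ` and `Ω`, so their zero values are placeholders; the bound is
  -- uniform over all covariance parameters.
  have h0 : Continuous fun c => (ofCoef c 0 0 : Stage2Param r h l p m) :=
    continuous_ofCoef.comp (continuous_id.prodMk (continuous_const (y := (0, 0))))
  have hcont : Continuous fun c => ∑ i, ∑ j, |(ofCoef c 0 0 : Stage2Param r h l p m).design i j| :=
    continuous_finsetSum _ fun i _ => continuous_finsetSum _ fun j _ =>
      ((continuous_design.comp h0).matrix_elem i j).abs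
  obtain ⟨t, ht⟩ := hC.exists_bound_of_continuousOn hcont.continuousOn
  refine ⟨t, fun θ hθ i j => le_trans ?_ ((le_abs_self _).trans (ht _ hθ))⟩
  refine le_trans ?_ (Finset.single_le_sum (f := fun i => ∑ j, |θ.design i j|)
    (fun i _ => Finset.sum_nonneg fun j _ => abs_nonneg _) (Finset.mem_univ i))
  exact Finset.single_le_sum (f := fun j => |θ.design i j|)
    (fun j _ => abs_nonneg _) (Finset.mem_univ j)

/-- The row of `Λ` at a reference indicator is a unit vector, so `Ψ a a` occurs as a diagonal entry
of `Λ Ψ Λᵀ`. Both summands of `covY` have nonnegative diagonals, so neither `Ψ` nor `Ω` can blow up;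
their traces then bound all entries. -/
theorem abs_le_of_covY_le {θ : Stage2Param r h l p m} (hΨ : θ.Ψ.PosSemidef)
    (hΩ : θ.Ω.PosSemidef) {ref : Fin p → Fin m}
    (href : ∀ a b, θ.Λ (ref a) b = if a = b then 1 else 0) {s : ℝ} (hs : ∀ i, θ.covY i i ≤ s) :
    (∀ a b, |θ.Ψ a b| ≤ p * s) ∧ ∀ i j, |θ.Ω i j| ≤ m * s := by
  have hΛ : ∀ i, 0 ≤ (θ.Λ * θ.Ψ * θ.Λᵀ) i i := fun i =>
    (hΨ.mul_mul_transpose_same θ.Λ).diag_nonneg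
  have hrefΨ : ∀ a, (θ.Λ * θ.Ψ * θ.Λᵀ) (ref a) (ref a) = θ.Ψ a a := fun a => by
    simp [Matrix.mul_apply, href]
  constructor
  · intro a b
    refine (hΨ.abs_apply_le_trace a b).trans ?_
    have : ∀ a, θ.Ψ a a ≤ s := fun a => by
      have h1 := hs (ref a)
      rw [covY, Matrix.add_apply, hrefΨ] at h1
      linarith [hΩ.diag_nonneg (i := ref a)]
    simpa [Matrix.trace] using Finset.sum_le_sum fun a (_ : a ∈ Finset.univ) => this a
  · intro i j
    refine (hΩ.abs_apply_le_trace i j).trans ?_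
    have : ∀ i, θ.Ω i i ≤ s := fun i => by
      have h1 := hs i
      rw [covY, Matrix.add_apply] at h1
      linarith [hΛ i]
    simpa [Matrix.trace] using Finset.sum_le_sum fun a (_ : a ∈ Finset.univ) => this a

theorem covY_posSemidef {θ : Stage2Param r h l p m} (hΨ : θ.Ψ.PosSemidef)
    (hΩ : θ.Ω.PosSemidef) : θ.covY.PosSemidef :=
  (hΨ.mul_mul_transpose_same θ.Λ).add hΩ

/-- Parameters whose modelled covariance matrix of `Y` lies in a compact set of invertible matrices
form a compact set. -/
theorem IsParameterSpace.isCompact_setOf_covY_mem {Θ : Set (Stage2Param r h l p m)}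
    (hΘ : IsParameterSpace Θ) {V : Set (Matrix (Fin m) (Fin m) ℝ)} (hV : IsCompact V)
    (hV0 : ∀ S ∈ V, S.det ≠ 0) : IsCompact {θ ∈ Θ | θ.covY ∈ V} := by
  obtain ⟨C, hC, hcoef⟩ := hΘ.coef_bounded
  obtain ⟨ref, href⟩ := hΘ.reference
  obtain ⟨s, hs⟩ := hV.exists_bound_of_continuousOn
    (f := fun S : Matrix (Fin m) (Fin m) ℝ => S.trace) continuous_id.matrix_trace.continuousOn
  have hdiag : ∀ θ ∈ Θ, θ.covY ∈ V → ∀ i, θ.covY i i ≤ s := fun θ hθ hmem i => by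
    have hps := covY_posSemidef (hΘ.admissible θ hθ).1 (hΘ.admissible θ hθ).2
    exact (le_abs_self _).trans ((hps.abs_apply_le_trace i i).trans
      ((le_abs_self _).trans (hs _ hmem)))
  have himage : IsCompact ((fun x : _ × Matrix (Fin p) (Fin p) ℝ × Matrix (Fin m) (Fin m) ℝ =>
      (ofCoef x.1 x.2.1 x.2.2 : Stage2Param r h l p m)) ''
      (C ×ˢ ({Ψ | ∀ a b, |Ψ a b| ≤ p * s} ×ˢ {Ω | ∀ i j, |Ω i j| ≤ m * s}))) :=
    (hC.prod ((Matrix.isCompact_setOf_forall_abs_le _).prod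
      (Matrix.isCompact_setOf_forall_abs_le _))).image continuous_ofCoef
  refine himage.of_isClosed_subset ?_ ?_
  · have hset : {θ ∈ Θ | θ.covY ∈ V} = closure Θ ∩ {θ | θ.Ψ.PosSemidef} ∩ {θ | θ.Ω.PosSemidef} ∩
        {θ | θ.covY ∈ V} := by
      ext θ
      constructor
      · rintro ⟨h1, h2⟩
        exact ⟨⟨⟨subset_closure h1, (hΘ.admissible θ h1).1⟩, (hΘ.admissible θ h1).2⟩, h2⟩
      · rintro ⟨⟨⟨h1, h2⟩, h3⟩, h4⟩
        refine ⟨hΘ.closed θ h1 ⟨h2, h3, ?_⟩, h4⟩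
        exact (covY_posSemidef h2 h3).posDef_iff_isUnit.2
          ((Matrix.isUnit_iff_isUnit_det _).2 (hV0 _ h4).isUnit)
    rw [hset]
    exact ((isClosed_closure.inter (Matrix.isClosed_setOf_posSemidef.preimage continuous_Ψ)).inter
      (Matrix.isClosed_setOf_posSemidef.preimage continuous_Ω)).inter
      (hV.isClosed.preimage continuous_covY)
  · rintro θ ⟨hθ, hmem⟩
    have hadm := hΘ.admissible θ hθ
    have hb := abs_le_of_covY_le hadm.1 hadm.2 (href θ hθ) (hdiag θ hθ hmem)
    exact ⟨(θ.coef, θ.Ψ, θ.Ω), ⟨hcoef θ hθ, hb.1, hb.2⟩, rfl⟩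

/-- Consistency of minimum contrast estimation in the stage-two model. -/
theorem IsParameterSpace.tendsto_of_normalContrast_le {Θ : Set (Stage2Param r h l p m)}
    (hΘ : IsParameterSpace Θ) {θ₀ : Stage2Param r h l p m} (hθ₀ : θ₀ ∈ Θ)
    {M : ℕ → Matrix (Fin m ⊕ Unit ⊕ Fin r ⊕ Fin h ⊕ Fin l)
      (Fin m ⊕ Unit ⊕ Fin r ⊕ Fin h ⊕ Fin l) ℝ}
    {M₀ : Matrix (Fin m ⊕ Unit ⊕ Fin r ⊕ Fin h ⊕ Fin l)
      (Fin m ⊕ Unit ⊕ Fin r ⊕ Fin h ⊕ Fin l) ℝ} (hM : Tendsto M atTop (𝓝 M₀))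
    (hMs : ∀ n, (M n)ᵀ = M n) (hM₀ : M₀.PosSemidef)
    (hcov : θ₀.design * M₀ * θ₀.designᵀ = θ₀.covY)
    (hcross : ∀ θ : Stage2Param r h l p m, θ₀.design * M₀ * (θ.design - θ₀.design)ᵀ = 0)
    {T : ℕ → Stage2Param r h l p m} (hT : ∀ᶠ n in atTop, T n ∈ Θ)
    (hmin : ∀ᶠ n in atTop,
      normalContrast (T n).covY ((T n).design * M n * (T n).designᵀ) ≤
      normalContrast θ₀.covY (θ₀.design * M n * θ₀.designᵀ))
    (huniq : ∀ θ ∈ Θ, θ.covY = θ₀.covY →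
      (θ.design - θ₀.design) * M₀ * (θ.design - θ₀.design)ᵀ = 0 → θ = θ₀) :
    Tendsto T atTop (𝓝 θ₀) := by
  have hS₀ := (hΘ.admissible θ₀ hθ₀).covY_posDef
  obtain ⟨C, hC, hcoef⟩ := hΘ.coef_bounded
  obtain ⟨t, ht⟩ := exists_design_bound hC
  have hM₀' : M₀ᵀ = M₀ := (by simpa using hM₀.isHermitian : M₀.IsSymm)
  have hlim : Tendsto (fun n => normalContrast θ₀.covY (θ₀.design * M n * θ₀.designᵀ)) atTop
      (𝓝 (normalContrast θ₀.covY (θ₀.design * M₀ * θ₀.designᵀ))) :=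
    (ContinuousAt.normalContrast (S := fun _ => θ₀.covY)
      (R := fun M => θ₀.design * M * θ₀.designᵀ) continuousAt_const
      ((continuousAt_const.matrix_mul continuousAt_id).matrix_mul continuousAt_const)
      hS₀.det_pos.ne').tendsto.comp hM
  -- The estimator does at least as well as `θ₀`, whose contrast converges; the extra `1` makes `b`
  -- an eventual upper bound.
  set b := normalContrast θ₀.covY (θ₀.design * M₀ * θ₀.designᵀ) + 1
  -- By Pythagoras `C M₀ Cᵀ ≥ S₀` for every design, so the compactness lemma applies along the
  -- estimators.
  obtain ⟨V, hV, hV0, hVmem⟩ := exists_isCompact_of_normalContrast_le hS₀ hM hMs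
    (C := fun n => (T n).design) (hT.mono fun n hn => ht _ (hcoef _ hn)) (Eventually.of_forall
      fun n => by
        rw [mul_mul_transpose_eq_add hM₀' (hcross (T n)), hcov, add_sub_cancel_left]
        exact hM₀.mul_mul_transpose_same _) b
  have hbd := hlim.eventually_lt_const (lt_add_one _)
  refine _root_.tendsto_of_normalContrast_le (hΘ.isCompact_setOf_covY_mem hV hV0)
    (S := fun θ => θ.covY) (C := fun θ => θ.design) (fun θ _ => continuous_covY.continuousAt)
    (fun θ _ => continuous_design.continuousAt) (fun θ hθ => (hΘ.admissible θ hθ.1).covY_posDef)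
    hS₀ hM hM₀ hcov (fun θ _ => hcross θ) ?_ hmin fun θ hθ => huniq θ hθ.1
  filter_upwards [hT, hmin, hbd, hVmem] with n h1 h2 h3 h4
  exact ⟨h1, h4 _ (hΘ.admissible _ h1).covY_posDef (h2.trans h3.le)⟩

end Stage2Param

/-! ### Densities of normal laws -/

theorem pi_gaussianReal_eq_withDensity (k : ℕ) :
    Measure.pi (fun _ : Fin k => gaussianReal 0 1) =
      volume.withDensity fun x => ENNReal.ofReal (∏ i, gaussianPDFReal 0 1 (x i)) := by
  refine (Measure.pi_eq fun s hs => ?_)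
  rw [withDensity_apply _ (MeasurableSet.univ_pi hs)]
  have hint : ∀ i, Integrable ((s i).indicator (gaussianPDFReal 0 1)) :=
    fun i => (integrable_gaussianPDFReal 0 1).indicator (hs i)
  have hprod : ∀ x : Fin k → ℝ, (Set.univ.pi s).indicator
      (fun x => ENNReal.ofReal (∏ i, gaussianPDFReal 0 1 (x i))) x =
      ENNReal.ofReal (∏ i, (s i).indicator (gaussianPDFReal 0 1) (x i)) := fun x => by
    by_cases hx : x ∈ Set.univ.pi s
    · rw [Set.indicator_of_mem hx]
      congr 1
      exact Finset.prod_congr rfl fun i _ => (Set.indicator_of_mem (hx i trivial) _).symm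
    · rw [Set.indicator_of_notMem hx]
      obtain ⟨i, hi⟩ : ∃ i, x i ∉ s i := by
        by_contra! h
        exact hx fun i _ => h i
      rw [Finset.prod_eq_zero (Finset.mem_univ i) (Set.indicator_of_notMem hi _),
        ENNReal.ofReal_zero]
  rw [← lintegral_indicator (MeasurableSet.univ_pi hs)]
  simp_rw [hprod]
  have hnn : ∀ i x, 0 ≤ (s i).indicator (gaussianPDFReal 0 1) x := fun i x =>
    Set.indicator_nonneg (fun _ _ => gaussianPDFReal_nonneg _ _ _) _
  rw [← ofReal_integral_eq_lintegral_ofReal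
      (μ := volume) (Integrable.fintype_prod (f := fun i => (s i).indicator (gaussianPDFReal 0 1)) hint)
      (ae_of_all _ fun x => Finset.prod_nonneg fun i _ => hnn i _),
    integral_fintype_prod_volume_eq_prod (fun i => (s i).indicator (gaussianPDFReal 0 1)),
    ENNReal.ofReal_prod_of_nonneg fun i _ => integral_nonneg (hnn i)]
  refine Finset.prod_congr rfl fun i _ => ?_
  rw [gaussianReal_apply_eq_integral _ one_ne_zero, integral_indicator (hs i)]

theorem prod_gaussianPDFReal_eq {k : ℕ} (x : Fin k → ℝ) :
    ∏ i, gaussianPDFReal 0 1 (x i) = Real.exp (gaussianLogDensity 1 x) := by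
  have h2 : (0 : ℝ) < 2 * Real.pi := by positivity
  have h1 : ∀ y, gaussianPDFReal 0 1 y =
      Real.exp (-(1 / 2) * (Real.log (2 * Real.pi) + y * y)) := fun y => by
    rw [gaussianPDFReal_def, mul_add, Real.exp_add, Real.sqrt_eq_rpow, NNReal.coe_one, mul_one,
      ← Real.rpow_neg h2.le, Real.rpow_def_of_pos h2]
    rw [show Real.log (2 * Real.pi) * -(1 / 2) = -(1 / 2) * Real.log (2 * Real.pi) by ring,
      show -(1 / 2) * (y * y) = -(y - 0) ^ 2 / (2 * 1) by ring]
  simp_rw [h1, gaussianLogDensity]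
  rw [← Real.exp_sum, ← Finset.mul_sum, Finset.sum_add_distrib, Matrix.det_smul, Matrix.det_one,
    mul_one, Real.log_pow, inv_one, Matrix.one_mulVec]
  simp [dotProduct]

open scoped MatrixOrder in
theorem normalLaw_eq_map_pi {k : ℕ} (m : Fin k → ℝ) (S : Matrix (Fin k) (Fin k) ℝ) :
    normalLaw m S = (Measure.pi fun _ : Fin k => gaussianReal 0 1).map
      fun x => m + CFC.sqrt S *ᵥ x := by
  rw [normalLaw, multivariateGaussian, ← map_pi_eq_stdGaussian, Measure.map_map (by fun_prop)
    (by fun_prop), Measure.map_map (by fun_prop) (by fun_prop)]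
  congr 1

instance {k : ℕ} (m : Fin k → ℝ) (S : Matrix (Fin k) (Fin k) ℝ) :
    IsProbabilityMeasure (normalLaw m S) :=
  Measure.isProbabilityMeasure_map (by fun_prop)

open scoped MatrixOrder in
-- Separates the mean from a fixed centred law, so that dependence on `(x, z)` can be moved from the
-- measure into the integrand.
theorem normalLaw_eq_map_add {k : ℕ} (m : Fin k → ℝ) (S : Matrix (Fin k) (Fin k) ℝ) :
    normalLaw m S = (normalLaw 0 S).map fun x => m + x := by
  rw [normalLaw_eq_map_pi, normalLaw_eq_map_pi, Measure.map_map (by fun_prop) (by fun_prop)]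
  congr 1
  ext x
  simp

theorem measurable_gaussianLogDensity {k : ℕ} (S : Matrix (Fin k) (Fin k) ℝ) :
    Measurable (gaussianLogDensity S) := by
  have : Continuous (gaussianLogDensity S) := by
    unfold gaussianLogDensity
    fun_prop
  exact this.measurable

theorem gaussianLogDensity_mul_self_mulVec {k : ℕ} {A : Matrix (Fin k) (Fin k) ℝ} (hA : Aᵀ = A)
    (hA0 : A.det ≠ 0) (x : Fin k → ℝ) :
    Real.exp (gaussianLogDensity (A * A) (A *ᵥ x)) * |A.det| =
      Real.exp (gaussianLogDensity 1 x) := by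
  have hu : IsUnit A.det := isUnit_iff_ne_zero.2 hA0
  have h1 : (A *ᵥ x) ⬝ᵥ ((A * A)⁻¹ *ᵥ (A *ᵥ x)) = x ⬝ᵥ x := by
    rw [Matrix.mulVec_mulVec, Matrix.mul_inv_rev, Matrix.mul_assoc, Matrix.nonsing_inv_mul _ hu,
      Matrix.mul_one, Matrix.dotProduct_mulVec, ← Matrix.mulVec_transpose, Matrix.mulVec_mulVec,
      Matrix.transpose_nonsing_inv, hA, Matrix.nonsing_inv_mul _ hu, Matrix.one_mulVec]
  have h2 : Real.log ((2 * Real.pi) • (A * A)).det =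
      k * Real.log (2 * Real.pi) + 2 * Real.log |A.det| := by
    rw [Matrix.det_smul, Matrix.det_mul, Fintype.card_fin, Real.log_mul (by positivity)
      (mul_ne_zero hA0 hA0), Real.log_pow, Real.log_mul hA0 hA0, Real.log_abs]
    ring
  rw [← Real.exp_log (abs_pos.2 hA0), ← Real.exp_add]
  congr 1
  rw [gaussianLogDensity, gaussianLogDensity, h1, h2, Matrix.det_smul, Matrix.det_one, mul_one,
    Real.log_pow, inv_one, Matrix.one_mulVec, Fintype.card_fin]
  ring

open scoped MatrixOrder in
-- The law is the image of the standard normal under `x ↦ m + √S x`; positive definiteness makes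
-- this an affine bijection with Jacobian `|det √S|`.
theorem normalLaw_eq_withDensity {k : ℕ} (m : Fin k → ℝ) {S : Matrix (Fin k) (Fin k) ℝ}
    (hS : S.PosDef) :
    normalLaw m S = volume.withDensity fun y =>
      ENNReal.ofReal (Real.exp (gaussianLogDensity S (y - m))) := by
  set A := CFC.sqrt S with hAdef
  have hAA : A * A = S := by
    exact CFC.sqrt_mul_sqrt_self _ hS.posSemidef.nonneg
  have hAs : Aᵀ = A := by
    have := (CFC.sqrt_nonneg S).isSelfAdjoint
    simpa [IsSelfAdjoint, Matrix.star_eq_conjTranspose] using this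
  have hA0 : A.det ≠ 0 := fun h => hS.det_pos.ne' (by rw [← hAA, Matrix.det_mul, h, zero_mul])
  have hmeasS : Measurable fun y : Fin k → ℝ =>
      ENNReal.ofReal (Real.exp (gaussianLogDensity S (y - m))) :=
    ENNReal.measurable_ofReal.comp (Real.measurable_exp.comp
      ((measurable_gaussianLogDensity S).comp (by fun_prop)))
  -- Lebesgue measure as a multiple of its own affine image: this pulls the integral over `s` back
  -- to the preimage of `s`.
  have hvol : (volume : Measure (Fin k → ℝ)) =
      ENNReal.ofReal |A.det| • (volume.map fun x => m + A *ᵥ x) := by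
    have h1 := Real.map_matrix_volume_pi_eq_smul_volume_pi hA0
    have h2 : (volume.map fun x : Fin k → ℝ => m + A *ᵥ x) =
        ENNReal.ofReal |A.det⁻¹| • volume := by
      have : (fun x : Fin k → ℝ => m + A *ᵥ x) = (fun y => m + y) ∘ Matrix.toLin' A := by
        ext x; simp
      rw [this, ← Measure.map_map (by fun_prop) (by fun_prop), h1, Measure.map_smul,
        (measurePreserving_add_left volume m).map_eq]
    rw [h2, smul_smul, ← ENNReal.ofReal_mul (abs_nonneg _), ← abs_mul, mul_inv_cancel₀ hA0,
      abs_one, ENNReal.ofReal_one, one_smul]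
  have hmeas : Measurable fun x : Fin k → ℝ => m + A *ᵥ x := by fun_prop
  rw [normalLaw_eq_map_pi, pi_gaussianReal_eq_withDensity]
  ext s hs
  have hmeas' : Measurable fun x : Fin k → ℝ =>
      ENNReal.ofReal (Real.exp (gaussianLogDensity S (m + A *ᵥ x - m))) := hmeasS.comp hmeas
  have hint : ∫⁻ y in s, ENNReal.ofReal (Real.exp (gaussianLogDensity S (y - m))) =
      ENNReal.ofReal |A.det| * ∫⁻ x in (fun x => m + A *ᵥ x) ⁻¹' s,
        ENNReal.ofReal (Real.exp (gaussianLogDensity S (m + A *ᵥ x - m))) := by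
    conv_lhs => rw [hvol]
    rw [Measure.restrict_smul, lintegral_smul_measure, setLIntegral_map hs hmeasS hmeas,
      smul_eq_mul]
  rw [Measure.map_apply hmeas hs, withDensity_apply _ (hmeas hs), withDensity_apply _ hs, hint,
    ← lintegral_const_mul _ hmeas']
  refine lintegral_congr fun x => ?_
  rw [← ENNReal.ofReal_mul (abs_nonneg _), prod_gaussianPDFReal_eq, add_sub_cancel_left, mul_comm,
    ← hAA, gaussianLogDensity_mul_self_mulVec hAs hA0]

/-! ### Continuity of expectations under convergence of densities -/

/-- Scheffé's lemma. -/
theorem tendsto_integral_abs_sub_of_tendsto {α I : Type*} {mα : MeasurableSpace α} {μ : Measure α}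
    {l : Filter I} [l.IsCountablyGenerated] {f : I → α → ℝ} {g : α → ℝ}
    (hf : ∀ i, Integrable (f i) μ) (hg : Integrable g μ) (hf0 : ∀ i x, 0 ≤ f i x)
    (hg0 : ∀ x, 0 ≤ g x) (hint : ∀ i, ∫ x, f i x ∂μ = ∫ x, g x ∂μ)
    (hlim : ∀ x, Tendsto (fun i => f i x) l (𝓝 (g x))) :
    Tendsto (fun i => ∫ x, |f i x - g x| ∂μ) l (𝓝 0) := by
  have hmin : Tendsto (fun i => ∫ x, min (f i x) (g x) ∂μ) l (𝓝 (∫ x, g x ∂μ)) := by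
    refine tendsto_integral_filter_of_dominated_convergence g
      (Eventually.of_forall fun i => ((hf i).inf hg).1) (Eventually.of_forall fun i =>
        ae_of_all _ fun x => ?_) hg (ae_of_all _ fun x => ?_)
    · rw [Real.norm_of_nonneg (le_min (hf0 i x) (hg0 x))]
      exact min_le_right _ _
    · simpa using (hlim x).min (tendsto_const_nhds (x := g x))
  -- From `|f - g| = f + g - 2 min (f, g)` and equal masses; only `min (f, g)`, dominated by `g`,
  -- needs a limit theorem.
  have heq : ∀ i, ∫ x, |f i x - g x| ∂μ = 2 * ∫ x, g x ∂μ - 2 * ∫ x, min (f i x) (g x) ∂μ := by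
    intro i
    have h1 : ∀ x, |f i x - g x| = f i x + g x - 2 * min (f i x) (g x) := fun x => by
      rcases le_total (f i x) (g x) with h | h
      · rw [min_eq_left h, abs_of_nonpos (by linarith)]; ring
      · rw [min_eq_right h, abs_of_nonneg (by linarith)]; ring
    simp_rw [h1]
    have h2 : Integrable (fun x => f i x + g x) μ := (hf i).add hg
    have h3 : Integrable (fun x => 2 * min (f i x) (g x)) μ := ((hf i).inf hg).const_mul 2
    rw [integral_sub h2 h3, integral_add (hf i) hg,
      integral_const_mul, hint i]
    ring
  simp_rw [heq]
  have := (tendsto_const_nhds (x := 2 * ∫ x, g x ∂μ)).sub (hmin.const_mul 2)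
  simpa using this

theorem enorm_apply_le {ι : Type*} [Fintype ι] (v : ι → ℝ) (i : ι) : ‖v i‖ₑ ≤ ‖v‖ₑ := by
  simpa [enorm_eq_nnnorm] using nnnorm_le_pi_nnnorm v i

/-- The bound is `max G 0` because `ENNReal.ofReal` truncates a negative `G`. -/
theorem memLp_two_of_lintegral_sq_le {α : Type*} {mα : MeasurableSpace α} {ν : Measure α}
    {ψ : α → ℝ} (hψ : Measurable ψ) {G : ℝ} (h : ∫⁻ x, ‖ψ x‖ₑ ^ 2 ∂ν ≤ ENNReal.ofReal G) :
    MemLp ψ 2 ν ∧ ∫ x, ψ x ^ 2 ∂ν ≤ max G 0 := by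
  have hsq : Integrable (fun x => ψ x ^ 2) ν := by
    refine ⟨(hψ.pow_const 2).aestronglyMeasurable, ?_⟩
    simp only [HasFiniteIntegral, enorm_pow]
    exact h.trans_lt ENNReal.ofReal_lt_top
  refine ⟨(memLp_two_iff_integrable_sq hψ.aestronglyMeasurable).2 hsq, ?_⟩
  rw [integral_eq_lintegral_of_nonneg_ae (ae_of_all _ fun x => sq_nonneg _) hsq.1]
  have h1 : ∫⁻ x, ENNReal.ofReal (ψ x ^ 2) ∂ν = ∫⁻ x, ‖ψ x‖ₑ ^ 2 ∂ν :=
    lintegral_congr fun x => by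
      rw [← enorm_pow, Real.enorm_of_nonneg (sq_nonneg _)]
  rw [h1]
  exact ENNReal.toReal_le_of_le_ofReal (le_max_right _ _)
    (h.trans (ENNReal.ofReal_le_ofReal (le_max_left _ _)))

theorem sq_integral_le_integral_sq {α : Type*} {mα : MeasurableSpace α} {ν : Measure α}
    [IsProbabilityMeasure ν] {ψ : α → ℝ} (hψ : MemLp ψ 2 ν) :
    (∫ x, ψ x ∂ν) ^ 2 ≤ ∫ x, ψ x ^ 2 ∂ν := by
  have h := variance_nonneg ψ ν
  rw [variance_eq_sub hψ] at h
  simpa using h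

/-- Expectations converge when the densities converge and the second moments are bounded. -/
theorem tendsto_integral_withDensity {α I : Type*} {mα : MeasurableSpace α} {μ : Measure α}
    {l : Filter I} [l.IsCountablyGenerated] {f : I → α → ℝ} {g : α → ℝ}
    (hf : ∀ i, Measurable (f i)) (hg : Measurable g) (hf0 : ∀ i x, 0 ≤ f i x)
    (hg0 : ∀ x, 0 ≤ g x)
    (hfp : ∀ i, IsProbabilityMeasure (μ.withDensity fun x => ENNReal.ofReal (f i x)))
    (hgp : IsProbabilityMeasure (μ.withDensity fun x => ENNReal.ofReal (g x)))
    (hlim : ∀ x, Tendsto (fun i => f i x) l (𝓝 (g x))) {ψ : α → ℝ} {c : ℝ}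
    (hfψ : ∀ i, MemLp ψ 2 (μ.withDensity fun x => ENNReal.ofReal (f i x)) ∧
      ∫ x, ψ x ^ 2 ∂(μ.withDensity fun x => ENNReal.ofReal (f i x)) ≤ c)
    (hgψ : MemLp ψ 2 (μ.withDensity fun x => ENNReal.ofReal (g x)) ∧
      ∫ x, ψ x ^ 2 ∂(μ.withDensity fun x => ENNReal.ofReal (g x)) ≤ c) :
    Tendsto (fun i => ∫ x, ψ x ∂(μ.withDensity fun x => ENNReal.ofReal (f i x))) l
      (𝓝 (∫ x, ψ x ∂(μ.withDensity fun x => ENNReal.ofReal (g x)))) := by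
  have hI : ∀ {f : α → ℝ}, Measurable f → (∀ x, 0 ≤ f x) → ∀ ψ : α → ℝ,
      ∫ x, ψ x ∂(μ.withDensity fun x => ENNReal.ofReal (f x)) = ∫ x, f x * ψ x ∂μ :=
    fun {f} hf hf0 ψ => by
      rw [integral_withDensity_eq_integral_toReal_smul hf.ennreal_ofReal
        (ae_of_all _ fun _ => ENNReal.ofReal_lt_top)]
      simp [ENNReal.toReal_ofReal (hf0 _)]
  have hInt : ∀ {f : α → ℝ}, Measurable f → (∀ x, 0 ≤ f x) → ∀ {ψ : α → ℝ},
      Integrable ψ (μ.withDensity fun x => ENNReal.ofReal (f x)) →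
      Integrable (fun x => f x * ψ x) μ := fun {f} hf hf0 {ψ} h => by
    rw [integrable_withDensity_iff_integrable_smul' hf.ennreal_ofReal
      (ae_of_all _ fun _ => ENNReal.ofReal_lt_top)] at h
    simpa [ENNReal.toReal_ofReal (hf0 _)] using h
  have hone : ∀ {f : α → ℝ}, Measurable f → (∀ x, 0 ≤ f x) →
      IsProbabilityMeasure (μ.withDensity fun x => ENNReal.ofReal (f x)) →
      Integrable f μ ∧ ∫ x, f x ∂μ = 1 := fun {f} hf hf0 hp => by
    have h1 := hI hf hf0 fun _ => 1
    have h2 := hInt hf hf0 (integrable_const (1 : ℝ))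
    simp only [mul_one] at h1 h2
    exact ⟨h2, by rw [← h1]; simp⟩
  have hsch := tendsto_integral_abs_sub_of_tendsto (μ := μ) (fun i => (hone (hf i) (hf0 i) (hfp i)).1)
    (hone hg hg0 hgp).1 hf0 hg0 (fun i => by
      rw [(hone (hf i) (hf0 i) (hfp i)).2, (hone hg hg0 hgp).2]) hlim
  have hc : 0 ≤ c := (integral_nonneg fun x => sq_nonneg (ψ x)).trans hgψ.2
  rw [Metric.tendsto_nhds]
  intro δ hδ
  -- Weight for `|ψ| ≤ t ψ² / 2 + 1 / (2 t)`. The first part integrates to at most `t c < δ / 2` by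
  -- the moment bounds, the second to less than `δ / 2` once the L¹ distance of the densities is
  -- below `δ t`.
  set t : ℝ := δ / (2 * (c + 1)) with ht
  have ht0 : 0 < t := by positivity
  have hev := hsch.eventually_lt_const (show 0 < δ * t by positivity)
  filter_upwards [hev] with i hi
  have e1 := hone (hf i) (hf0 i) (hfp i)
  have e2 := hone hg hg0 hgp
  have i1 := hInt (hf i) (hf0 i) ((hfψ i).1.integrable one_le_two)
  have i2 := hInt hg hg0 (hgψ.1.integrable one_le_two)
  have i3 := hInt (hf i) (hf0 i) (hfψ i).1.integrable_sq
  have i4 := hInt hg hg0 hgψ.1.integrable_sq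
  have i5 : Integrable (fun x => t / 2 * (f i x * ψ x ^ 2 + g x * ψ x ^ 2)) μ :=
    (i3.add i4).const_mul _
  have i6 : Integrable (fun x => 1 / (2 * t) * |f i x - g x|) μ :=
    (e1.1.sub e2.1).abs.const_mul _
  have b1 := (hfψ i).2
  have b2 := hgψ.2
  rw [hI (hf i) (hf0 i)] at b1 ⊢
  rw [hI hg hg0] at b2 ⊢
  rw [Real.dist_eq, ← integral_sub i1 i2]
  have hbound : ∀ x, |f i x * ψ x - g x * ψ x| ≤
      t / 2 * (f i x * ψ x ^ 2 + g x * ψ x ^ 2) + 1 / (2 * t) * |f i x - g x| := fun x => by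
    have h1 : |f i x - g x| ≤ f i x + g x := by
      rw [abs_le]; constructor <;> linarith [hf0 i x, hg0 x]
    have h2 : |ψ x| ≤ t / 2 * ψ x ^ 2 + 1 / (2 * t) := by
      have h3 : 0 ≤ (t * |ψ x| - 1) ^ 2 / (2 * t) := by positivity
      have h4 : (t * |ψ x| - 1) ^ 2 / (2 * t) = t / 2 * ψ x ^ 2 + 1 / (2 * t) - |ψ x| := by
        rw [← sq_abs (ψ x)]
        field_simp
        ring
      linarith
    rw [← sub_mul, abs_mul]
    calc |f i x - g x| * |ψ x| ≤ |f i x - g x| * (t / 2 * ψ x ^ 2 + 1 / (2 * t)) :=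
          mul_le_mul_of_nonneg_left h2 (abs_nonneg _)
      _ ≤ _ := by
          have := mul_le_mul_of_nonneg_right h1 (show 0 ≤ t / 2 * ψ x ^ 2 by positivity)
          linarith
  calc |∫ x, f i x * ψ x - g x * ψ x ∂μ| ≤ ∫ x, |f i x * ψ x - g x * ψ x| ∂μ :=
        abs_integral_le_integral_abs
    _ ≤ ∫ x, (t / 2 * (f i x * ψ x ^ 2 + g x * ψ x ^ 2) + 1 / (2 * t) * |f i x - g x|) ∂μ :=
        integral_mono (i1.sub i2).abs (i5.add i6) hbound
    _ = t / 2 * (∫ x, f i x * ψ x ^ 2 ∂μ + ∫ x, g x * ψ x ^ 2 ∂μ) +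
          1 / (2 * t) * ∫ x, |f i x - g x| ∂μ := by
        rw [integral_add i5 i6,
          integral_const_mul, integral_const_mul, integral_add i3 i4]
    _ < t / 2 * (c + c) + 1 / (2 * t) * (δ * t) := by
        have h1 : t / 2 * (∫ x, f i x * ψ x ^ 2 ∂μ + ∫ x, g x * ψ x ^ 2 ∂μ) ≤ t / 2 * (c + c) := by
          gcongr
        have h2 : 1 / (2 * t) * ∫ x, |f i x - g x| ∂μ < 1 / (2 * t) * (δ * t) := by
          gcongr
        linarith
    _ ≤ δ := by
        have h1 : 1 / (2 * t) * (δ * t) = δ / 2 := by field_simp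
        have h2 : t * (c + 1) = δ / 2 := by rw [ht]; field_simp
        nlinarith

/-! ### The stage-one predictions -/

namespace Stage1Param

variable {r q h l : ℕ}

/-- Provides countably generated neighbourhood filters for dominated convergence and countable dense
subsets for measurable suprema over parameters. -/
instance : SecondCountableTopology (Stage1Param r q h) :=
  haveI : ∀ m n : ℕ, SecondCountableTopology (Matrix (Fin m) (Fin n) ℝ) := fun m n =>
    inferInstanceAs (SecondCountableTopology (Fin m → Fin n → ℝ))
  isInducing.secondCountableTopology

/-- By the Woodbury identity `postCov = (covXi⁻¹ + Λᵀ Ω⁻¹ Λ)⁻¹`, the inverse of a sum of a positive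
definite and a positive semidefinite matrix. Hence the posterior has a density. -/
theorem Admissible.postCov_posDef {θ : Stage1Param r q h} (hθ : θ.Admissible) :
    θ.postCov.PosDef := by
  have hP := hθ.covXi_posDef
  have hΩ := hθ.omega_posDef
  have hQ : (θ.covXi⁻¹ + θ.Λᵀ * θ.Ω⁻¹ * θ.Λ).PosDef := by
    refine hP.inv.add_posSemidef ?_
    simpa using hΩ.inv.posSemidef.mul_mul_transpose_same θ.Λᵀ
  have hPu := (Matrix.isUnit_iff_isUnit_det _).1 hP.isUnit
  have hΩu := (Matrix.isUnit_iff_isUnit_det _).1 hΩ.isUnit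
  have hsym : θ.covXiᵀ = θ.covXi := (by simpa using hP.isHermitian : θ.covXi.IsSymm)
  have h1 := Matrix.add_mul_mul_inv_eq_sub (A := θ.covXi⁻¹) (U := θ.Λᵀ) (C := θ.Ω⁻¹) (V := θ.Λ)
    hP.inv.isUnit hΩ.inv.isUnit (by
      rw [Matrix.nonsing_inv_nonsing_inv _ hPu, Matrix.nonsing_inv_nonsing_inv _ hΩu, add_comm]
      exact hθ.covX_posDef.isUnit)
  rw [Matrix.nonsing_inv_nonsing_inv _ hPu, Matrix.nonsing_inv_nonsing_inv _ hΩu] at h1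
  have h2 : θ.postCov = (θ.covXi⁻¹ + θ.Λᵀ * θ.Ω⁻¹ * θ.Λ)⁻¹ := by
    rw [h1, postCov, covXiX, covX, Matrix.transpose_mul, Matrix.transpose_transpose, hsym,
      add_comm θ.Ω, ← Matrix.mul_assoc]
  rw [h2]
  exact hQ.inv

theorem continuousAt_covXiX {θ : Stage1Param r q h} (hθ : θ.Admissible) :
    ContinuousAt (fun θ : Stage1Param r q h => θ.covXiX) θ :=
  (continuousAt_covXi hθ).matrix_mul continuous_Λ.continuousAt.matrix_transpose

theorem continuousAt_postGain {θ : Stage1Param r q h} (hθ : θ.Admissible) :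
    ContinuousAt (fun θ : Stage1Param r q h => θ.covXiX * θ.covX⁻¹) θ :=
  (continuousAt_covXiX hθ).matrix_mul
    ((continuousAt_covX hθ).matrix_inv hθ.covX_posDef.det_pos.ne')

theorem continuousAt_postCov {θ : Stage1Param r q h} (hθ : θ.Admissible) :
    ContinuousAt (fun θ : Stage1Param r q h => θ.postCov) θ :=
  (continuousAt_covXi hθ).sub
    ((continuousAt_postGain hθ).matrix_mul (continuousAt_covXiX hθ).matrix_transpose)

theorem continuousAt_meanX {θ : Stage1Param r q h} (hθ : θ.Admissible) (z : Fin r → ℝ) :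
    ContinuousAt (fun θ : Stage1Param r q h => θ.meanX z) θ :=
  (continuous_ν.continuousAt.add (continuous_Λ.continuousAt.matrix_mulVec
    (continuousAt_meanXi hθ z))).add (continuous_K.continuousAt.matrix_mulVec continuousAt_const)

theorem continuousAt_postMean {θ : Stage1Param r q h} (hθ : θ.Admissible) (x : Fin h → ℝ)
    (z : Fin r → ℝ) : ContinuousAt (fun θ : Stage1Param r q h => θ.postMean x z) θ :=
  (continuousAt_meanXi hθ z).add ((continuousAt_postGain hθ).matrix_mulVec
    (continuousAt_const.sub (continuousAt_meanX hθ z)))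

theorem continuousAt_gaussianLogDensity {X : Type*} [TopologicalSpace X] {k : ℕ}
    {S : X → Matrix (Fin k) (Fin k) ℝ} {e : X → Fin k → ℝ} {x : X} (hS : ContinuousAt S x)
    (he : ContinuousAt e x) (hx : (S x).PosDef) :
    ContinuousAt (fun y => gaussianLogDensity (S y) (e y)) x := by
  have hdet : ContinuousAt (fun y => ((2 * Real.pi) • S y).det) x :=
    ContinuousAt.comp (g := fun A : Matrix (Fin k) (Fin k) ℝ => A.det)
      continuous_id.matrix_det.continuousAt (hS.const_smul (2 * Real.pi))
  have hne : ((2 * Real.pi) • S x).det ≠ 0 :=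
    (hx.smul (by positivity : 0 < 2 * Real.pi)).det_pos.ne'
  have hq : ContinuousAt (fun y => e y ⬝ᵥ ((S y)⁻¹ *ᵥ e y)) x :=
    ContinuousAt.comp₂ (f := fun p : (Fin k → ℝ) × (Fin k → ℝ) => p.1 ⬝ᵥ p.2)
      (Continuous.dotProduct continuous_fst continuous_snd).continuousAt he
      ((hS.matrix_inv hx.det_pos.ne').matrix_mulVec he)
  exact continuousAt_const.mul ((hdet.log hne).add hq)

/-- Predictions depend continuously on the parameter where the conditional second moments of the
predicted terms are bounded. -/
theorem continuousOn_predict {φ : (Fin q → ℝ) → Fin l → ℝ} (hφ : Measurable φ)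
    {U : Set (Stage1Param r q h)} (hU : ∀ θ ∈ U, θ.Admissible) {x : Fin h → ℝ} {z : Fin r → ℝ}
    {G : ℝ} (hG : ∀ θ ∈ U, ∫⁻ u, ‖φ u‖ₑ ^ 2 ∂(θ.postLaw x z) ≤ ENNReal.ofReal G) (c : Fin l) :
    ContinuousOn (fun θ => predict φ θ x z c) U := by
  intro θ₀ hθ₀
  have hmeas : Measurable fun u => φ u c := (measurable_pi_apply c).comp hφ
  have hdens : ∀ θ ∈ U, θ.postLaw x z = volume.withDensity fun y =>
      ENNReal.ofReal (Real.exp (gaussianLogDensity θ.postCov (y - θ.postMean x z))) :=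
    fun θ hθ => normalLaw_eq_withDensity _ (hU θ hθ).postCov_posDef
  have hmom : ∀ θ ∈ U, MemLp (fun u => φ u c) 2 (θ.postLaw x z) ∧
      ∫ u, φ u c ^ 2 ∂(θ.postLaw x z) ≤ max G 0 := fun θ hθ =>
    memLp_two_of_lintegral_sq_le hmeas ((lintegral_mono fun u => by
      gcongr
      exact enorm_apply_le (φ u) c).trans (hG θ hθ))
  have hmd : ∀ θ : Stage1Param r q h, Measurable fun y : Fin q → ℝ =>
      Real.exp (gaussianLogDensity θ.postCov (y - θ.postMean x z)) := fun θ =>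
    Real.measurable_exp.comp ((measurable_gaussianLogDensity _).comp (by fun_prop))
  -- Passing to the subtype `U` makes the moment bound hold for all indices, as the convergence
  -- lemma requires.
  rw [ContinuousWithinAt, nhdsWithin_eq_map_subtype_coe hθ₀, tendsto_map'_iff]
  have hp : ∀ θ ∈ U, IsProbabilityMeasure (volume.withDensity fun y =>
      ENNReal.ofReal (Real.exp (gaussianLogDensity θ.postCov (y - θ.postMean x z)))) :=
    fun θ hθ => by
      rw [← hdens θ hθ]
      exact inferInstanceAs (IsProbabilityMeasure (normalLaw _ _))
  have key := tendsto_integral_withDensity (μ := volume) (l := 𝓝 (⟨θ₀, hθ₀⟩ : U)) (ψ := fun u => φ u c)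
    (f := fun (θ : U) y =>
      Real.exp (gaussianLogDensity θ.1.postCov (y - θ.1.postMean x z)))
    (g := fun y => Real.exp (gaussianLogDensity θ₀.postCov (y - θ₀.postMean x z))) (c := max G 0)
    (fun θ => hmd θ) (hmd θ₀) (fun _ _ => (Real.exp_pos _).le) (fun _ => (Real.exp_pos _).le)
    (fun θ => hp θ θ.2) (hp θ₀ hθ₀) (fun y => ?_) (fun θ => ?_) ?_
  · have h1 : ∀ θ ∈ U, predict φ θ x z c = ∫ u, φ u c ∂(volume.withDensity fun y =>
        ENNReal.ofReal (Real.exp (gaussianLogDensity θ.postCov (y - θ.postMean x z)))) :=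
      fun θ hθ => by rw [predict, hdens θ hθ]
    rw [h1 θ₀ hθ₀]
    exact key.congr fun θ => (h1 θ θ.2).symm
  · have h1 := (continuousAt_gaussianLogDensity (continuousAt_postCov (hU θ₀ hθ₀))
      (continuousAt_const.sub (continuousAt_postMean (hU θ₀ hθ₀) x z)) (e := fun θ => y - _)
      (hU θ₀ hθ₀).postCov_posDef).rexp
    exact h1.tendsto.comp (f := Subtype.val) (x := 𝓝 (⟨θ₀, hθ₀⟩ : U))
      continuous_subtype_val.continuousAt
  · rw [← hdens θ θ.2]; exact hmom θ θ.2
  · rw [← hdens θ₀ hθ₀]; exact hmom θ₀ hθ₀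

/-- Jensen's inequality for the posterior law. -/
theorem sq_predict_le {φ : (Fin q → ℝ) → Fin l → ℝ} (hφ : Measurable φ)
    {θ : Stage1Param r q h} {x : Fin h → ℝ} {z : Fin r → ℝ}
    {G : ℝ} (hG : ∫⁻ u, ‖φ u‖ₑ ^ 2 ∂(θ.postLaw x z) ≤ ENNReal.ofReal G) (c : Fin l) :
    predict φ θ x z c ^ 2 ≤ max G 0 := by
  have hmom := memLp_two_of_lintegral_sq_le (ψ := fun u => φ u c) ((measurable_pi_apply c).comp hφ)
    ((lintegral_mono fun u => by
      gcongr
      exact enorm_apply_le (φ u) c).trans hG)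
  have : IsProbabilityMeasure (θ.postLaw x z) :=
    inferInstanceAs (IsProbabilityMeasure (normalLaw _ _))
  exact (sq_integral_le_integral_sq hmom.1).trans hmom.2

theorem continuous_meanX (θ : Stage1Param r q h) : Continuous θ.meanX := by
  unfold meanX meanXi
  fun_prop

theorem continuous_postMean (θ : Stage1Param r q h) :
    Continuous fun w : (Fin h → ℝ) × (Fin r → ℝ) => θ.postMean w.1 w.2 := by
  unfold postMean meanX meanXi
  fun_prop

/-- Over a fixed measure the prediction is a parametric integral in `(x, z)`: this gives
measurability, and it is the form in which the conditional expectation appears. -/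
theorem predict_eq_integral {φ : (Fin q → ℝ) → Fin l → ℝ} (hφ : Measurable φ)
    (θ : Stage1Param r q h) (x : Fin h → ℝ) (z : Fin r → ℝ) (c : Fin l) :
    predict φ θ x z c = ∫ u, φ (θ.postMean x z + u) c ∂(normalLaw 0 θ.postCov) := by
  have hm : Measurable fun u => φ u c := (measurable_pi_apply c).comp hφ
  rw [predict, postLaw, normalLaw_eq_map_add, integral_map (by fun_prop) hm.aestronglyMeasurable]

theorem measurable_predict {φ : (Fin q → ℝ) → Fin l → ℝ} (hφ : Measurable φ)
    (θ : Stage1Param r q h) :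
    Measurable fun w : (Fin h → ℝ) × (Fin r → ℝ) => predict φ θ w.1 w.2 := by
  refine measurable_pi_iff.2 fun c => ?_
  simp_rw [predict_eq_integral hφ]
  have : Measurable fun p : ((Fin h → ℝ) × (Fin r → ℝ)) × (Fin q → ℝ) =>
      φ (θ.postMean p.1.1 p.1.2 + p.2) c :=
    (measurable_pi_apply c).comp (hφ.comp
      (((continuous_postMean θ).measurable.comp measurable_fst).add measurable_snd))
  exact this.stronglyMeasurable.integral_prod_right.measurable

end Stage1Param

/-! ### Independence -/

namespace ProbabilityTheory

theorem indepFun_of_hasLaw_prod {S α β : Type*} {mS : MeasurableSpace S} {mα : MeasurableSpace α}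
    {mβ : MeasurableSpace β} {μ : Measure S} {A : S → α} {B : S → β} {a : Measure α} {b : Measure β}
    [IsProbabilityMeasure a] [IsProbabilityMeasure b] [IsFiniteMeasure μ]
    (h : HasLaw (fun ω => (A ω, B ω)) (a.prod b) μ) :
    HasLaw A a μ ∧ HasLaw B b μ ∧ A ⟂ᵢ[μ] B := by
  have hA : HasLaw A a μ := (measurePreserving_fst (μ := a) (ν := b)).hasLaw.comp h
  have hB : HasLaw B b μ := (measurePreserving_snd (μ := a) (ν := b)).hasLaw.comp h
  exact ⟨hA, hB, (indepFun_iff_hasLaw_prodMk_prod hA hB).2 h⟩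

/-- The joint law is `A ⊗ (B ⊗ C)`, and product measures may be reassociated. -/
theorem IndepFun.prodMk_left {S α β γ : Type*} {mS : MeasurableSpace S} {mα : MeasurableSpace α}
    {mβ : MeasurableSpace β} {mγ : MeasurableSpace γ} {μ : Measure S} [IsProbabilityMeasure μ]
    {A : S → α} {B : S → β} {C : S → γ} (hA : Measurable A) (hB : Measurable B) (hC : Measurable C)
    (h₁ : A ⟂ᵢ[μ] (fun ω => (B ω, C ω))) (h₂ : B ⟂ᵢ[μ] C) :
    (fun ω => (A ω, B ω)) ⟂ᵢ[μ] C := by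
  have hAB : A ⟂ᵢ[μ] B := h₁.comp measurable_id measurable_fst
  have e1 := h₁.map_prod_eq_prod_map_map hA.aemeasurable (hB.prodMk hC).aemeasurable
  have e2 := h₂.map_prod_eq_prod_map_map hB.aemeasurable hC.aemeasurable
  have e3 := hAB.map_prod_eq_prod_map_map hA.aemeasurable hB.aemeasurable
  rw [indepFun_iff_map_prod_eq_prod_map_map (hA.prodMk hB).aemeasurable hC.aemeasurable, e3]
  have : IsProbabilityMeasure (μ.map A) := Measure.isProbabilityMeasure_map hA.aemeasurable
  have : IsProbabilityMeasure (μ.map B) := Measure.isProbabilityMeasure_map hB.aemeasurable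
  have : IsProbabilityMeasure (μ.map C) := Measure.isProbabilityMeasure_map hC.aemeasurable
  have hp := (measurePreserving_prodAssoc (μ.map A) (μ.map B) (μ.map C)).symm
  rw [← hp.map_eq, ← e2, ← e1, Measure.map_map hp.measurable (hA.prodMk (hB.prodMk hC))]
  rfl

end ProbabilityTheory

/-! ### Second moment matrices -/

/-- The matrix `E[U Wᵀ]`. -/
noncomputable def secondMoment {S ι κ : Type*} {mS : MeasurableSpace S} (μ : Measure S)
    (U : S → ι → ℝ) (W : S → κ → ℝ) : Matrix ι κ ℝ :=
  Matrix.of fun a b => ∫ ω, U ω a * W ω b ∂μ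

section SecondMoment

variable {S ι κ ι' κ' : Type*} {mS : MeasurableSpace S} {μ : Measure S}

theorem secondMoment_congr {U U' : S → ι → ℝ} {W W' : S → κ → ℝ} (hU : U =ᵐ[μ] U')
    (hW : W =ᵐ[μ] W') : secondMoment μ U W = secondMoment μ U' W' := by
  ext a b
  refine integral_congr_ae ?_
  filter_upwards [hU, hW] with ω h1 h2
  rw [h1, h2]

theorem transpose_secondMoment (U : S → ι → ℝ) (W : S → κ → ℝ) :
    (secondMoment μ U W)ᵀ = secondMoment μ W U := by
  ext a b
  simp [secondMoment, mul_comm]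

variable [Fintype ι] [Fintype κ] [Fintype ι'] [Fintype κ']

theorem MeasureTheory.MemLp.mulVec {U : S → ι → ℝ} (hU : MemLp U 2 μ) (F : Matrix ι' ι ℝ) :
    MemLp (fun ω => F *ᵥ U ω) 2 μ := by
  refine MemLp.of_eval fun a => ?_
  exact memLp_finsetSum _ fun i _ => (hU.eval i).const_mul (F a i)

theorem MeasureTheory.MemLp.integrable_mul_eval {U : S → ι → ℝ} {W : S → κ → ℝ}
    (hU : MemLp U 2 μ) (hW : MemLp W 2 μ) (a : ι) (b : κ) :
    Integrable (fun ω => U ω a * W ω b) μ :=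
  (hU.eval a).integrable_mul (hW.eval b)

theorem secondMoment_mulVec {ι' κ' : Type*} {U : S → ι → ℝ} {W : S → κ → ℝ}
    (hU : MemLp U 2 μ) (hW : MemLp W 2 μ) (F : Matrix ι' ι ℝ) (G : Matrix κ' κ ℝ) :
    secondMoment μ (fun ω => F *ᵥ U ω) (fun ω => G *ᵥ W ω) = F * secondMoment μ U W * Gᵀ := by
  ext a b
  have h1 : ∀ ω, (F *ᵥ U ω) a * (G *ᵥ W ω) b =
      ∑ j, ∑ i, (F a i * G b j) * (U ω i * W ω j) := fun ω => by
    simp only [Matrix.mulVec, dotProduct]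
    rw [Finset.sum_mul_sum, Finset.sum_comm]
    exact Finset.sum_congr rfl fun j _ => Finset.sum_congr rfl fun i _ => by ring
  simp only [secondMoment, Matrix.of_apply, h1, Matrix.mul_apply, Matrix.transpose_apply]
  rw [integral_finsetSum _ fun j _ => integrable_finsetSum _ fun i _ =>
    (hU.integrable_mul_eval hW i j).const_mul _]
  refine Finset.sum_congr rfl fun j _ => ?_
  rw [integral_finsetSum _ fun i _ => (hU.integrable_mul_eval hW i j).const_mul _, Finset.sum_mul]
  refine Finset.sum_congr rfl fun i _ => ?_
  rw [integral_const_mul]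
  ring

theorem secondMoment_add_left {U U' : S → ι → ℝ} {W : S → κ → ℝ} (hU : MemLp U 2 μ)
    (hU' : MemLp U' 2 μ) (hW : MemLp W 2 μ) :
    secondMoment μ (fun ω => U ω + U' ω) W = secondMoment μ U W + secondMoment μ U' W := by
  ext a b
  simp only [secondMoment, Matrix.of_apply, Matrix.add_apply, Pi.add_apply, add_mul]
  exact integral_add (hU.integrable_mul_eval hW a b) (hU'.integrable_mul_eval hW a b)

theorem secondMoment_add_right {U : S → ι → ℝ} {W W' : S → κ → ℝ} (hU : MemLp U 2 μ)
    (hW : MemLp W 2 μ) (hW' : MemLp W' 2 μ) :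
    secondMoment μ U (fun ω => W ω + W' ω) = secondMoment μ U W + secondMoment μ U W' := by
  ext a b
  simp only [secondMoment, Matrix.of_apply, Matrix.add_apply, Pi.add_apply, mul_add]
  exact integral_add (hU.integrable_mul_eval hW a b) (hU.integrable_mul_eval hW' a b)

/-- `xᵀ E[U Uᵀ] x = E (x · U)²`. -/
theorem secondMoment_posSemidef {U : S → ι → ℝ} (hU : MemLp U 2 μ) :
    (secondMoment μ U U).PosSemidef := by
  refine Matrix.PosSemidef.of_dotProduct_mulVec_nonneg ?_ fun x => ?_
  · rw [Matrix.IsHermitian, Matrix.conjTranspose_eq_transpose_of_trivial, transpose_secondMoment]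
  · have h := secondMoment_mulVec hU hU (Matrix.replicateRow Unit x) (Matrix.replicateRow Unit x)
    have h2 : x ⬝ᵥ (secondMoment μ U U *ᵥ x) = (Matrix.replicateRow Unit x * secondMoment μ U U *
        (Matrix.replicateRow Unit x)ᵀ) () () := by
      rw [Matrix.mul_assoc, Matrix.transpose_replicateRow]
      simp [Matrix.mul_apply, dotProduct, Matrix.mulVec]
    rw [star_trivial, h2, ← h]
    exact integral_nonneg fun ω => mul_self_nonneg _

theorem secondMoment_eq_zero_of_indepFun {ι κ : Type*} {U : S → ι → ℝ} {W : S → κ → ℝ}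
    (hU : AEStronglyMeasurable U μ) (hW : AEStronglyMeasurable W μ) (h : U ⟂ᵢ[μ] W)
    (h0 : ∀ a, ∫ ω, U ω a ∂μ = 0) : secondMoment μ U W = 0 := by
  ext a b
  have hab : (fun ω => U ω a) ⟂ᵢ[μ] (fun ω => W ω b) :=
    h.comp (measurable_pi_apply a) (measurable_pi_apply b)
  simp only [secondMoment, Matrix.of_apply, Matrix.zero_apply]
  rw [hab.integral_fun_mul_eq_mul_integral
    ((continuous_apply a).comp_aestronglyMeasurable hU)
    ((continuous_apply b).comp_aestronglyMeasurable hW), h0, zero_mul]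

end SecondMoment

/-! ### Moments of normal laws -/

section NormalLaw

variable {k : ℕ}

instance (m : Fin k → ℝ) (S : Matrix (Fin k) (Fin k) ℝ) : IsGaussian (normalLaw m S) := by
  rw [normalLaw, ← PiLp.coe_continuousLinearEquiv 2 ℝ]
  infer_instance

theorem integral_eval_normalLaw (m : Fin k → ℝ) (S : Matrix (Fin k) (Fin k) ℝ) (a : Fin k) :
    ∫ x, x a ∂(normalLaw m S) = m a := by
  rw [normalLaw, integral_map (f := fun x : Fin k → ℝ => x a) (by fun_prop)
    (measurable_pi_apply a).aestronglyMeasurable]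
  have h := integral_id_multivariateGaussian (μ := WithLp.toLp 2 m) (S := S)
  have h2 := (EuclideanSpace.proj (𝕜 := ℝ) a).integral_comp_comm
    (IsGaussian.integrable_id (μ := multivariateGaussian (WithLp.toLp 2 m) S))
  simp only [id_eq, h] at h2
  exact h2

theorem secondMoment_normalLaw {S : Matrix (Fin k) (Fin k) ℝ} (hS : S.PosSemidef) :
    secondMoment (normalLaw 0 S) id id = S := by
  ext a b
  have h := covariance_eval_multivariateGaussian (μ := WithLp.toLp 2 (0 : Fin k → ℝ)) hS a b
  have h0 : ∀ a, ∫ x, x a ∂(multivariateGaussian (WithLp.toLp 2 (0 : Fin k → ℝ)) S) = 0 :=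
    fun a => by
      have := integral_eval_normalLaw 0 S a
      rw [normalLaw, integral_map (f := fun x : Fin k → ℝ => x a) (by fun_prop)
        (measurable_pi_apply a).aestronglyMeasurable] at this
      exact this
  rw [← h, covariance, h0, h0]
  simp only [secondMoment, Matrix.of_apply, id_eq, sub_zero]
  rw [normalLaw, integral_map (by fun_prop) (by fun_prop)]

theorem ProbabilityTheory.HasLaw.memLp_normalLaw {Ω : Type*} {mΩ : MeasurableSpace Ω}
    {μ : Measure Ω} {U : Ω → Fin k → ℝ} {m : Fin k → ℝ} {S : Matrix (Fin k) (Fin k) ℝ}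
    (hU : HasLaw U (normalLaw m S) μ) : MemLp U 2 μ :=
  hU.hasGaussianLaw.memLp_two

theorem ProbabilityTheory.HasLaw.integral_eval_normalLaw {Ω : Type*} {mΩ : MeasurableSpace Ω}
    {μ : Measure Ω} {U : Ω → Fin k → ℝ} {m : Fin k → ℝ} {S : Matrix (Fin k) (Fin k) ℝ}
    (hU : HasLaw U (normalLaw m S) μ) (a : Fin k) : ∫ ω, U ω a ∂μ = m a := by
  rw [← _root_.integral_eval_normalLaw m S a]
  exact hU.integral_comp (f := fun x => x a) (measurable_pi_apply a).aestronglyMeasurable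

theorem ProbabilityTheory.HasLaw.secondMoment_normalLaw {Ω : Type*} {mΩ : MeasurableSpace Ω}
    {μ : Measure Ω} {U : Ω → Fin k → ℝ} {S : Matrix (Fin k) (Fin k) ℝ} (hS : S.PosSemidef)
    (hU : HasLaw U (normalLaw 0 S) μ) : secondMoment μ U U = S := by
  conv_rhs => rw [← _root_.secondMoment_normalLaw hS]
  ext a b
  exact hU.integral_comp (f := fun x => x a * x b) (by fun_prop)

/-- A centred Gaussian vector is determined by its second moments. -/
theorem ProbabilityTheory.HasGaussianLaw.hasLaw_normalLaw {Ω : Type*} {mΩ : MeasurableSpace Ω}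
    {μ : Measure Ω} {U : Ω → Fin k → ℝ} (hU : HasGaussianLaw U μ)
    (h0 : ∀ a, ∫ ω, U ω a ∂μ = 0) : HasLaw U (normalLaw 0 (secondMoment μ U U)) μ := by
  have hps := secondMoment_posSemidef hU.memLp_two
  have := hU.isProbabilityMeasure
  have := hU.isGaussian_map
  refine ⟨hU.aemeasurable, ?_⟩
  have hg : IsGaussian ((μ.map U).map (WithLp.toLp 2)) := by
    rw [← PiLp.coe_symm_continuousLinearEquiv 2 ℝ]
    infer_instance
  have key : (μ.map U).map (WithLp.toLp 2) =
      multivariateGaussian (WithLp.toLp 2 0) (secondMoment μ U U) := by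
    have hmap : (μ.map U).map (WithLp.toLp 2) = μ.map fun ω => WithLp.toLp 2 (U ω) :=
      AEMeasurable.map_map_of_aemeasurable (by fun_prop) hU.aemeasurable
    refine IsGaussian.ext ?_ ?_
    · rw [integral_id_multivariateGaussian']
      ext a
      have h2 := (EuclideanSpace.proj (𝕜 := ℝ) a).integral_comp_comm
        (IsGaussian.integrable_id (μ := (μ.map U).map (WithLp.toLp 2)))
      refine h2.symm.trans ?_
      rw [hmap, integral_map (by fun_prop) (by fun_prop)]
      exact h0 a
    · rw [← ContinuousLinearMap.toBilinForm_inj]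
      refine LinearMap.BilinForm.ext_basis (EuclideanSpace.basisFun (Fin k) ℝ).toBasis
        fun i j ↦ ?_
      rw [ContinuousLinearMap.toBilinForm_apply, ContinuousLinearMap.toBilinForm_apply,
        covarianceBilin_multivariateGaussian hps, hmap]
      have h3 := covarianceBilin_apply_basisFun (X := fun i ω => U ω i)
        (fun i => hU.memLp_two.eval i) i j
      rw [OrthonormalBasis.coe_toBasis, h3, covariance, h0, h0]
      simp [secondMoment]
  rw [normalLaw, ← key, Measure.map_map (by fun_prop) (by fun_prop)]
  simp [Function.comp_def]

end NormalLaw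

/-! ### Gaussian residuals: independence criteria and covariance algebra -/

theorem Measurable.matrix_mulVec {S m n : Type*} {mS : MeasurableSpace S} [Fintype n]
    (A : Matrix m n ℝ) {f : S → n → ℝ} (hf : Measurable f) : Measurable fun ω => A *ᵥ f ω :=
  measurable_pi_iff.2 fun i => Finset.measurable_sum _ fun j _ =>
    ((measurable_pi_apply j).comp hf).const_mul (A i j)

theorem ProbabilityTheory.HasGaussianLaw.indepFun_of_secondMoment_eq_zero {S : Type*}
    {mS : MeasurableSpace S} {μ : Measure S} {a b : ℕ} {ρ : S → Fin a → ℝ} {e : S → Fin b → ℝ}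
    (hg : HasGaussianLaw (fun ω => (ρ ω, e ω)) μ) (h0 : ∀ a, ∫ ω, ρ ω a ∂μ = 0)
    (h : secondMoment μ ρ e = 0) : ρ ⟂ᵢ[μ] e := by
  have := hg.isProbabilityMeasure
  refine HasGaussianLaw.indepFun_of_covariance_eval (X := fun a ω => ρ ω a)
    (Y := fun b ω => e ω b) hg fun a b => ?_
  have h1 : cov[fun ω => ρ ω a, fun ω => e ω b; μ] = ∫ ω, ρ ω a * e ω b ∂μ := by
    rw [covariance_eq_sub (hg.fst.memLp_two.eval a) (hg.snd.memLp_two.eval b), h0, zero_mul,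
      sub_zero]
    rfl
  rw [h1]
  exact congrFun (congrFun h a) b

theorem ProbabilityTheory.HasLaw.integral_mulVec_normalLaw {S : Type*} {mS : MeasurableSpace S}
    {μ : Measure S} {k a : ℕ} {U : S → Fin k → ℝ} {T : Matrix (Fin k) (Fin k) ℝ}
    [IsProbabilityMeasure μ] (hU : HasLaw U (normalLaw 0 T) μ) (F : Matrix (Fin a) (Fin k) ℝ)
    (c : Fin a) : ∫ ω, (F *ᵥ U ω) c ∂μ = 0 := by
  simp only [Matrix.mulVec, dotProduct]
  rw [integral_finsetSum _ fun j _ =>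
    ((hU.memLp_normalLaw.eval j).integrable one_le_two).const_mul _]
  refine Finset.sum_eq_zero fun j _ => ?_
  rw [integral_const_mul, hU.integral_eval_normalLaw, Pi.zero_apply, mul_zero]

/-- `(X, Z)` is a function of `(Z, e)`. This lets `Z` have an arbitrary law: only `e` and `ρ` come
from Gaussian arguments. -/
theorem ProbabilityTheory.IndepFun.add_prodMk_left {S : Type*} {mS : MeasurableSpace S}
    {μ : Measure S} [IsProbabilityMeasure μ] {a b c : ℕ} {Z : S → Fin a → ℝ} {e : S → Fin b → ℝ}
    {ρ : S → Fin c → ℝ} (hZ : Measurable Z) (he : Measurable e) (hρ : Measurable ρ)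
    (h₁ : Z ⟂ᵢ[μ] (fun ω => (e ω, ρ ω))) (h₂ : e ⟂ᵢ[μ] ρ) {g : (Fin a → ℝ) → Fin b → ℝ}
    (hg : Measurable g) {X : S → Fin b → ℝ} (hX : ∀ ω, X ω = g (Z ω) + e ω) :
    (fun ω => (X ω, Z ω)) ⟂ᵢ[μ] ρ := by
  have hm : Measurable fun t : (Fin a → ℝ) × (Fin b → ℝ) => (g t.1 + t.2, t.1) :=
    ((hg.comp measurable_fst).add measurable_snd).prodMk measurable_fst
  obtain rfl : X = fun ω => g (Z ω) + e ω := funext hX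
  exact (IndepFun.prodMk_left hZ he hρ h₁ h₂).comp hm measurable_id

section ResidualAlgebra

variable {q h : Type*} [Fintype q] [Fintype h] (A Ψ : Matrix q q ℝ)
  (Λ : Matrix h q ℝ) (Ω : Matrix h h ℝ) (D : Matrix q h ℝ)

/-- With `A = (I - B)⁻¹` and `D` the regression matrix of `ξ` on `X`, the left side is the
covariance of the prediction residual with `X - E[X | Z]`; the right side then vanishes by the
normal equations. -/
theorem residual_mul_predictor [DecidableEq h] :
    (A - D * (Λ * A)) * Ψ * (Λ * A)ᵀ + -D * Ω * (1 : Matrix h h ℝ)ᵀ =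
      A * Ψ * Aᵀ * Λᵀ - D * (Λ * (A * Ψ * Aᵀ) * Λᵀ + Ω) := by
  simp only [Matrix.transpose_mul, Matrix.transpose_one, Matrix.mul_one, Matrix.sub_mul,
    Matrix.neg_mul, Matrix.mul_add, Matrix.mul_assoc]
  abel

theorem residual_mul_residual :
    (A - D * (Λ * A)) * Ψ * (A - D * (Λ * A))ᵀ + -D * Ω * (-D)ᵀ =
      A * Ψ * Aᵀ - D * (Λ * (A * Ψ * Aᵀ)) -
        (A * Ψ * Aᵀ * Λᵀ - D * (Λ * (A * Ψ * Aᵀ) * Λᵀ + Ω)) * Dᵀ := by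
  simp only [Matrix.transpose_mul, Matrix.transpose_sub, Matrix.transpose_neg, Matrix.sub_mul,
    Matrix.mul_sub, Matrix.neg_mul, Matrix.mul_neg, Matrix.mul_add, Matrix.add_mul,
    Matrix.mul_assoc]
  abel

end ResidualAlgebra

/-! ### The conditional law of the latent predictors given `(X, Z)` -/

namespace SEMVariables.Follows

variable {S : Type*} [MeasurableSpace S] {r q h l p m : ℕ} {V : SEMVariables S r q h p m}
  {μ : Measure S} {φ : (Fin q → ℝ) → Fin l → ℝ}
  {θ₁ : Stage1Param r q h} {θ₂ : Stage2Param r h l p m}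

theorem ξ_eq (hV : V.Follows μ φ θ₁ θ₂) (hadm : θ₁.Admissible) (i : ℕ) (ω : S) :
    V.ξ i ω = θ₁.meanXi (V.Z i ω) + (1 - θ₁.B)⁻¹ *ᵥ V.ζ' i ω := by
  have h1 : (1 - θ₁.B) *ᵥ V.ξ i ω = θ₁.α + θ₁.Γ *ᵥ V.Z i ω + V.ζ' i ω := by
    rw [Matrix.sub_mulVec, Matrix.one_mulVec, sub_eq_iff_eq_add]
    conv_lhs => rw [hV.latent_predictor i ω]
    abel
  have h2 := congrArg ((1 - θ₁.B)⁻¹ *ᵥ ·) h1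
  simp only [Matrix.mulVec_mulVec, Matrix.nonsing_inv_mul _ hadm.solvable,
    Matrix.one_mulVec] at h2
  rw [h2, Stage1Param.meanXi, Matrix.mulVec_add]

theorem X_sub_meanX (hV : V.Follows μ φ θ₁ θ₂) (hadm : θ₁.Admissible) (i : ℕ) (ω : S) :
    V.X i ω - θ₁.meanX (V.Z i ω) =
      (θ₁.Λ * (1 - θ₁.B)⁻¹) *ᵥ V.ζ' i ω + V.ε' i ω := by
  rw [hV.indicator, hV.ξ_eq hadm, Stage1Param.meanX, Matrix.mulVec_add, Matrix.mulVec_mulVec]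
  abel

/-- `Z` cancels: the residual is linear in the Gaussian errors `ζ', ε'` alone, hence Gaussian and
independent of `Z`. -/
theorem ξ_sub_postMean (hV : V.Follows μ φ θ₁ θ₂) (hadm : θ₁.Admissible) (i : ℕ) (ω : S) :
    V.ξ i ω - θ₁.postMean (V.X i ω) (V.Z i ω) = ((1 - θ₁.B)⁻¹ -
      θ₁.covXiX * θ₁.covX⁻¹ * (θ₁.Λ * (1 - θ₁.B)⁻¹)) *ᵥ V.ζ' i ω +
      (-(θ₁.covXiX * θ₁.covX⁻¹)) *ᵥ V.ε' i ω := by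
  rw [Stage1Param.postMean, hV.X_sub_meanX hadm, hV.ξ_eq hadm, Matrix.sub_mulVec,
    Matrix.neg_mulVec, Matrix.mulVec_add, Matrix.mulVec_mulVec]
  abel

theorem measurable_ξ (hV : V.Follows μ φ θ₁ θ₂) (hadm : θ₁.Admissible) (i : ℕ) :
    Measurable (V.ξ i) := by
  have h1 := hV.measurable_Z i
  have h2 := hV.measurable_ζ' i
  have : V.ξ i = fun ω => (1 - θ₁.B)⁻¹ *ᵥ (θ₁.α + θ₁.Γ *ᵥ V.Z i ω) +
    (1 - θ₁.B)⁻¹ *ᵥ V.ζ' i ω := funext fun ω => hV.ξ_eq hadm i ω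
  rw [this]
  exact (((h1.matrix_mulVec _).const_add _).matrix_mulVec _).add (h2.matrix_mulVec _)

theorem measurable_X (hV : V.Follows μ φ θ₁ θ₂) (hadm : θ₁.Admissible) (i : ℕ) :
    Measurable (V.X i) := by
  have : V.X i = fun ω => θ₁.ν + θ₁.Λ *ᵥ V.ξ i ω + θ₁.K *ᵥ V.Z i ω + V.ε' i ω :=
    funext fun ω => hV.indicator i ω
  rw [this]
  exact ((((hV.measurable_ξ hadm i).matrix_mulVec _).const_add _).add
    ((hV.measurable_Z i).matrix_mulVec _)).add (hV.measurable_ε' i)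

theorem measurable_X_sub_meanX (hV : V.Follows μ φ θ₁ θ₂) (hadm : θ₁.Admissible) (i : ℕ) :
    Measurable fun ω => V.X i ω - θ₁.meanX (V.Z i ω) :=
  Measurable.sub (hV.measurable_X hadm i)
    (θ₁.continuous_meanX.measurable.comp (hV.measurable_Z i))

theorem measurable_ξ_sub_postMean (hV : V.Follows μ φ θ₁ θ₂) (hadm : θ₁.Admissible) (i : ℕ) :
    Measurable fun ω => V.ξ i ω - θ₁.postMean (V.X i ω) (V.Z i ω) := by
  have hm : Measurable fun w : (Fin h → ℝ) × (Fin r → ℝ) => θ₁.postMean w.1 w.2 :=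
    θ₁.continuous_postMean.measurable
  have hW : Measurable fun ω => (V.X i ω, V.Z i ω) :=
    (hV.measurable_X hadm i).prodMk (hV.measurable_Z i)
  have hc := hm.comp hW
  exact (hV.measurable_ξ hadm i).sub hc

variable [IsProbabilityMeasure μ]

theorem indep_components (hV : V.Follows μ φ θ₁ θ₂) (i : ℕ) :
    (HasLaw (V.Z i) (μ.map (V.Z 0)) μ ∧ HasLaw (V.ζ' i) (normalLaw 0 θ₁.Ψ) μ ∧
      HasLaw (V.ε' i) (normalLaw 0 θ₁.Ω) μ ∧ HasLaw (V.ζ i) (μ.map (V.ζ 0)) μ ∧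
      HasLaw (V.ε i) (μ.map (V.ε 0)) μ) ∧
    V.Z i ⟂ᵢ[μ] (fun ω => (V.ζ' i ω, V.ε' i ω, V.ζ i ω, V.ε i ω)) ∧
    V.ζ' i ⟂ᵢ[μ] (fun ω => (V.ε' i ω, V.ζ i ω, V.ε i ω)) ∧
    V.ε' i ⟂ᵢ[μ] (fun ω => (V.ζ i ω, V.ε i ω)) ∧ V.ζ i ⟂ᵢ[μ] V.ε i := by
  have : IsProbabilityMeasure (μ.map (V.Z 0)) :=
    Measure.isProbabilityMeasure_map (hV.measurable_Z 0).aemeasurable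
  have : IsProbabilityMeasure (μ.map (V.ζ 0)) :=
    Measure.isProbabilityMeasure_map (hV.measurable_ζ 0).aemeasurable
  have : IsProbabilityMeasure (μ.map (V.ε 0)) :=
    Measure.isProbabilityMeasure_map (hV.measurable_ε 0).aemeasurable
  obtain ⟨hZ, h1, i1⟩ := indepFun_of_hasLaw_prod (hV.law i)
  obtain ⟨hζ', h2, i2⟩ := indepFun_of_hasLaw_prod h1
  obtain ⟨hε', h3, i3⟩ := indepFun_of_hasLaw_prod h2
  obtain ⟨hζ, hε, i4⟩ := indepFun_of_hasLaw_prod h3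
  exact ⟨⟨hZ, hζ', hε', hζ, hε⟩, i1, i2, i3, i4⟩

theorem indep_Z (hV : V.Follows μ φ θ₁ θ₂) (i : ℕ) :
    V.Z i ⟂ᵢ[μ] (fun ω => (V.ζ' i ω, V.ε' i ω)) :=
  (hV.indep_components i).2.1.comp (φ := id)
    (ψ := fun t : (Fin q → ℝ) × (Fin h → ℝ) × (Fin p → ℝ) × (Fin m → ℝ) => (t.1, t.2.1))
    measurable_id (by fun_prop)

theorem indep_stage2 (hV : V.Follows μ φ θ₁ θ₂) (i : ℕ) :
    (fun ω => (V.Z i ω, V.ζ' i ω, V.ε' i ω)) ⟂ᵢ[μ] (fun ω => (V.ζ i ω, V.ε i ω)) := by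
  obtain ⟨-, i1, i2, i3, -⟩ := hV.indep_components i
  have hζ' := hV.measurable_ζ' i
  have hε' := hV.measurable_ε' i
  have hζε : Measurable fun ω => (V.ζ i ω, V.ε i ω) :=
    (hV.measurable_ζ i).prodMk (hV.measurable_ε i)
  refine IndepFun.prodMk_left (hV.measurable_Z i) (hζ'.prodMk hε') hζε ?_
    (IndepFun.prodMk_left hζ' hε' hζε i2 i3)
  exact i1.comp (φ := id) (ψ := fun t => ((t.1, t.2.1), t.2.2)) measurable_id (by fun_prop)

/-- The second moments of two linear functions of `(ζ', ε')`. -/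
theorem secondMoment_stage1 (hV : V.Follows μ φ θ₁ θ₂) (hadm : θ₁.Admissible) (i : ℕ)
    {a b : ℕ} (F₁ : Matrix (Fin a) (Fin q) ℝ) (F₂ : Matrix (Fin a) (Fin h) ℝ)
    (G₁ : Matrix (Fin b) (Fin q) ℝ) (G₂ : Matrix (Fin b) (Fin h) ℝ) :
    secondMoment μ (fun ω => F₁ *ᵥ V.ζ' i ω + F₂ *ᵥ V.ε' i ω)
      (fun ω => G₁ *ᵥ V.ζ' i ω + G₂ *ᵥ V.ε' i ω) =
      F₁ * θ₁.Ψ * G₁ᵀ + F₂ * θ₁.Ω * G₂ᵀ := by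
  obtain ⟨⟨-, hζ', hε', -, -⟩, -, i2, -, -⟩ := hV.indep_components i
  have m1 := hζ'.memLp_normalLaw
  have m2 := hε'.memLp_normalLaw
  have hind : V.ζ' i ⟂ᵢ[μ] V.ε' i := i2.comp measurable_id measurable_fst
  have h0 : secondMoment μ (V.ζ' i) (V.ε' i) = 0 :=
    secondMoment_eq_zero_of_indepFun m1.1 m2.1 hind fun a => hζ'.integral_eval_normalLaw a
  have h0' : secondMoment μ (V.ε' i) (V.ζ' i) = 0 := by
    rw [← transpose_secondMoment, h0, Matrix.transpose_zero]
  have mG : MemLp (fun ω => G₁ *ᵥ V.ζ' i ω + G₂ *ᵥ V.ε' i ω) 2 μ :=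
    (m1.mulVec G₁).add (m2.mulVec G₂)
  rw [secondMoment_add_left (m1.mulVec F₁) (m2.mulVec F₂) mG,
    secondMoment_add_right (m1.mulVec F₁) (m1.mulVec G₁) (m2.mulVec G₂),
    secondMoment_add_right (m2.mulVec F₂) (m1.mulVec G₁) (m2.mulVec G₂),
    secondMoment_mulVec m1 m1, secondMoment_mulVec m1 m2, secondMoment_mulVec m2 m1,
    secondMoment_mulVec m2 m2, h0, h0', hζ'.secondMoment_normalLaw hadm.psi_posDef.posSemidef,
    hε'.secondMoment_normalLaw hadm.omega_posDef.posSemidef]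
  simp

theorem secondMoment_X_sub_meanX (hV : V.Follows μ φ θ₁ θ₂) (hadm : θ₁.Admissible) (i : ℕ) :
    secondMoment μ (fun ω => V.X i ω - θ₁.meanX (V.Z i ω))
      (fun ω => V.X i ω - θ₁.meanX (V.Z i ω)) = θ₁.covX := by
  have h1 := hV.secondMoment_stage1 hadm i (θ₁.Λ * (1 - θ₁.B)⁻¹) 1 (θ₁.Λ * (1 - θ₁.B)⁻¹) 1
  simp only [Matrix.one_mulVec, ← hV.X_sub_meanX hadm] at h1
  rw [h1, Stage1Param.covX, Stage1Param.covXi]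
  simp only [Matrix.transpose_mul, Matrix.transpose_one, Matrix.mul_one, Matrix.one_mul,
    Matrix.mul_assoc]

theorem secondMoment_ξ_sub_postMean_X (hV : V.Follows μ φ θ₁ θ₂) (hadm : θ₁.Admissible) (i : ℕ) :
    secondMoment μ (fun ω => V.ξ i ω - θ₁.postMean (V.X i ω) (V.Z i ω))
      (fun ω => V.X i ω - θ₁.meanX (V.Z i ω)) = 0 := by
  have hu := (Matrix.isUnit_iff_isUnit_det _).1 hadm.covX_posDef.isUnit
  have h1 := hV.secondMoment_stage1 hadm i ((1 - θ₁.B)⁻¹ -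
      θ₁.covXiX * θ₁.covX⁻¹ * (θ₁.Λ * (1 - θ₁.B)⁻¹)) (-(θ₁.covXiX * θ₁.covX⁻¹))
      (θ₁.Λ * (1 - θ₁.B)⁻¹) 1
  simp only [← hV.ξ_sub_postMean hadm] at h1
  simp only [Matrix.one_mulVec, ← hV.X_sub_meanX hadm] at h1
  rw [h1]
  refine (residual_mul_predictor _ _ _ _ _).trans ?_
  change θ₁.covXiX - θ₁.covXiX * θ₁.covX⁻¹ * θ₁.covX = 0
  rw [Matrix.mul_assoc, Matrix.nonsing_inv_mul _ hu, Matrix.mul_one, sub_self]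

theorem secondMoment_ξ_sub_postMean (hV : V.Follows μ φ θ₁ θ₂) (hadm : θ₁.Admissible) (i : ℕ) :
    secondMoment μ (fun ω => V.ξ i ω - θ₁.postMean (V.X i ω) (V.Z i ω))
      (fun ω => V.ξ i ω - θ₁.postMean (V.X i ω) (V.Z i ω)) = θ₁.postCov := by
  have hu := (Matrix.isUnit_iff_isUnit_det _).1 hadm.covX_posDef.isUnit
  have hsym : θ₁.covXiᵀ = θ₁.covXi := (by simpa using hadm.covXi_posDef.isHermitian :
    θ₁.covXi.IsSymm)
  set F₁ := (1 - θ₁.B)⁻¹ - θ₁.covXiX * θ₁.covX⁻¹ * (θ₁.Λ * (1 - θ₁.B)⁻¹) with hF₁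
  set F₂ := -(θ₁.covXiX * θ₁.covX⁻¹) with hF₂
  have h1 := hV.secondMoment_stage1 hadm i F₁ F₂ F₁ F₂
  simp only [hF₁, hF₂, ← hV.ξ_sub_postMean hadm] at h1
  rw [h1]
  refine (residual_mul_residual _ _ _ _ _).trans ?_
  change θ₁.covXi - θ₁.covXiX * θ₁.covX⁻¹ * (θ₁.Λ * θ₁.covXi) -
    (θ₁.covXiX - θ₁.covXiX * θ₁.covX⁻¹ * θ₁.covX) * (θ₁.covXiX * θ₁.covX⁻¹)ᵀ = _
  rw [Matrix.mul_assoc θ₁.covXiX θ₁.covX⁻¹ θ₁.covX, Matrix.nonsing_inv_mul _ hu, Matrix.mul_one,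
    sub_self, Matrix.zero_mul, sub_zero, Stage1Param.postCov]
  conv_rhs => enter [2, 2]; rw [Stage1Param.covXiX, Matrix.transpose_mul,
    Matrix.transpose_transpose, hsym]

theorem hasGaussianLaw_stage1 (hV : V.Follows μ φ θ₁ θ₂) (i : ℕ)
    {a b : ℕ} (F₁ : Matrix (Fin a) (Fin q) ℝ) (F₂ : Matrix (Fin a) (Fin h) ℝ)
    (G₁ : Matrix (Fin b) (Fin q) ℝ) (G₂ : Matrix (Fin b) (Fin h) ℝ) :
    HasGaussianLaw (fun ω => (F₁ *ᵥ V.ζ' i ω + F₂ *ᵥ V.ε' i ω,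
      G₁ *ᵥ V.ζ' i ω + G₂ *ᵥ V.ε' i ω)) μ := by
  obtain ⟨⟨-, hζ', hε', -, -⟩, -, i2, -, -⟩ := hV.indep_components i
  have hind : V.ζ' i ⟂ᵢ[μ] V.ε' i := i2.comp measurable_id measurable_fst
  have hg := IndepFun.hasGaussianLaw hζ'.hasGaussianLaw hε'.hasGaussianLaw hind
  let T : (Fin q → ℝ) × (Fin h → ℝ) →ₗ[ℝ] (Fin a → ℝ) × (Fin b → ℝ) :=
    (F₁.mulVecLin.comp (LinearMap.fst ℝ _ _) + F₂.mulVecLin.comp (LinearMap.snd ℝ _ _)).prod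
      (G₁.mulVecLin.comp (LinearMap.fst ℝ _ _) + G₂.mulVecLin.comp (LinearMap.snd ℝ _ _))
  exact hg.map_fun (LinearMap.toContinuousLinearMap T)

theorem hasGaussianLaw_residual (hV : V.Follows μ φ θ₁ θ₂) (hadm : θ₁.Admissible) (i : ℕ) :
    HasGaussianLaw (fun ω => (V.ξ i ω - θ₁.postMean (V.X i ω) (V.Z i ω),
      V.X i ω - θ₁.meanX (V.Z i ω))) μ := by
  have h1 := hV.hasGaussianLaw_stage1 i ((1 - θ₁.B)⁻¹ -
      θ₁.covXiX * θ₁.covX⁻¹ * (θ₁.Λ * (1 - θ₁.B)⁻¹)) (-(θ₁.covXiX * θ₁.covX⁻¹))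
      (θ₁.Λ * (1 - θ₁.B)⁻¹) 1
  simp only [← hV.ξ_sub_postMean hadm] at h1
  simpa only [Matrix.one_mulVec, ← hV.X_sub_meanX hadm] using h1

theorem integral_stage1 (hV : V.Follows μ φ θ₁ θ₂) (i : ℕ) {a : ℕ}
    (F₁ : Matrix (Fin a) (Fin q) ℝ) (F₂ : Matrix (Fin a) (Fin h) ℝ) (c : Fin a) :
    ∫ ω, (F₁ *ᵥ V.ζ' i ω + F₂ *ᵥ V.ε' i ω) c ∂μ = 0 := by
  obtain ⟨⟨-, hζ', hε', -, -⟩, -⟩ := hV.indep_components i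
  have m1 := (hζ'.memLp_normalLaw.mulVec F₁).eval c
  have m2 := (hε'.memLp_normalLaw.mulVec F₂).eval c
  simp_rw [Pi.add_apply]
  rw [integral_add (m1.integrable one_le_two) (m2.integrable one_le_two),
    hζ'.integral_mulVec_normalLaw, hε'.integral_mulVec_normalLaw, add_zero]

theorem integral_ξ_sub_postMean (hV : V.Follows μ φ θ₁ θ₂) (hadm : θ₁.Admissible) (i : ℕ)
    (c : Fin q) : ∫ ω, (V.ξ i ω - θ₁.postMean (V.X i ω) (V.Z i ω)) c ∂μ = 0 := by
  simp only [hV.ξ_sub_postMean hadm]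
  exact hV.integral_stage1 i _ _ c

theorem integral_X_sub_meanX (hV : V.Follows μ φ θ₁ θ₂) (hadm : θ₁.Admissible) (i : ℕ)
    (c : Fin h) : ∫ ω, (V.X i ω - θ₁.meanX (V.Z i ω)) c ∂μ = 0 := by
  have h1 := hV.integral_stage1 i (θ₁.Λ * (1 - θ₁.B)⁻¹) 1 c
  simpa only [Matrix.one_mulVec, ← hV.X_sub_meanX hadm] using h1

theorem hasLaw_ξ_sub_postMean (hV : V.Follows μ φ θ₁ θ₂) (hadm : θ₁.Admissible) (i : ℕ) :
    HasLaw (fun ω => V.ξ i ω - θ₁.postMean (V.X i ω) (V.Z i ω)) (normalLaw 0 θ₁.postCov) μ := by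
  have := (hV.hasGaussianLaw_residual hadm i).fst.hasLaw_normalLaw
    (hV.integral_ξ_sub_postMean hadm i)
  rwa [hV.secondMoment_ξ_sub_postMean hadm i] at this

theorem indep_Z_residual (hV : V.Follows μ φ θ₁ θ₂) (hadm : θ₁.Admissible) (i : ℕ) :
    V.Z i ⟂ᵢ[μ] (fun ω => (V.X i ω - θ₁.meanX (V.Z i ω),
      V.ξ i ω - θ₁.postMean (V.X i ω) (V.Z i ω))) := by
  simp only [hV.ξ_sub_postMean hadm]
  simp only [hV.X_sub_meanX hadm]
  generalize (1 - θ₁.B)⁻¹ - θ₁.covXiX * θ₁.covX⁻¹ * (θ₁.Λ * (1 - θ₁.B)⁻¹) = F₁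
  generalize -(θ₁.covXiX * θ₁.covX⁻¹) = F₂
  generalize θ₁.Λ * (1 - θ₁.B)⁻¹ = F₃
  have hm : Measurable fun t : (Fin q → ℝ) × (Fin h → ℝ) =>
      (F₃ *ᵥ t.1 + t.2, F₁ *ᵥ t.1 + F₂ *ᵥ t.2) :=
    ((measurable_fst.matrix_mulVec _).add measurable_snd).prodMk
      ((measurable_fst.matrix_mulVec _).add (measurable_snd.matrix_mulVec _))
  exact (hV.indep_Z i).comp measurable_id hm

theorem indep_residual (hV : V.Follows μ φ θ₁ θ₂) (hadm : θ₁.Admissible) (i : ℕ) :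
    (fun ω => V.X i ω - θ₁.meanX (V.Z i ω)) ⟂ᵢ[μ]
      (fun ω => V.ξ i ω - θ₁.postMean (V.X i ω) (V.Z i ω)) := by
  refine IndepFun.symm ?_
  refine HasGaussianLaw.indepFun_of_secondMoment_eq_zero
    (hV.hasGaussianLaw_residual hadm i) ?_ ?_
  · exact hV.integral_ξ_sub_postMean hadm i
  · exact hV.secondMoment_ξ_sub_postMean_X hadm i

/-- The residual is a function of the stage-one errors, so `Z` is independent of it together with `X
- E[X | Z]`. The two residuals are jointly Gaussian and uncorrelated, hence independent of each
other. Together they yield independence from `(X, Z)`, which is why the linear prediction determines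
the whole conditional law. -/
theorem indep_X_Z_residual (hV : V.Follows μ φ θ₁ θ₂) (hadm : θ₁.Admissible) (i : ℕ) :
    (fun ω => (V.X i ω, V.Z i ω)) ⟂ᵢ[μ]
      (fun ω => V.ξ i ω - θ₁.postMean (V.X i ω) (V.Z i ω)) := by
  refine IndepFun.add_prodMk_left (e := fun ω => V.X i ω - θ₁.meanX (V.Z i ω)) (g := θ₁.meanX)
    (hV.measurable_Z i) ?_ ?_ ?_ ?_ ?_ ?_
  · exact hV.measurable_X_sub_meanX hadm i
  · exact hV.measurable_ξ_sub_postMean hadm i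
  · exact hV.indep_Z_residual hadm i
  · exact hV.indep_residual hadm i
  · exact θ₁.continuous_meanX.measurable
  · exact fun ω => (add_sub_cancel _ _).symm

/-- Since `φ(ξ) = φ(postMean + ρ)` with `ρ` independent of `(X, Z)`, the conditional law of `ρ` is
constant, and integrating it out gives the prediction. -/
theorem condPhi_ae_eq (hV : V.Follows μ φ θ₁ θ₂) (hadm : θ₁.Admissible) (hφ : Measurable φ) (i : ℕ)
    (hint : ∀ c, Integrable (fun ω => φ (V.ξ i ω) c) μ) :
    V.condPhi μ φ i =ᵐ[μ] fun ω => θ₁.predict φ (V.X i ω) (V.Z i ω) := by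
  have hlaw := hV.hasLaw_ξ_sub_postMean hadm i
  have hind := hV.indep_X_Z_residual hadm i
  set ρ : S → Fin q → ℝ := fun ω => V.ξ i ω - θ₁.postMean (V.X i ω) (V.Z i ω) with hρ
  set W : S → (Fin h → ℝ) × (Fin r → ℝ) := fun ω => (V.X i ω, V.Z i ω) with hW
  have hWm : Measurable W := (hV.measurable_X hadm i).prodMk (hV.measurable_Z i)
  have hcd : condDistrib ρ W μ =ᵐ[μ.map W] Kernel.const _ (normalLaw 0 θ₁.postCov) := by
    refine condDistrib_ae_eq_of_measure_eq_compProd W hlaw.aemeasurable ?_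
    rw [hind.map_prod_eq_prod_map_map hWm.aemeasurable hlaw.aemeasurable, hlaw.map_eq,
      Measure.compProd_const]
  have hcd' := ae_of_ae_map hWm.aemeasurable hcd
  have hall : ∀ c, (fun ω => V.condPhi μ φ i ω c) =ᵐ[μ]
      fun ω => θ₁.predict φ (V.X i ω) (V.Z i ω) c := fun c => by
    have hf : Measurable fun t : ((Fin h → ℝ) × (Fin r → ℝ)) × (Fin q → ℝ) =>
        φ (θ₁.postMean t.1.1 t.1.2 + t.2) c :=
      (measurable_pi_apply c).comp (hφ.comp
        ((θ₁.continuous_postMean.measurable.comp measurable_fst).add measurable_snd))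
    have hfeq : (fun ω => φ (θ₁.postMean (W ω).1 (W ω).2 + ρ ω) c) = fun ω => φ (V.ξ i ω) c := by
      funext ω
      simp [hρ, hW]
    have h1 := condExp_prod_ae_eq_integral_condDistrib (μ := μ) (Y := ρ)
      (f := fun t : ((Fin h → ℝ) × (Fin r → ℝ)) × (Fin q → ℝ) =>
        φ (θ₁.postMean t.1.1 t.1.2 + t.2) c) hWm hlaw.aemeasurable hf.stronglyMeasurable
      (by simpa only [hfeq] using hint c)
    simp only [hfeq] at h1
    filter_upwards [h1, hcd'] with ω h2 h3
    rw [condPhi]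
    refine h2.trans ?_
    rw [h3, Stage1Param.predict_eq_integral hφ]
    rfl
  filter_upwards [ae_all_iff.2 hall] with ω hω
  exact funext hω

end SEMVariables.Follows

/-! ### Laws of large numbers, moments, and orthogonality of the prediction error -/

namespace SEMVariables

variable {S : Type*} [MeasurableSpace S] {r q h l p m : ℕ} {V : SEMVariables S r q h p m}
  {μ : Measure S} {φ : (Fin q → ℝ) → Fin l → ℝ}
  {θ₁ : Stage1Param r q h} {θ₂ : Stage2Param r h l p m}

/-- The variables of subject `i` which matter for the estimation. -/
def obs (V : SEMVariables S r q h p m) (i : ℕ) (ω : S) :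
    (Fin m → ℝ) × (Fin r → ℝ) × (Fin h → ℝ) × (Fin q → ℝ) :=
  (V.Y i ω, V.Z i ω, V.X i ω, V.ξ i ω)

/-- The limit of the stage-two estimator. -/
noncomputable abbrev limitParam (V : SEMVariables S r q h p m) (μ : Measure S)
    (φ : (Fin q → ℝ) → Fin l → ℝ) (θ₂ : Stage2Param r h l p m) : Stage2Param r h l p m :=
  {θ₂ with Ψ := θ₂.Ψ + θ₂.B * V.covPredError μ φ * θ₂.Bᵀ}

namespace Follows

/-- One map `F` serves all subjects, so the observations inherit independence and identical
distribution from the primitive variables. -/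
theorem exists_measurable_obs (hV : V.Follows μ φ θ₁ θ₂) (hadm : θ₁.Admissible)
    (hφ : Measurable φ) :
    ∃ F : (Fin r → ℝ) × (Fin q → ℝ) × (Fin h → ℝ) × (Fin p → ℝ) × (Fin m → ℝ) →
        (Fin m → ℝ) × (Fin r → ℝ) × (Fin h → ℝ) × (Fin q → ℝ), Measurable F ∧
      ∀ i, V.obs i = fun ω => F (V.Z i ω, V.ζ' i ω, V.ε' i ω, V.ζ i ω, V.ε i ω) := by
  let fξ : (Fin r → ℝ) × (Fin q → ℝ) × (Fin h → ℝ) × (Fin p → ℝ) × (Fin m → ℝ) → Fin q → ℝ :=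
    fun t => (1 - θ₁.B)⁻¹ *ᵥ (θ₁.α + θ₁.Γ *ᵥ t.1) + (1 - θ₁.B)⁻¹ *ᵥ t.2.1
  let fX : (Fin r → ℝ) × (Fin q → ℝ) × (Fin h → ℝ) × (Fin p → ℝ) × (Fin m → ℝ) → Fin h → ℝ :=
    fun t => θ₁.ν + θ₁.Λ *ᵥ fξ t + θ₁.K *ᵥ t.1 + t.2.2.1
  let fη : (Fin r → ℝ) × (Fin q → ℝ) × (Fin h → ℝ) × (Fin p → ℝ) × (Fin m → ℝ) → Fin p → ℝ :=
    fun t => θ₂.α + θ₂.B *ᵥ φ (fξ t) + θ₂.Γ *ᵥ t.1 + t.2.2.2.1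
  let fY : (Fin r → ℝ) × (Fin q → ℝ) × (Fin h → ℝ) × (Fin p → ℝ) × (Fin m → ℝ) → Fin m → ℝ :=
    fun t => θ₂.ν + θ₂.Λ *ᵥ fη t + θ₂.K *ᵥ t.1 + θ₂.L *ᵥ fX t + t.2.2.2.2
  have mξ : Measurable fξ := Measurable.add
    (Measurable.matrix_mulVec _ ((measurable_fst.matrix_mulVec _).const_add _))
    (measurable_snd.fst.matrix_mulVec _)
  have mX : Measurable fX := (((mξ.matrix_mulVec _).const_add _).add
    (measurable_fst.matrix_mulVec _)).add measurable_snd.snd.fst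
  have mη : Measurable fη := ((((hφ.comp mξ).matrix_mulVec _).const_add _).add
    (measurable_fst.matrix_mulVec _)).add measurable_snd.snd.snd.fst
  have mY : Measurable fY := ((((mη.matrix_mulVec _).const_add _).add
    (measurable_fst.matrix_mulVec _)).add (mX.matrix_mulVec _)).add measurable_snd.snd.snd.snd
  refine ⟨fun t => (fY t, t.1, fX t, fξ t), mY.prodMk (measurable_fst.prodMk (mX.prodMk mξ)),
    fun i => funext fun ω => ?_⟩
  have eξ := hV.ξ_eq hadm i ω
  have eX := hV.indicator i ω
  have eη := hV.latent_outcome i ω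
  have eY := hV.outcome i ω
  rw [eX, eη] at eY
  rw [obs, eY, eX, eξ]
  rfl

theorem identDistrib_obs (hV : V.Follows μ φ θ₁ θ₂) (hadm : θ₁.Admissible) (hφ : Measurable φ)
    (i : ℕ) : IdentDistrib (V.obs i) (V.obs 0) μ μ := by
  obtain ⟨F, hF, hobs⟩ := hV.exists_measurable_obs hadm hφ
  rw [hobs, hobs]
  have : IdentDistrib (fun ω => (V.Z i ω, V.ζ' i ω, V.ε' i ω, V.ζ i ω, V.ε i ω))
      (fun ω => (V.Z 0 ω, V.ζ' 0 ω, V.ε' 0 ω, V.ζ 0 ω, V.ε 0 ω)) μ μ :=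
    ⟨(hV.law i).aemeasurable, (hV.law 0).aemeasurable,
      (hV.law i).map_eq.trans (hV.law 0).map_eq.symm⟩
  exact this.comp hF

theorem ae_tendsto_average (hV : V.Follows μ φ θ₁ θ₂) (hadm : θ₁.Admissible) (hφ : Measurable φ)
    {g : (Fin m → ℝ) × (Fin r → ℝ) × (Fin h → ℝ) × (Fin q → ℝ) → ℝ} (hg : Measurable g)
    (hint : Integrable (fun ω => g (V.obs 0 ω)) μ) :
    ∀ᵐ ω ∂μ, Tendsto (fun n : ℕ => (∑ i ∈ Finset.range n, g (V.obs i ω)) / n) atTop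
      (𝓝 (∫ ω, g (V.obs 0 ω) ∂μ)) := by
  obtain ⟨F, hF, hobs⟩ := hV.exists_measurable_obs hadm hφ
  refine strong_law_ae_real (fun i ω => g (V.obs i ω)) hint (fun i j hij => ?_)
    fun i => (hV.identDistrib_obs hadm hφ i).comp hg
  have := (hV.subjects_indep.indepFun hij).comp (hg.comp hF) (hg.comp hF)
  simp only [hobs]
  exact this

theorem identDistrib_X_Z (hV : V.Follows μ φ θ₁ θ₂) (hadm : θ₁.Admissible) (hφ : Measurable φ)
    (i : ℕ) : IdentDistrib (fun ω => (V.X i ω, V.Z i ω)) (fun ω => (V.X 0 ω, V.Z 0 ω)) μ μ :=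
  (hV.identDistrib_obs hadm hφ i).comp (u := fun t => (t.2.2.1, t.2.1)) (by fun_prop)

theorem measurable_X_Z (hV : V.Follows μ φ θ₁ θ₂) (hadm : θ₁.Admissible)
    (i : ℕ) : Measurable fun ω => (V.X i ω, V.Z i ω) :=
  (hV.measurable_X hadm i).prodMk (hV.measurable_Z i)

/-- The limit parameter differs from `θ₂` only in `Ψ`, which does not enter `meanY`; what remains is
the prediction error passed through `Λ B`, plus the stage-two errors. -/
theorem Y_sub_meanY (hV : V.Follows μ φ θ₁ θ₂) (ω : S) :
    V.Y 0 ω - (V.limitParam μ φ θ₂).meanY (V.Z 0 ω) (V.X 0 ω) (V.condPhi μ φ 0 ω) =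
      (θ₂.Λ * θ₂.B) *ᵥ V.predError μ φ 0 ω + (θ₂.Λ *ᵥ V.ζ 0 ω + V.ε 0 ω) := by
  rw [hV.outcome, hV.latent_outcome, predError]
  simp only [Stage2Param.meanY, Matrix.mulVec_add, Matrix.mulVec_sub, Matrix.mulVec_mulVec]
  abel

theorem memLp_condPhi {i : ℕ} (hφξ : MemLp (fun ω => φ (V.ξ i ω)) 2 μ) :
    MemLp (V.condPhi μ φ i) 2 μ :=
  MemLp.of_eval fun c => MemLp.condExp one_le_two (hφξ.eval c)

theorem memLp_predError {i : ℕ} (hφξ : MemLp (fun ω => φ (V.ξ i ω)) 2 μ) :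
    MemLp (V.predError μ φ i) 2 μ :=
  hφξ.sub (memLp_condPhi hφξ)

variable [IsProbabilityMeasure μ]

/-- Tonelli for the product law of `(X, Z)` and the residual. Using `lintegral` presupposes no
integrability, so the domination hypothesis can be turned into square integrability of `φ(ξ)`. -/
theorem lintegral_enorm_φ_sq (hV : V.Follows μ φ θ₁ θ₂) (hadm : θ₁.Admissible) (hφ : Measurable φ)
    (i : ℕ) : ∫⁻ ω, ‖φ (V.ξ i ω)‖ₑ ^ 2 ∂μ =
      ∫⁻ w, ∫⁻ u, ‖φ u‖ₑ ^ 2 ∂(θ₁.postLaw w.1 w.2) ∂(μ.map fun ω => (V.X i ω, V.Z i ω)) := by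
  have hlaw := hV.hasLaw_ξ_sub_postMean hadm i
  have hW := hV.measurable_X_Z hadm i
  have hprod := (hV.indep_X_Z_residual hadm i).map_prod_eq_prod_map_map hW.aemeasurable
    hlaw.aemeasurable
  rw [hlaw.map_eq] at hprod
  have hpm : Measurable fun w : (Fin h → ℝ) × (Fin r → ℝ) => θ₁.postMean w.1 w.2 :=
    θ₁.continuous_postMean.measurable
  have hf : Measurable fun t : ((Fin h → ℝ) × (Fin r → ℝ)) × (Fin q → ℝ) =>
      ‖φ (θ₁.postMean t.1.1 t.1.2 + t.2)‖ₑ ^ 2 :=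
    (hφ.comp ((hpm.comp measurable_fst).add measurable_snd)).enorm.pow_const 2
  have hsq : Measurable fun u => ‖φ u‖ₑ ^ 2 := hφ.enorm.pow_const 2
  have hin : ∀ w : (Fin h → ℝ) × (Fin r → ℝ), ∫⁻ u, ‖φ u‖ₑ ^ 2 ∂(θ₁.postLaw w.1 w.2) =
      ∫⁻ u, ‖φ (θ₁.postMean w.1 w.2 + u)‖ₑ ^ 2 ∂(normalLaw 0 θ₁.postCov) := fun w => by
    rw [Stage1Param.postLaw, normalLaw_eq_map_add, lintegral_map hsq (by fun_prop)]
  simp_rw [hin]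
  rw [← lintegral_prod _ hf.aemeasurable, ← hprod,
    lintegral_map hf (hW.prodMk (hV.measurable_ξ_sub_postMean hadm i))]
  simp

theorem memLp_φ_ξ (hV : V.Follows μ φ θ₁ θ₂) (hadm : θ₁.Admissible) (hφ : Measurable φ)
    {G : (Fin h → ℝ) × (Fin r → ℝ) → ℝ} (hG : Integrable G (μ.map fun ω => (V.X 0 ω, V.Z 0 ω)))
    (hle : ∀ᵐ w ∂(μ.map fun ω => (V.X 0 ω, V.Z 0 ω)),
      ∫⁻ u, ‖φ u‖ₑ ^ 2 ∂(θ₁.postLaw w.1 w.2) ≤ ENNReal.ofReal (G w)) (i : ℕ) :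
    MemLp (fun ω => φ (V.ξ i ω)) 2 μ := by
  have hm : Measurable fun ω => φ (V.ξ i ω) := hφ.comp (hV.measurable_ξ hadm i)
  refine (memLp_two_iff_integrable_sq_norm hm.aestronglyMeasurable).2
    ⟨(hm.norm.pow_const 2).aestronglyMeasurable, ?_⟩
  simp only [HasFiniteIntegral, enorm_pow, enorm_norm]
  rw [hV.lintegral_enorm_φ_sq hadm hφ i, (hV.identDistrib_X_Z hadm hφ i).map_eq]
  refine (lintegral_mono_ae hle).trans_lt ?_
  refine lt_of_le_of_lt (lintegral_mono fun w => ?_) hG.2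
  rw [← ofReal_norm]
  exact ENNReal.ofReal_le_ofReal (le_abs_self _)

theorem memLp_components (hV : V.Follows μ φ θ₁ θ₂) (i : ℕ) :
    MemLp (V.Z i) 2 μ ∧ MemLp (V.ζ' i) 2 μ ∧ MemLp (V.ε' i) 2 μ ∧ MemLp (V.ζ i) 2 μ ∧
      MemLp (V.ε i) 2 μ := by
  obtain ⟨⟨hZ, hζ', hε', hζ, hε⟩, -⟩ := hV.indep_components i
  refine ⟨?_, hζ'.memLp_normalLaw, hε'.memLp_normalLaw, ?_, ?_⟩
  · exact (IdentDistrib.mk hZ.aemeasurable (hV.measurable_Z 0).aemeasurable hZ.map_eq).memLp_iff.2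
      hV.memLp_Z
  · exact (IdentDistrib.mk hζ.aemeasurable (hV.measurable_ζ 0).aemeasurable hζ.map_eq).memLp_iff.2
      hV.memLp_ζ
  · exact (IdentDistrib.mk hε.aemeasurable (hV.measurable_ε 0).aemeasurable hε.map_eq).memLp_iff.2
      hV.memLp_ε

theorem memLp_X (hV : V.Follows μ φ θ₁ θ₂) (hadm : θ₁.Admissible) (i : ℕ) :
    MemLp (V.X i) 2 μ := by
  obtain ⟨hZ, hζ', hε', -, -⟩ := hV.memLp_components i
  have hα : MemLp (fun _ : S => (1 - θ₁.B)⁻¹ *ᵥ θ₁.α) 2 μ := memLp_const _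
  have hν : MemLp (fun _ : S => θ₁.ν) 2 μ := memLp_const _
  have h1 := (hα.add ((hZ.mulVec θ₁.Γ).mulVec (1 - θ₁.B)⁻¹)).add (hζ'.mulVec (1 - θ₁.B)⁻¹)
  have hξ : MemLp (V.ξ i) 2 μ := by
    convert h1 using 1
    funext ω
    rw [hV.ξ_eq hadm, Stage1Param.meanXi, Matrix.mulVec_add]
    rfl
  have h2 := ((hν.add (hξ.mulVec θ₁.Λ)).add (hZ.mulVec θ₁.K)).add hε'
  convert h2 using 1
  exact funext (hV.indicator i)

theorem memLp_Y (hV : V.Follows μ φ θ₁ θ₂) (hadm : θ₁.Admissible) (i : ℕ)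
    (hφξ : MemLp (fun ω => φ (V.ξ i ω)) 2 μ) : MemLp (V.Y i) 2 μ := by
  obtain ⟨hZ, -, -, hζ, hε⟩ := hV.memLp_components i
  have hα : MemLp (fun _ : S => θ₂.α) 2 μ := memLp_const _
  have hν : MemLp (fun _ : S => θ₂.ν) 2 μ := memLp_const _
  have h1 := ((hα.add (hφξ.mulVec θ₂.B)).add (hZ.mulVec θ₂.Γ)).add hζ
  have hη : MemLp (V.η i) 2 μ := by
    convert h1 using 1
    exact funext (hV.latent_outcome i)
  have h2 := (((hν.add (hη.mulVec θ₂.Λ)).add (hZ.mulVec θ₂.K)).add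
    ((hV.memLp_X hadm i).mulVec θ₂.L)).add hε
  convert h2 using 1
  exact funext (hV.outcome i)

theorem memLp_predict (hV : V.Follows μ φ θ₁ θ₂) (hadm : θ₁.Admissible) (hφ : Measurable φ) (i : ℕ)
    (hφξ : MemLp (fun ω => φ (V.ξ i ω)) 2 μ) :
    MemLp (fun ω => θ₁.predict φ (V.X i ω) (V.Z i ω)) 2 μ := by
  have h1 := hV.condPhi_ae_eq hadm hφ i fun c => (hφξ.eval c).integrable one_le_two
  exact (memLp_congr_ae h1).1 (memLp_condPhi hφξ)

theorem predError_ae_eq (hV : V.Follows μ φ θ₁ θ₂) (hadm : θ₁.Admissible) (hφ : Measurable φ)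
    (i : ℕ) (hφξ : MemLp (fun ω => φ (V.ξ i ω)) 2 μ) :
    V.predError μ φ i =ᵐ[μ] fun ω => φ (V.ξ i ω) - θ₁.predict φ (V.X i ω) (V.Z i ω) := by
  filter_upwards [hV.condPhi_ae_eq hadm hφ i fun c => (hφξ.eval c).integrable one_le_two]
    with ω hω
  rw [predError, hω]

/-- A function of `(X, Z)` can be pulled out of the conditional expectation. This is what allows `X`
as an extra covariate. -/
theorem integral_predError_mul (hV : V.Follows μ φ θ₁ θ₂) (hadm : θ₁.Admissible)
    (i : ℕ) (hφξ : MemLp (fun ω => φ (V.ξ i ω)) 2 μ)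
    {g : (Fin h → ℝ) × (Fin r → ℝ) → ℝ} (hg : Measurable g)
    (hg2 : MemLp (fun ω => g (V.X i ω, V.Z i ω)) 2 μ) (c : Fin l) :
    ∫ ω, V.predError μ φ i ω c * g (V.X i ω, V.Z i ω) ∂μ = 0 := by
  have hle : MeasurableSpace.comap (fun ω => (V.X i ω, V.Z i ω)) inferInstance ≤ ‹_› :=
    (hV.measurable_X_Z hadm i).comap_le
  have hgm : StronglyMeasurable[MeasurableSpace.comap (fun ω => (V.X i ω, V.Z i ω)) inferInstance]
      fun ω => g (V.X i ω, V.Z i ω) :=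
    (hg.comp (comap_measurable fun ω => (V.X i ω, V.Z i ω))).stronglyMeasurable
  have hf := hφξ.eval c
  have hfg : Integrable (fun ω => φ (V.ξ i ω) c * g (V.X i ω, V.Z i ω)) μ := hf.integrable_mul hg2
  have hcg : Integrable (fun ω => V.condPhi μ φ i ω c * g (V.X i ω, V.Z i ω)) μ :=
    ((memLp_condPhi hφξ).eval c).integrable_mul hg2
  have h1 := condExp_mul_of_stronglyMeasurable_right hgm hfg (hf.integrable one_le_two)
  have h2 : ∫ ω, V.condPhi μ φ i ω c * g (V.X i ω, V.Z i ω) ∂μ =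
      ∫ ω, φ (V.ξ i ω) c * g (V.X i ω, V.Z i ω) ∂μ := by
    rw [← integral_condExp (μ := μ) hle (f := fun ω => φ (V.ξ i ω) c * g (V.X i ω, V.Z i ω))]
    exact (integral_congr_ae h1).symm
  simp only [predError, Pi.sub_apply, sub_mul]
  rw [integral_sub hfg hcg, h2, sub_self]

theorem integral_predError (hV : V.Follows μ φ θ₁ θ₂) (hadm : θ₁.Admissible)
    (i : ℕ) (hφξ : MemLp (fun ω => φ (V.ξ i ω)) 2 μ) (c : Fin l) :
    ∫ ω, V.predError μ φ i ω c ∂μ = 0 := by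
  simpa using hV.integral_predError_mul hadm i hφξ (g := fun _ => 1) measurable_const
    (memLp_const _) c

theorem covariance_predError_X (hV : V.Follows μ φ θ₁ θ₂) (hadm : θ₁.Admissible)
    (i : ℕ) (hφξ : MemLp (fun ω => φ (V.ξ i ω)) 2 μ) (c : Fin l) (j : Fin h) :
    cov[fun ω => V.predError μ φ i ω c, fun ω => V.X i ω j; μ] = 0 := by
  have hX := (hV.memLp_X hadm i).eval j
  rw [covariance_eq_sub ((memLp_predError hφξ).eval c) hX, hV.integral_predError hadm i hφξ,
    zero_mul, sub_zero]
  exact hV.integral_predError_mul hadm i hφξ (g := fun w => w.1 j) (by fun_prop) hX c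

theorem secondMoment_predError (hV : V.Follows μ φ θ₁ θ₂) (hadm : θ₁.Admissible)
    (hφξ : MemLp (fun ω => φ (V.ξ 0 ω)) 2 μ) :
    secondMoment μ (V.predError μ φ 0) (V.predError μ φ 0) = V.covPredError μ φ := by
  ext c d
  have hm := memLp_predError (V := V) hφξ
  rw [covPredError, Matrix.of_apply, covariance_eq_sub (hm.eval c) (hm.eval d),
    hV.integral_predError hadm 0 hφξ, zero_mul, sub_zero]
  rfl

end Follows
end SEMVariables

/-! ### Consistency of stage one -/

theorem ae_eq_zero_of_secondMoment_eq_zero {S ι : Type*} {mS : MeasurableSpace S} {μ : Measure S}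
    [Fintype ι] {U : S → ι → ℝ} (hU : MemLp U 2 μ) (h : secondMoment μ U U = 0) :
    ∀ᵐ ω ∂μ, U ω = 0 := by
  have hall : ∀ a, ∀ᵐ ω ∂μ, U ω a = 0 := fun a => by
    have h1 : ∫ ω, U ω a * U ω a ∂μ = 0 := congrFun (congrFun h a) a
    rw [integral_eq_zero_iff_of_nonneg (fun ω => mul_self_nonneg _)
      (hU.integrable_mul_eval hU a a)] at h1
    filter_upwards [h1] with ω hω using mul_self_eq_zero.1 hω
  filter_upwards [ae_all_iff.2 hall] with ω hω using funext hω

theorem MeasureTheory.MemLp.sumElim {S ι κ : Type*} {mS : MeasurableSpace S} {μ : Measure S}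
    [Fintype ι] [Fintype κ] {U : S → ι → ℝ} {W : S → κ → ℝ} (hU : MemLp U 2 μ)
    (hW : MemLp W 2 μ) : MemLp (fun ω => Sum.elim (U ω) (W ω)) 2 μ :=
  MemLp.of_eval fun a => a.casesOn hU.eval hW.eval

theorem Measurable.sumElim_pi {S ι κ : Type*} {mS : MeasurableSpace S}
    {U : S → ι → ℝ} {W : S → κ → ℝ} (hU : Measurable U)
    (hW : Measurable W) : Measurable fun ω => Sum.elim (U ω) (W ω) :=
  measurable_pi_iff.2 fun a => a.casesOn (measurable_pi_iff.1 hU) (measurable_pi_iff.1 hW)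

namespace SEMVariables.Follows

variable {S : Type*} [MeasurableSpace S] {r q h l p m : ℕ} {V : SEMVariables S r q h p m}
  {μ : Measure S} {φ : (Fin q → ℝ) → Fin l → ℝ}
  {θ₁ : Stage1Param r q h} {θ₂ : Stage2Param r h l p m}

theorem ae_tendsto_empMoment {ι : Type*} [Finite ι] (hV : V.Follows μ φ θ₁ θ₂)
    (hadm : θ₁.Admissible) (hφ : Measurable φ)
    {g : (Fin m → ℝ) × (Fin r → ℝ) × (Fin h → ℝ) × (Fin q → ℝ) → ι → ℝ} (hg : Measurable g)
    (hint : ∀ a b, Integrable (fun ω => g (V.obs 0 ω) a * g (V.obs 0 ω) b) μ) :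
    ∀ᵐ ω ∂μ, Tendsto (empMoment fun i => g (V.obs i ω)) atTop
      (𝓝 (secondMoment μ (fun ω => g (V.obs 0 ω)) (fun ω => g (V.obs 0 ω)))) := by
  have hall : ∀ a b, ∀ᵐ ω ∂μ, Tendsto (fun n => empMoment (fun i => g (V.obs i ω)) n a b) atTop
      (𝓝 (secondMoment μ (fun ω => g (V.obs 0 ω)) (fun ω => g (V.obs 0 ω)) a b)) := fun a b =>
    hV.ae_tendsto_average hadm hφ (g := fun t => g t a * g t b)
      (((measurable_pi_apply a).comp hg).mul ((measurable_pi_apply b).comp hg)) (hint a b)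
  filter_upwards [ae_all_iff.2 fun a => ae_all_iff.2 (hall a)] with ω hω
  exact tendsto_pi_nhds.2 fun a => tendsto_pi_nhds.2 fun b => hω a b

variable [IsProbabilityMeasure μ]

theorem memLp_dataVec1 (hV : V.Follows μ φ θ₁ θ₂) (hadm : θ₁.Admissible) :
    MemLp (fun ω => Stage1Param.dataVec (V.X 0 ω) (V.Z 0 ω)) 2 μ :=
  (hV.memLp_X hadm 0).sumElim ((memLp_const (fun _ => 1)).sumElim hV.memLp_Z)

theorem design_mul_moment_mul (hV : V.Follows μ φ θ₁ θ₂) (hadm : θ₁.Admissible) :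
    θ₁.design * secondMoment μ (fun ω => Stage1Param.dataVec (V.X 0 ω) (V.Z 0 ω))
      (fun ω => Stage1Param.dataVec (V.X 0 ω) (V.Z 0 ω)) * θ₁.designᵀ = θ₁.covX := by
  have hv := hV.memLp_dataVec1 hadm
  rw [← secondMoment_mulVec hv hv]
  simp only [Stage1Param.design_mulVec]
  exact hV.secondMoment_X_sub_meanX hadm 0

theorem design_sub_mulVec (θ : Stage1Param r q h) (x : Fin h → ℝ) (z : Fin r → ℝ) :
    (θ.design - θ₁.design) *ᵥ Stage1Param.dataVec x z = θ₁.meanX z - θ.meanX z := by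
  rw [Matrix.sub_mulVec, Stage1Param.design_mulVec, Stage1Param.design_mulVec]
  abel

/-- The normal equations: `X - E[X | Z]` is centred and independent of `Z`, while a change of
parameter alters the modelled mean by a function of `Z`. -/
theorem design_mul_moment_mul_sub (hV : V.Follows μ φ θ₁ θ₂) (hadm : θ₁.Admissible)
    (θ : Stage1Param r q h) :
    θ₁.design * secondMoment μ (fun ω => Stage1Param.dataVec (V.X 0 ω) (V.Z 0 ω))
      (fun ω => Stage1Param.dataVec (V.X 0 ω) (V.Z 0 ω)) * (θ.design - θ₁.design)ᵀ = 0 := by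
  have hv := hV.memLp_dataVec1 hadm
  rw [← secondMoment_mulVec hv hv]
  simp only [Stage1Param.design_mulVec, design_sub_mulVec]
  have hm : Measurable fun z => θ₁.meanX z - θ.meanX z :=
    θ₁.continuous_meanX.measurable.sub θ.continuous_meanX.measurable
  refine secondMoment_eq_zero_of_indepFun (hV.measurable_X_sub_meanX hadm 0).aestronglyMeasurable
    (hm.comp (hV.measurable_Z 0)).aestronglyMeasurable ?_ (hV.integral_X_sub_meanX hadm 0)
  exact ((hV.indep_Z_residual hadm 0).symm.comp measurable_fst hm)

theorem meanX_ae_eq (hV : V.Follows μ φ θ₁ θ₂) (hadm : θ₁.Admissible) (θ : Stage1Param r q h)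
    (h : (θ.design - θ₁.design) *
      secondMoment μ (fun ω => Stage1Param.dataVec (V.X 0 ω) (V.Z 0 ω))
      (fun ω => Stage1Param.dataVec (V.X 0 ω) (V.Z 0 ω)) * (θ.design - θ₁.design)ᵀ = 0) :
    ∀ᵐ ω ∂μ, θ.meanX (V.Z 0 ω) = θ₁.meanX (V.Z 0 ω) := by
  have hv := hV.memLp_dataVec1 hadm
  rw [← secondMoment_mulVec hv hv] at h
  filter_upwards [ae_eq_zero_of_secondMoment_eq_zero (hv.mulVec _) h] with ω hω
  rw [design_sub_mulVec] at hω
  exact (sub_eq_zero.1 hω).symm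

/-- Consistency of the stage-one estimator. -/
theorem tendsto_stage1 (hV : V.Follows μ φ θ₁ θ₂) (hφ : Measurable φ) {Θ₁ : Set (Stage1Param r q h)}
    (hΘ₁ : IsCompact Θ₁) (hadm₁ : ∀ θ ∈ Θ₁, θ.Admissible) (hθ₁ : θ₁ ∈ Θ₁)
    (hid₁ : Stage1Identified V μ Θ₁ θ₁) {T₁ : ℕ → S → Stage1Param r q h}
    (hT : ∀ᵐ ω ∂μ, ∀ᶠ n in atTop, T₁ n ω ∈ Θ₁ ∧ IsMaxOn (V.logLik1 n ω) Θ₁ (T₁ n ω)) :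
    ∀ᵐ ω ∂μ, Tendsto (fun n => T₁ n ω) atTop (𝓝 θ₁) := by
  have hadm := hadm₁ θ₁ hθ₁
  have hv := hV.memLp_dataVec1 hadm
  have hlim := hV.ae_tendsto_empMoment hadm hφ
    (g := fun t => Stage1Param.dataVec t.2.2.1 t.2.1)
    (measurable_snd.snd.fst.sumElim_pi (measurable_const.sumElim_pi measurable_snd.fst))
    fun a b => hv.integrable_mul_eval hv a b
  filter_upwards [hlim, hT] with ω hω hTω
  refine tendsto_of_normalContrast_le hΘ₁ (S := fun θ => θ.covX) (C := fun θ => θ.design)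
    (fun θ hθ => Stage1Param.continuousAt_covX (hadm₁ θ hθ))
    (fun θ hθ => Stage1Param.continuousAt_design (hadm₁ θ hθ))
    (fun θ hθ => (hadm₁ θ hθ).covX_posDef) hadm.covX_posDef hω (secondMoment_posSemidef hv)
    (hV.design_mul_moment_mul hadm) (fun θ _ => hV.design_mul_moment_mul_sub hadm θ)
    (hTω.mono fun n hn => hn.1) ?_
    fun θ hθ hcov hD => hid₁ θ hθ hcov (hV.meanX_ae_eq hadm θ hD)
  filter_upwards [hTω, eventually_ne_atTop 0] with n hn hn0
  refine normalContrast_le_of_sum_le (hadm₁ _ hn.1).covX_posDef.det_pos hadm.covX_posDef.det_pos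
    _ _ (fun i => Stage1Param.dataVec (V.X i ω) (V.Z i ω)) hn0 ?_
  simp only [Stage1Param.design_mulVec]
  exact hn.2 hθ₁

end SEMVariables.Follows

/-! ### Orthogonality and consistency in stage two -/

theorem MeasureTheory.MemLp.fun_add {S ι : Type*} {mS : MeasurableSpace S} {μ : Measure S}
    [Fintype ι] {U W : S → ι → ℝ} (hU : MemLp U 2 μ) (hW : MemLp W 2 μ) :
    MemLp (fun ω => U ω + W ω) 2 μ :=
  hU.add hW

namespace SEMVariables.Follows

variable {S : Type*} [MeasurableSpace S] {r q h l p m : ℕ} {V : SEMVariables S r q h p m}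
  {μ : Measure S} {φ : (Fin q → ℝ) → Fin l → ℝ}
  {θ₁ : Stage1Param r q h} {θ₂ : Stage2Param r h l p m}

variable [IsProbabilityMeasure μ]

theorem indep_X_Z_ξ (hV : V.Follows μ φ θ₁ θ₂) (hadm : θ₁.Admissible) (i : ℕ) :
    (fun ω => (V.X i ω, V.Z i ω, V.ξ i ω)) ⟂ᵢ[μ] (fun ω => (V.ζ i ω, V.ε i ω)) := by
  let fξ : (Fin r → ℝ) × (Fin q → ℝ) × (Fin h → ℝ) → Fin q → ℝ :=
    fun t => (1 - θ₁.B)⁻¹ *ᵥ (θ₁.α + θ₁.Γ *ᵥ t.1) + (1 - θ₁.B)⁻¹ *ᵥ t.2.1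
  let fX : (Fin r → ℝ) × (Fin q → ℝ) × (Fin h → ℝ) → Fin h → ℝ :=
    fun t => θ₁.ν + θ₁.Λ *ᵥ fξ t + θ₁.K *ᵥ t.1 + t.2.2
  have mξ : Measurable fξ := Measurable.add
    (Measurable.matrix_mulVec _ ((measurable_fst.matrix_mulVec _).const_add _))
    (measurable_snd.fst.matrix_mulVec _)
  have mX : Measurable fX := (((mξ.matrix_mulVec _).const_add _).add
    (measurable_fst.matrix_mulVec _)).add measurable_snd.snd
  have heq : (fun ω => (V.X i ω, V.Z i ω, V.ξ i ω)) =
      (fun t => (fX t, t.1, fξ t)) ∘ fun ω => (V.Z i ω, V.ζ' i ω, V.ε' i ω) := by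
    funext ω
    rw [hV.indicator i ω, hV.ξ_eq hadm i ω]
    rfl
  rw [heq]
  exact (hV.indep_stage2 i).comp (mX.prodMk (measurable_fst.prodMk mξ)) measurable_id

theorem secondMoment_comp_error (hV : V.Follows μ φ θ₁ θ₂) (hadm : θ₁.Admissible) {k : ℕ}
    {g : (Fin h → ℝ) × (Fin r → ℝ) × (Fin q → ℝ) → Fin k → ℝ} (hg : Measurable g) :
    secondMoment μ (V.ζ 0) (fun ω => g (V.X 0 ω, V.Z 0 ω, V.ξ 0 ω)) = 0 ∧
      secondMoment μ (V.ε 0) (fun ω => g (V.X 0 ω, V.Z 0 ω, V.ξ 0 ω)) = 0 := by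
  have hind := (hV.indep_X_Z_ξ hadm 0).symm
  have hm : Measurable fun ω => g (V.X 0 ω, V.Z 0 ω, V.ξ 0 ω) := hg.comp
    ((hV.measurable_X hadm 0).prodMk ((hV.measurable_Z 0).prodMk (hV.measurable_ξ hadm 0)))
  exact ⟨secondMoment_eq_zero_of_indepFun (hV.measurable_ζ 0).aestronglyMeasurable
      hm.aestronglyMeasurable (hind.comp measurable_fst hg) hV.mean_ζ,
    secondMoment_eq_zero_of_indepFun (hV.measurable_ε 0).aestronglyMeasurable
      hm.aestronglyMeasurable (hind.comp measurable_snd hg) hV.mean_ε⟩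

theorem secondMoment_error (hV : V.Follows μ φ θ₁ θ₂) :
    secondMoment μ (fun ω => θ₂.Λ *ᵥ V.ζ 0 ω + (1 : Matrix (Fin m) (Fin m) ℝ) *ᵥ V.ε 0 ω)
      (fun ω => θ₂.Λ *ᵥ V.ζ 0 ω + (1 : Matrix (Fin m) (Fin m) ℝ) *ᵥ V.ε 0 ω) = θ₂.covY := by
  obtain ⟨-, -, -, -, hind⟩ := hV.indep_components 0
  have mζ := hV.memLp_ζ
  have mε := hV.memLp_ε
  have h0 : secondMoment μ (V.ζ 0) (V.ε 0) = 0 :=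
    secondMoment_eq_zero_of_indepFun mζ.1 mε.1 hind hV.mean_ζ
  have h0' : secondMoment μ (V.ε 0) (V.ζ 0) = 0 := by
    rw [← transpose_secondMoment, h0, Matrix.transpose_zero]
  have hΨ : secondMoment μ (V.ζ 0) (V.ζ 0) = θ₂.Ψ := by ext a b; exact hV.cov_ζ a b
  have hΩ : secondMoment μ (V.ε 0) (V.ε 0) = θ₂.Ω := by ext a b; exact hV.cov_ε a b
  rw [secondMoment_add_left (mζ.mulVec _) (mε.mulVec _) ((mζ.mulVec _).fun_add (mε.mulVec _)),
    secondMoment_add_right (mζ.mulVec _) (mζ.mulVec _) (mε.mulVec _),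
    secondMoment_add_right (mε.mulVec _) (mζ.mulVec _) (mε.mulVec _),
    secondMoment_mulVec mζ mζ, secondMoment_mulVec mζ mε, secondMoment_mulVec mε mζ,
    secondMoment_mulVec mε mε, h0, h0', hΨ, hΩ, Stage2Param.covY]
  simp

theorem secondMoment_error_comp (hV : V.Follows μ φ θ₁ θ₂) (hadm : θ₁.Admissible) {k : ℕ}
    {g : (Fin h → ℝ) × (Fin r → ℝ) × (Fin q → ℝ) → Fin k → ℝ} (hg : Measurable g)
    (hg2 : MemLp (fun ω => g (V.X 0 ω, V.Z 0 ω, V.ξ 0 ω)) 2 μ) :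
    secondMoment μ (fun ω => θ₂.Λ *ᵥ V.ζ 0 ω + (1 : Matrix (Fin m) (Fin m) ℝ) *ᵥ V.ε 0 ω)
      (fun ω => g (V.X 0 ω, V.Z 0 ω, V.ξ 0 ω)) = 0 := by
  obtain ⟨h1, h2⟩ := hV.secondMoment_comp_error hadm hg
  have e1 := secondMoment_mulVec hV.memLp_ζ hg2 θ₂.Λ (1 : Matrix (Fin k) (Fin k) ℝ)
  have e2 := secondMoment_mulVec hV.memLp_ε hg2 (1 : Matrix (Fin m) (Fin m) ℝ)
    (1 : Matrix (Fin k) (Fin k) ℝ)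
  rw [h1, Matrix.mul_zero, Matrix.zero_mul] at e1
  rw [h2, Matrix.mul_zero, Matrix.zero_mul] at e2
  rw [secondMoment_add_left (hV.memLp_ζ.mulVec _) (hV.memLp_ε.mulVec _) hg2]
  simp only [Matrix.one_mulVec] at e1 e2 ⊢
  rw [e1, e2, add_zero]

theorem secondMoment_predError_comp (hV : V.Follows μ φ θ₁ θ₂) (hadm : θ₁.Admissible)
    (hφξ : MemLp (fun ω => φ (V.ξ 0 ω)) 2 μ) {k : ℕ}
    {g : (Fin h → ℝ) × (Fin r → ℝ) → Fin k → ℝ} (hg : Measurable g)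
    (hg2 : MemLp (fun ω => g (V.X 0 ω, V.Z 0 ω)) 2 μ) :
    secondMoment μ (V.predError μ φ 0) (fun ω => g (V.X 0 ω, V.Z 0 ω)) = 0 := by
  ext c d
  exact hV.integral_predError_mul hadm 0 hφξ ((measurable_pi_apply d).comp hg) (hg2.eval d) c

theorem residual2_ae_eq (hV : V.Follows μ φ θ₁ θ₂) (hadm : θ₁.Admissible) (hφ : Measurable φ)
    (hφξ : MemLp (fun ω => φ (V.ξ 0 ω)) 2 μ) :
    (fun ω => V.Y 0 ω - (V.limitParam μ φ θ₂).meanY (V.Z 0 ω) (V.X 0 ω)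
      (θ₁.predict φ (V.X 0 ω) (V.Z 0 ω))) =ᵐ[μ] fun ω =>
      (θ₂.Λ * θ₂.B) *ᵥ V.predError μ φ 0 ω +
        (θ₂.Λ *ᵥ V.ζ 0 ω + (1 : Matrix (Fin m) (Fin m) ℝ) *ᵥ V.ε 0 ω) := by
  filter_upwards [hV.condPhi_ae_eq hadm hφ 0 fun c => (hφξ.eval c).integrable one_le_two]
    with ω hω
  rw [← hω, hV.Y_sub_meanY, Matrix.one_mulVec]

/-- Replacing the conditional expectation by the explicit prediction makes the prediction error a
measurable function of `(X, Z, ξ)`, of which `ζ` and `ε` are independent. -/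
theorem secondMoment_error_predError (hV : V.Follows μ φ θ₁ θ₂) (hadm : θ₁.Admissible)
    (hφ : Measurable φ) (hφξ : MemLp (fun ω => φ (V.ξ 0 ω)) 2 μ) {k : ℕ}
    (F : Matrix (Fin k) (Fin l) ℝ) :
    secondMoment μ (fun ω => θ₂.Λ *ᵥ V.ζ 0 ω + (1 : Matrix (Fin m) (Fin m) ℝ) *ᵥ V.ε 0 ω)
      (fun ω => F *ᵥ V.predError μ φ 0 ω) = 0 := by
  have hp := Stage1Param.measurable_predict hφ θ₁
  have hg : Measurable fun t : (Fin h → ℝ) × (Fin r → ℝ) × (Fin q → ℝ) => (t.1, t.2.1) :=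
    measurable_fst.prodMk measurable_snd.fst
  have hp' := hp.comp hg
  have hφ' : Measurable fun t : (Fin h → ℝ) × (Fin r → ℝ) × (Fin q → ℝ) => φ t.2.2 :=
    hφ.comp measurable_snd.snd
  have hm : Measurable fun t : (Fin h → ℝ) × (Fin r → ℝ) × (Fin q → ℝ) =>
      F *ᵥ (φ t.2.2 - θ₁.predict φ t.1 t.2.1) := (hφ'.sub hp').matrix_mulVec F
  have hδeq : (fun ω => F *ᵥ V.predError μ φ 0 ω) =ᵐ[μ] fun ω =>
      F *ᵥ (φ (V.ξ 0 ω) - θ₁.predict φ (V.X 0 ω) (V.Z 0 ω)) := by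
    filter_upwards [hV.predError_ae_eq hadm hφ 0 hφξ] with ω hω
    rw [hω]
  have hδ : MemLp (V.predError μ φ 0) 2 μ := memLp_predError hφξ
  have h2 := (memLp_congr_ae hδeq).1 (hδ.mulVec F)
  rw [secondMoment_congr (ae_eq_refl _) hδeq]
  exact hV.secondMoment_error_comp hadm
    (g := fun t => F *ᵥ (φ t.2.2 - θ₁.predict φ t.1 t.2.1)) hm h2

/-- The source of the bias. Prediction error and model errors are orthogonal, so covariances add,
and the extra term `Λ (B Var(δ) Bᵀ) Λᵀ` has exactly the form that a change of `Ψ` produces. -/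
theorem secondMoment_residual2 (hV : V.Follows μ φ θ₁ θ₂) (hadm : θ₁.Admissible)
    (hφ : Measurable φ) (hφξ : MemLp (fun ω => φ (V.ξ 0 ω)) 2 μ) :
    secondMoment μ (fun ω => V.Y 0 ω - (V.limitParam μ φ θ₂).meanY (V.Z 0 ω) (V.X 0 ω)
      (θ₁.predict φ (V.X 0 ω) (V.Z 0 ω)))
      (fun ω => V.Y 0 ω - (V.limitParam μ φ θ₂).meanY (V.Z 0 ω) (V.X 0 ω)
      (θ₁.predict φ (V.X 0 ω) (V.Z 0 ω))) = (V.limitParam μ φ θ₂).covY := by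
  have hae := hV.residual2_ae_eq hadm hφ hφξ
  rw [secondMoment_congr hae hae]
  have hδ : MemLp (V.predError μ φ 0) 2 μ := memLp_predError hφξ
  have hu : MemLp (fun ω => θ₂.Λ *ᵥ V.ζ 0 ω + (1 : Matrix (Fin m) (Fin m) ℝ) *ᵥ V.ε 0 ω) 2 μ :=
    (hV.memLp_ζ.mulVec _).fun_add (hV.memLp_ε.mulVec _)
  have hcross := hV.secondMoment_error_predError hadm hφ hφξ (θ₂.Λ * θ₂.B)
  have hcross' : secondMoment μ (fun ω => (θ₂.Λ * θ₂.B) *ᵥ V.predError μ φ 0 ω)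
      (fun ω => θ₂.Λ *ᵥ V.ζ 0 ω + (1 : Matrix (Fin m) (Fin m) ℝ) *ᵥ V.ε 0 ω) = 0 := by
    rw [← transpose_secondMoment, hcross, Matrix.transpose_zero]
  rw [secondMoment_add_left (hδ.mulVec _) hu ((hδ.mulVec _).fun_add hu),
    secondMoment_add_right (hδ.mulVec _) (hδ.mulVec _) hu,
    secondMoment_add_right hu (hδ.mulVec _) hu, hcross, hcross', hV.secondMoment_error,
    secondMoment_mulVec hδ hδ, hV.secondMoment_predError hadm hφξ]
  simp only [Stage2Param.covY, Matrix.transpose_mul, Matrix.mul_add, Matrix.add_mul,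
    Matrix.mul_assoc, add_zero, zero_add]
  abel

/-- The normal equations of stage two: the prediction error is orthogonal to functions of `(X, Z)`
by conditioning, the model errors by independence. -/
theorem secondMoment_residual2_comp (hV : V.Follows μ φ θ₁ θ₂) (hadm : θ₁.Admissible)
    (hφ : Measurable φ) (hφξ : MemLp (fun ω => φ (V.ξ 0 ω)) 2 μ) {k : ℕ}
    {g : (Fin h → ℝ) × (Fin r → ℝ) → Fin k → ℝ} (hg : Measurable g)
    (hg2 : MemLp (fun ω => g (V.X 0 ω, V.Z 0 ω)) 2 μ) :
    secondMoment μ (fun ω => V.Y 0 ω - (V.limitParam μ φ θ₂).meanY (V.Z 0 ω) (V.X 0 ω)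
      (θ₁.predict φ (V.X 0 ω) (V.Z 0 ω))) (fun ω => g (V.X 0 ω, V.Z 0 ω)) = 0 := by
  rw [secondMoment_congr (hV.residual2_ae_eq hadm hφ hφξ) (ae_eq_refl _)]
  have hδ : MemLp (V.predError μ φ 0) 2 μ := memLp_predError hφξ
  have hu : MemLp (fun ω => θ₂.Λ *ᵥ V.ζ 0 ω + (1 : Matrix (Fin m) (Fin m) ℝ) *ᵥ V.ε 0 ω) 2 μ :=
    (hV.memLp_ζ.mulVec _).fun_add (hV.memLp_ε.mulVec _)
  have e1 := secondMoment_mulVec hδ hg2 (θ₂.Λ * θ₂.B) (1 : Matrix (Fin k) (Fin k) ℝ)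
  rw [hV.secondMoment_predError_comp hadm hφξ hg hg2, Matrix.mul_zero, Matrix.zero_mul] at e1
  simp only [Matrix.one_mulVec] at e1
  rw [secondMoment_add_left (hδ.mulVec _) hu hg2, e1, zero_add]
  exact hV.secondMoment_error_comp hadm (g := fun t => g (t.1, t.2.1))
    (hg.comp (measurable_fst.prodMk measurable_snd.fst)) hg2

theorem covPredError_posSemidef (hV : V.Follows μ φ θ₁ θ₂) (hadm : θ₁.Admissible)
    (hφξ : MemLp (fun ω => φ (V.ξ 0 ω)) 2 μ) : (V.covPredError μ φ).PosSemidef := by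
  rw [← hV.secondMoment_predError hadm hφξ]
  exact secondMoment_posSemidef (memLp_predError hφξ)

/-- The limit must itself compete in the likelihood; this is why `Ψ` has to be unrestricted. Adding
a positive semidefinite term preserves admissibility. -/
theorem limitParam_mem (hV : V.Follows μ φ θ₁ θ₂) (hadm : θ₁.Admissible)
    (hφξ : MemLp (fun ω => φ (V.ξ 0 ω)) 2 μ) {Θ₂ : Set (Stage2Param r h l p m)}
    (hΘ₂ : Stage2Param.IsParameterSpace Θ₂) (hθ₂ : θ₂ ∈ Θ₂) : V.limitParam μ φ θ₂ ∈ Θ₂ := by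
  have h2 := hΘ₂.admissible θ₂ hθ₂
  have hps := (hV.covPredError_posSemidef hadm hφξ).mul_mul_transpose_same θ₂.B
  have hΨ := h2.psi_posSemidef.add hps
  refine hΘ₂.psi_unrestricted θ₂ hθ₂ _ hΨ ⟨hΨ, h2.omega_posSemidef, ?_⟩
  have := h2.covY_posDef.add_posSemidef (hps.mul_mul_transpose_same θ₂.Λ)
  convert this using 1
  simp only [Stage2Param.covY, Matrix.mul_add, Matrix.add_mul]
  abel

theorem memLp_dataVec2 (hV : V.Follows μ φ θ₁ θ₂) (hadm : θ₁.Admissible) (hφ : Measurable φ)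
    (hφξ : MemLp (fun ω => φ (V.ξ 0 ω)) 2 μ) :
    MemLp (fun ω => Stage2Param.dataVec (V.Y 0 ω) (V.Z 0 ω) (V.X 0 ω)
      (θ₁.predict φ (V.X 0 ω) (V.Z 0 ω))) 2 μ :=
  (hV.memLp_Y hadm 0 hφξ).sumElim ((memLp_const (fun _ => 1)).sumElim (hV.memLp_Z.sumElim
    ((hV.memLp_X hadm 0).sumElim (hV.memLp_predict hadm hφ 0 hφξ))))

theorem design2_sub_mulVec (θ θ' : Stage2Param r h l p m) (y : Fin m → ℝ) (z : Fin r → ℝ)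
    (x : Fin h → ℝ) (f : Fin l → ℝ) :
    (θ.design - θ'.design) *ᵥ Stage2Param.dataVec y z x f = θ'.meanY z x f - θ.meanY z x f := by
  rw [Matrix.sub_mulVec, Stage2Param.design_mulVec, Stage2Param.design_mulVec]
  abel

theorem measurable_meanY_predict (hφ : Measurable φ) (θ : Stage2Param r h l p m) :
    Measurable fun w : (Fin h → ℝ) × (Fin r → ℝ) =>
      θ.meanY w.2 w.1 (θ₁.predict φ w.1 w.2) := by
  have h1 := Stage1Param.measurable_predict hφ θ₁
  have h2 : Measurable fun w : (Fin h → ℝ) × (Fin r → ℝ) =>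
      θ.α + θ.B *ᵥ θ₁.predict φ w.1 w.2 + θ.Γ *ᵥ w.2 :=
    ((h1.matrix_mulVec _).const_add _).add (measurable_snd.matrix_mulVec _)
  exact (((h2.matrix_mulVec _).const_add _).add (measurable_snd.matrix_mulVec _)).add
    (measurable_fst.matrix_mulVec _)

/-- Consistency of the stage-two estimator, given that the empirical moments converge. -/
theorem tendsto_stage2 (hV : V.Follows μ φ θ₁ θ₂) (hadm : θ₁.Admissible) (hφ : Measurable φ)
    (hφξ : MemLp (fun ω => φ (V.ξ 0 ω)) 2 μ)
    {Θ₂ : Set (Stage2Param r h l p m)} (hΘ₂ : Stage2Param.IsParameterSpace Θ₂) (hθ₂ : θ₂ ∈ Θ₂)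
    (hid₂ : Stage2Identified V μ φ Θ₂ (V.limitParam μ φ θ₂))
    {T₁ : ℕ → Stage1Param r q h} {T₂ : ℕ → Stage2Param r h l p m} {ω : S}
    (hlim : Tendsto (fun n => empMoment (fun i => Stage2Param.dataVec (V.Y i ω) (V.Z i ω) (V.X i ω)
      ((T₁ n).predict φ (V.X i ω) (V.Z i ω))) n) atTop
      (𝓝 (secondMoment μ (fun ω => Stage2Param.dataVec (V.Y 0 ω) (V.Z 0 ω) (V.X 0 ω)
        (θ₁.predict φ (V.X 0 ω) (V.Z 0 ω))) (fun ω => Stage2Param.dataVec (V.Y 0 ω) (V.Z 0 ω)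
        (V.X 0 ω) (θ₁.predict φ (V.X 0 ω) (V.Z 0 ω))))))
    (hT : ∀ᶠ n in atTop, T₂ n ∈ Θ₂ ∧ IsMaxOn (V.logLik2 φ (T₁ n) n ω) Θ₂ (T₂ n)) :
    Tendsto T₂ atTop (𝓝 (V.limitParam μ φ θ₂)) := by
  have hmem := hV.limitParam_mem hadm hφξ hΘ₂ hθ₂
  have hv := hV.memLp_dataVec2 hadm hφ hφξ
  have hd : ∀ θ : Stage2Param r h l p m, MemLp (fun ω => (V.limitParam μ φ θ₂).meanY (V.Z 0 ω)
      (V.X 0 ω) (θ₁.predict φ (V.X 0 ω) (V.Z 0 ω)) - θ.meanY (V.Z 0 ω)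
      (V.X 0 ω) (θ₁.predict φ (V.X 0 ω) (V.Z 0 ω))) 2 μ := fun θ => by
    have := hv.mulVec (θ.design - (V.limitParam μ φ θ₂).design)
    simpa only [design2_sub_mulVec] using this
  refine hΘ₂.tendsto_of_normalContrast_le hmem hlim (fun n => transpose_empMoment _ _)
    (secondMoment_posSemidef hv) ?_ (fun θ => ?_) (hT.mono fun n hn => hn.1) ?_
    fun θ hθ hcov hD => ?_
  · rw [← secondMoment_mulVec hv hv]
    simp only [Stage2Param.design_mulVec]
    exact hV.secondMoment_residual2 hadm hφ hφξ
  · rw [← secondMoment_mulVec hv hv]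
    simp only [Stage2Param.design_mulVec, design2_sub_mulVec]
    exact hV.secondMoment_residual2_comp hadm hφ hφξ (g := fun w => (V.limitParam μ φ θ₂).meanY w.2
      w.1 (θ₁.predict φ w.1 w.2) - θ.meanY w.2 w.1 (θ₁.predict φ w.1 w.2))
      ((measurable_meanY_predict hφ _).sub (measurable_meanY_predict hφ _)) (hd θ)
  · filter_upwards [hT, eventually_ne_atTop 0] with n hn hn0
    refine normalContrast_le_of_sum_le (hΘ₂.admissible _ hn.1).covY_posDef.det_pos
      (hΘ₂.admissible _ hmem).covY_posDef.det_pos _ _ _ hn0 ?_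
    simp only [Stage2Param.design_mulVec]
    exact hn.2 hmem
  · refine hid₂ θ hθ hcov ?_
    rw [← secondMoment_mulVec hv hv] at hD
    filter_upwards [ae_eq_zero_of_secondMoment_eq_zero (hv.mulVec _) hD,
      hV.condPhi_ae_eq hadm hφ 0 fun c => (hφξ.eval c).integrable one_le_two] with ω h1 h2
    rw [design2_sub_mulVec] at h1
    rw [h2]
    exact (sub_eq_zero.1 h1).symm

end SEMVariables.Follows

/-! ### Estimated covariates and the uniform law of large numbers -/

/-- Cauchy–Schwarz for the empirical averages. -/
theorem tendsto_average_mul_zero {x y : ℕ → ℕ → ℝ} {c : ℝ}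
    (hx : Tendsto (fun n => (∑ i ∈ Finset.range n, x n i ^ 2) / n) atTop (𝓝 0))
    (hy : Tendsto (fun n => (∑ i ∈ Finset.range n, y n i ^ 2) / n) atTop (𝓝 c)) :
    Tendsto (fun n => (∑ i ∈ Finset.range n, x n i * y n i) / n) atTop (𝓝 0) := by
  have hs : Tendsto (fun n => √((∑ i ∈ Finset.range n, x n i ^ 2) / n *
      ((∑ i ∈ Finset.range n, y n i ^ 2) / n))) atTop (𝓝 0) := by
    simpa using (hx.mul hy).sqrt
  refine squeeze_zero_norm (fun n => ?_) hs
  rw [Real.norm_eq_abs]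
  refine Real.abs_le_sqrt ?_
  have := Finset.sum_mul_sq_le_sq_mul_sq (Finset.range n) (x n) (y n)
  rw [div_pow, div_mul_div_comm, ← sq]
  gcongr

/-- `u_a u_b - v_a v_b` is a sum of three products, each with a factor `u - v` that vanishes in
empirical mean square. -/
theorem tendsto_empMoment_of_tendsto {ι : Type*} [Finite ι] {v : ℕ → ι → ℝ} {u : ℕ → ℕ → ι → ℝ}
    {M : Matrix ι ι ℝ} (hv : Tendsto (empMoment v) atTop (𝓝 M))
    (hu : ∀ a, Tendsto (fun n => (∑ i ∈ Finset.range n, (u n i a - v i a) ^ 2) / n) atTop (𝓝 0)) :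
    Tendsto (fun n => empMoment (u n) n) atTop (𝓝 M) := by
  have hv' : ∀ a b, Tendsto (fun n => empMoment v n a b) atTop (𝓝 (M a b)) := fun a b =>
    tendsto_pi_nhds.1 (tendsto_pi_nhds.1 hv a) b
  have hsq : ∀ a, Tendsto (fun n : ℕ => (∑ i ∈ Finset.range n, v i a ^ 2) / n) atTop
      (𝓝 (M a a)) := fun a => by
    simpa only [empMoment, Matrix.of_apply, sq] using hv' a a
  refine tendsto_pi_nhds.2 fun a => tendsto_pi_nhds.2 fun b => ?_
  have h1 := tendsto_average_mul_zero (hu a) (hsq b)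
  have h2 := tendsto_average_mul_zero (hu b) (hsq a)
  have h3 := tendsto_average_mul_zero (hu a) (hu b)
  have h4 := (((hv' a b).add h1).add h2).add h3
  simp only [add_zero] at h4
  refine h4.congr fun n => ?_
  simp only [empMoment, Matrix.of_apply, ← add_div, ← Finset.sum_add_distrib]
  congr 1
  exact Finset.sum_congr rfl fun i _ => by ring

/-- A uniform law of large numbers along parameters converging to a zero of the summands. -/
theorem ae_tendsto_average_zero_of_dominated {S P β : Type*} {mS : MeasurableSpace S}
    {mβ : MeasurableSpace β} [TopologicalSpace P] [SecondCountableTopology P] {μ : Measure S}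
    {A : Set P} {x₀ : P} (hx₀ : x₀ ∈ A) {ψ : P → β → ℝ} (hψ : ∀ x, Measurable (ψ x))
    (hψ₀ : ∀ x w, 0 ≤ ψ x w) (hψx₀ : ∀ w, ψ x₀ w = 0) {W : ℕ → S → β}
    (hW : ∀ i, IdentDistrib (W i) (W 0) μ μ) {H : β → ℝ}
    (hH : Integrable H (μ.map (W 0)))
    (hgood : ∀ᵐ w ∂(μ.map (W 0)), ContinuousOn (fun x => ψ x w) A ∧ ∀ x ∈ A, ψ x w ≤ H w)
    (hlln : ∀ g : β → ℝ, Measurable g → Integrable (fun ω => g (W 0 ω)) μ →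
      ∀ᵐ ω ∂μ, Tendsto (fun n : ℕ => (∑ i ∈ Finset.range n, g (W i ω)) / n) atTop
        (𝓝 (∫ ω, g (W 0 ω) ∂μ))) :
    ∀ᵐ ω ∂μ, ∀ T : ℕ → P, Tendsto T atTop (𝓝[A] x₀) →
      Tendsto (fun n : ℕ => (∑ i ∈ Finset.range n, ψ (T n) (W i ω)) / n) atTop (𝓝 0) := by
  obtain ⟨B, hB⟩ := (𝓝[A] x₀).exists_antitone_basis
  set C : ℕ → Set P := fun k => A ∩ B k with hC
  have hxB : ∀ k, x₀ ∈ B k := fun k => mem_of_mem_nhdsWithin hx₀ (hB.1.mem_of_mem trivial)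
  have hne : ∀ k, Nonempty (C k) := fun k => ⟨⟨x₀, hx₀, hxB k⟩⟩
  -- Envelope of `ψ` over a shrinking neighbourhood of `x₀` in `A`. The supremum runs over a dense
  -- sequence to keep it measurable; continuity on `A` makes it bound all points of the
  -- neighbourhood for almost every `w`.
  set f : ℕ → β → ℝ := fun k w => ⨆ j, ψ (TopologicalSpace.denseSeq (C k) j) w with hf
  have hfm : ∀ k, Measurable (f k) := fun k => Measurable.iSup fun j => hψ _
  have hbdd : ∀ w, (∀ x ∈ A, ψ x w ≤ H w) → ∀ k,
      BddAbove (Set.range fun j => ψ (TopologicalSpace.denseSeq (C k) j) w) := fun w hw k =>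
    ⟨H w, by
      rintro _ ⟨j, rfl⟩
      exact hw _ (TopologicalSpace.denseSeq (C k) j).2.1⟩
  have hf0 : ∀ k w, 0 ≤ f k w := fun k w => Real.iSup_nonneg fun j => hψ₀ _ _
  have hfH : ∀ w, (∀ x ∈ A, ψ x w ≤ H w) → ∀ k, f k w ≤ H w := fun w hw k =>
    ciSup_le fun j => hw _ (TopologicalSpace.denseSeq (C k) j).2.1
  have hle : ∀ w, ContinuousOn (fun x => ψ x w) A → (∀ x ∈ A, ψ x w ≤ H w) → ∀ k,
      ∀ x ∈ C k, ψ x w ≤ f k w := fun w hc hw k x hx => by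
    have hcl : IsClosed {y : C k | ψ y w ≤ f k w} :=
      isClosed_le (continuousOn_iff_continuous_domRestrict.1 (hc.mono Set.inter_subset_left))
        continuous_const
    have hsub : Set.range (TopologicalSpace.denseSeq (C k)) ⊆ {y : C k | ψ y w ≤ f k w} := by
      rintro _ ⟨j, rfl⟩
      exact le_ciSup (hbdd w hw k) j
    have := hcl.closure_subset_iff.2 hsub
    rw [(TopologicalSpace.denseRange_denseSeq (C k)).closure_range] at this
    exact this (Set.mem_univ (⟨x, hx⟩ : C k))
  have hlim : ∀ w, ContinuousOn (fun x => ψ x w) A → Tendsto (fun k => f k w) atTop (𝓝 0) :=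
      fun w hc => by
    refine Metric.tendsto_atTop.2 fun δ hδ => ?_
    have h1 : Tendsto (fun x => ψ x w) (𝓝[A] x₀) (𝓝 0) := hψx₀ w ▸ hc x₀ hx₀
    obtain ⟨k, hk⟩ := hB.1.eventually_iff.1 (h1.eventually_lt_const (half_pos hδ))
    refine ⟨k, fun n hn => ?_⟩
    rw [Real.dist_eq, sub_zero, abs_of_nonneg (hf0 n w)]
    refine lt_of_le_of_lt (ciSup_le fun j => ?_) (half_lt_self hδ)
    exact (hk.2 (hB.2 hn (TopologicalSpace.denseSeq (C n) j).2.2)).le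
  have hgood' : ∀ i, ∀ᵐ ω ∂μ, ContinuousOn (fun x => ψ x (W i ω)) A ∧
      ∀ x ∈ A, ψ x (W i ω) ≤ H (W i ω) := fun i =>
    ae_of_ae_map (hW i).aemeasurable_fst ((hW i).map_eq ▸ hgood)
  have hHi : Integrable (fun ω => H (W 0 ω)) μ := hH.comp_aemeasurable (hW 0).aemeasurable_fst
  have hbound : ∀ k, ∀ᵐ ω ∂μ, ‖f k (W 0 ω)‖ ≤ H (W 0 ω) := fun k => by
    filter_upwards [hgood' 0] with ω hω
    rw [Real.norm_eq_abs, abs_of_nonneg (hf0 k _)]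
    exact hfH _ hω.2 k
  have hfmeas : ∀ k, AEStronglyMeasurable (fun ω => f k (W 0 ω)) μ := fun k =>
    ((hfm k).comp_aemeasurable (hW 0).aemeasurable_fst).aestronglyMeasurable
  have hint : ∀ k, Integrable (fun ω => f k (W 0 ω)) μ := fun k =>
    hHi.mono' (hfmeas k) (hbound k)
  -- The envelopes decrease to the value `0` at `x₀` and are dominated by `H`, so their means become
  -- arbitrarily small; the strong law for one fixed envelope then suffices.
  have hdct : Tendsto (fun k => ∫ ω, f k (W 0 ω) ∂μ) atTop (𝓝 0) := by
    have := tendsto_integral_of_dominated_convergence (fun ω => H (W 0 ω)) hfmeas hHi hbound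
      (f := fun _ => 0) ((hgood' 0).mono fun ω hω => hlim _ hω.1)
    simpa using this
  -- The null set is fixed before `T` is introduced, so that `T` may later be the sample-dependent
  -- estimator.
  filter_upwards [ae_all_iff.2 hgood', ae_all_iff.2 fun k => hlln (f k) (hfm k) (hint k)]
    with ω h1 h2 T hT
  refine Metric.tendsto_atTop'.2 fun δ hδ => ?_
  obtain ⟨k, hk⟩ := (hdct.eventually_lt_const hδ).exists
  have hev := (h2 k).eventually_lt_const hk
  have hTA : ∀ᶠ n in atTop, T n ∈ C k :=
    hT.eventually (inter_mem self_mem_nhdsWithin (hB.1.mem_of_mem trivial))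
  obtain ⟨N, hN⟩ := eventually_atTop.1 (hev.and hTA)
  refine ⟨N, fun n hn => ?_⟩
  obtain ⟨h3, h4⟩ := hN n (le_of_lt hn)
  rw [Real.dist_eq, sub_zero, abs_of_nonneg
    (div_nonneg (Finset.sum_nonneg fun i _ => hψ₀ _ _) (Nat.cast_nonneg n))]
  refine lt_of_le_of_lt ?_ h3
  gcongr with i _
  exact hle _ (h1 i).1 (h1 i).2 k _ h4

/-! ### Moments with estimated predictions -/

namespace SEMVariables.Follows

variable {S : Type*} [MeasurableSpace S] {r q h l p m : ℕ} {V : SEMVariables S r q h p m}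
  {μ : Measure S} {φ : (Fin q → ℝ) → Fin l → ℝ}
  {θ₁ : Stage1Param r q h} {θ₂ : Stage2Param r h l p m}

theorem ae_tendsto_average_X_Z (hV : V.Follows μ φ θ₁ θ₂) (hadm : θ₁.Admissible)
    (hφ : Measurable φ) {g : (Fin h → ℝ) × (Fin r → ℝ) → ℝ} (hg : Measurable g)
    (hint : Integrable (fun ω => g (V.X 0 ω, V.Z 0 ω)) μ) :
    ∀ᵐ ω ∂μ, Tendsto (fun n : ℕ => (∑ i ∈ Finset.range n, g (V.X i ω, V.Z i ω)) / n) atTop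
      (𝓝 (∫ ω, g (V.X 0 ω, V.Z 0 ω) ∂μ)) := by
  have h1 : Measurable fun t : (Fin m → ℝ) × (Fin r → ℝ) × (Fin h → ℝ) × (Fin q → ℝ) =>
    (t.2.2.1, t.2.1) := measurable_snd.snd.fst.prodMk measurable_snd.fst
  have h2 := hV.ae_tendsto_average hadm hφ (hg.comp h1)
  simp only [obs, Function.comp_apply] at h2
  exact h2 hint

/-- Replacing the true stage-one parameter by a consistent estimator changes the predictions
negligibly in mean square. -/
theorem ae_tendsto_average_sq_predict_sub (hV : V.Follows μ φ θ₁ θ₂) (hφ : Measurable φ)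
    {Θ₁ : Set (Stage1Param r q h)} (hadm₁ : ∀ θ ∈ Θ₁, θ.Admissible) (hθ₁ : θ₁ ∈ Θ₁)
    (hdom : V.LocallyDominated μ φ Θ₁ θ₁) (c : Fin l) :
    ∀ᵐ ω ∂μ, ∀ T : ℕ → Stage1Param r q h, Tendsto T atTop (𝓝[Θ₁] θ₁) →
      Tendsto (fun n : ℕ => (∑ i ∈ Finset.range n, ((T n).predict φ (V.X i ω) (V.Z i ω) c -
        θ₁.predict φ (V.X i ω) (V.Z i ω) c) ^ 2) / n) atTop (𝓝 0) := by
  obtain ⟨U, hU, G, hG, hle⟩ := hdom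
  have hadm := hadm₁ θ₁ hθ₁
  have hθU : θ₁ ∈ U ∩ Θ₁ := ⟨mem_of_mem_nhdsWithin hθ₁ hU, hθ₁⟩
  have hp : ∀ θ : Stage1Param r q h, Measurable fun w : (Fin h → ℝ) × (Fin r → ℝ) =>
      θ.predict φ w.1 w.2 c := fun θ =>
    measurable_pi_iff.1 (Stage1Param.measurable_predict hφ θ) c
  have hnhds : 𝓝[Θ₁] θ₁ ≤ 𝓝[U ∩ Θ₁] θ₁ :=
    nhdsWithin_le_of_mem (inter_mem hU self_mem_nhdsWithin)
  have hid := hV.identDistrib_X_Z hadm hφ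
  have hlln := fun (g : (Fin h → ℝ) × (Fin r → ℝ) → ℝ) (hg : Measurable g)
    (hint : Integrable (fun ω => g (V.X 0 ω, V.Z 0 ω)) μ) =>
      hV.ae_tendsto_average_X_Z hadm hφ hg hint
  -- The factor `4` is from `(a - b)² ≤ 2 a² + 2 b²`, with both squared predictions at most `max G
  -- 0`.
  have hHi := hG.pos_part.const_mul 4
  have hψ := fun θ => ((hp θ).sub (hp θ₁)).pow_const 2
  have hgood : ∀ᵐ w ∂(μ.map fun ω => (V.X 0 ω, V.Z 0 ω)),
      ContinuousOn (fun θ : Stage1Param r q h =>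
        (θ.predict φ w.1 w.2 c - θ₁.predict φ w.1 w.2 c) ^ 2) (U ∩ Θ₁) ∧ ∀ θ ∈ U ∩ Θ₁,
        (θ.predict φ w.1 w.2 c - θ₁.predict φ w.1 w.2 c) ^ 2 ≤ 4 * max (G w) 0 := by
    filter_upwards [hle] with w hw
    have hc := Stage1Param.continuousOn_predict hφ (fun θ hθ => hadm₁ θ hθ.2)
      (fun θ (hθ : θ ∈ U ∩ Θ₁) => hw θ hθ.1) c
    refine ⟨(hc.sub continuousOn_const).pow 2, fun θ hθ => ?_⟩
    have h1 := Stage1Param.sq_predict_le hφ (hw θ hθ.1) c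
    have h2 := Stage1Param.sq_predict_le hφ (hw θ₁ hθU.1) c
    have h3 := sq_nonneg (θ.predict φ w.1 w.2 c + θ₁.predict φ w.1 w.2 c)
    linarith [sub_sq (θ.predict φ w.1 w.2 c) (θ₁.predict φ w.1 w.2 c),
      add_sq (θ.predict φ w.1 w.2 c) (θ₁.predict φ w.1 w.2 c)]
  have key := ae_tendsto_average_zero_of_dominated hθU hψ (fun θ w => sq_nonneg _)
    (fun w => by simp) hid hHi hgood hlln
  filter_upwards [key] with ω hω T hT using hω T (hT.mono_right hnhds)

variable [IsProbabilityMeasure μ]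

/-- The strong law handles the moments at the true `θ₁`; only the prediction block of the data
vector changes with `T`, and that change is negligible in mean square. -/
theorem ae_tendsto_empMoment_predict (hV : V.Follows μ φ θ₁ θ₂) (hφ : Measurable φ)
    {Θ₁ : Set (Stage1Param r q h)} (hadm₁ : ∀ θ ∈ Θ₁, θ.Admissible) (hθ₁ : θ₁ ∈ Θ₁)
    (hdom : V.LocallyDominated μ φ Θ₁ θ₁) (hφξ : MemLp (fun ω => φ (V.ξ 0 ω)) 2 μ) :
    ∀ᵐ ω ∂μ, ∀ T : ℕ → Stage1Param r q h, Tendsto T atTop (𝓝[Θ₁] θ₁) →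
      Tendsto (fun n => empMoment (fun i => Stage2Param.dataVec (V.Y i ω) (V.Z i ω) (V.X i ω)
        ((T n).predict φ (V.X i ω) (V.Z i ω))) n) atTop
      (𝓝 (secondMoment μ (fun ω => Stage2Param.dataVec (V.Y 0 ω) (V.Z 0 ω) (V.X 0 ω)
        (θ₁.predict φ (V.X 0 ω) (V.Z 0 ω))) (fun ω => Stage2Param.dataVec (V.Y 0 ω) (V.Z 0 ω)
        (V.X 0 ω) (θ₁.predict φ (V.X 0 ω) (V.Z 0 ω))))) := by
  have hadm := hadm₁ θ₁ hθ₁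
  have hv := hV.memLp_dataVec2 hadm hφ hφξ
  have hm : Measurable fun t : (Fin m → ℝ) × (Fin r → ℝ) × (Fin h → ℝ) × (Fin q → ℝ) =>
      θ₁.predict φ t.2.2.1 t.2.1 := by
    have h1 : Measurable fun t : (Fin m → ℝ) × (Fin r → ℝ) × (Fin h → ℝ) × (Fin q → ℝ) =>
      (t.2.2.1, t.2.1) := measurable_snd.snd.fst.prodMk measurable_snd.fst
    have h2 := (Stage1Param.measurable_predict hφ θ₁).comp h1
    exact h2
  have hlim := hV.ae_tendsto_empMoment hadm hφ
    (g := fun t => Stage2Param.dataVec t.1 t.2.1 t.2.2.1 (θ₁.predict φ t.2.2.1 t.2.1))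
    (measurable_fst.sumElim_pi (measurable_const.sumElim_pi (measurable_snd.fst.sumElim_pi
      (measurable_snd.snd.fst.sumElim_pi hm)))) fun a b => hv.integrable_mul_eval hv a b
  filter_upwards [hlim, ae_all_iff.2 fun c =>
    hV.ae_tendsto_average_sq_predict_sub hφ hadm₁ hθ₁ hdom c] with ω h1 h2 T hT
  refine tendsto_empMoment_of_tendsto
    (u := fun n i => Stage2Param.dataVec (V.Y i ω) (V.Z i ω) (V.X i ω)
        ((T n).predict φ (V.X i ω) (V.Z i ω))) h1 fun a => ?_
  rcases a with a | a | a | a | c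
  · simp [Stage2Param.dataVec, obs]
  · simp [Stage2Param.dataVec, obs]
  · simp [Stage2Param.dataVec, obs]
  · simp [Stage2Param.dataVec, obs]
  · exact h2 c T hT

end SEMVariables.Follows

/-! ### Assembly of the two stages -/

theorem mainTheorem3 {S : Type*} [MeasurableSpace S] (μ : Measure S) [IsProbabilityMeasure μ]
    (r q h l p m : ℕ) (V : SEMVariables S r q h p m)
    (φ : (Fin q → ℝ) → Fin l → ℝ) (hφ : Measurable φ)
    (Θ₁ : Set (Stage1Param r q h)) (θ₁ : Stage1Param r q h)
    (Θ₂ : Set (Stage2Param r h l p m)) (θ₂ : Stage2Param r h l p m)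
    (hV : V.Follows μ φ θ₁ θ₂)
    (hΘ₁ : IsCompact Θ₁) (hadm₁ : ∀ θ ∈ Θ₁, θ.Admissible) (hθ₁ : θ₁ ∈ Θ₁)
    (hid₁ : Stage1Identified V μ Θ₁ θ₁)
    (hdom : V.LocallyDominated μ φ Θ₁ θ₁)
    (hΘ₂ : Stage2Param.IsParameterSpace Θ₂) (hθ₂ : θ₂ ∈ Θ₂)
    (hid₂ : Stage2Identified V μ φ Θ₂
      {θ₂ with Ψ := θ₂.Ψ + θ₂.B * V.covPredError μ φ * θ₂.Bᵀ})
    (T₁ : ℕ → S → Stage1Param r q h) (T₂ : ℕ → S → Stage2Param r h l p m)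
    (hT : V.IsTwoStageEstimator μ φ Θ₁ Θ₂ T₁ T₂) :
    (∀ᵐ ω ∂μ, Tendsto (fun n => T₁ n ω) atTop (𝓝 θ₁)) ∧
    (∀ᵐ ω ∂μ, Tendsto (fun n => T₂ n ω) atTop
      (𝓝 {θ₂ with Ψ := θ₂.Ψ + θ₂.B * V.covPredError μ φ * θ₂.Bᵀ})) ∧
    (∀ i, ∀ᵐ ω ∂μ, θ₁.predict φ (V.X i ω) (V.Z i ω) = V.condPhi μ φ i ω) ∧
    (∀ i c j, MemLp (fun ω => V.predError μ φ i ω c) 2 μ ∧ MemLp (fun ω => V.X i ω j) 2 μ ∧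
      cov[fun ω => V.predError μ φ i ω c, fun ω => V.X i ω j; μ] = 0) := by
  have hadm := hadm₁ θ₁ hθ₁
  have hφξ : ∀ i, MemLp (fun ω => φ (V.ξ i ω)) 2 μ := by
    obtain ⟨U, hU, G, hG, hle⟩ := hdom
    exact hV.memLp_φ_ξ hadm hφ hG
      (hle.mono fun w hw => hw θ₁ (mem_of_mem_nhdsWithin hθ₁ hU))
  have h1 := hV.tendsto_stage1 hφ hΘ₁ hadm₁ hθ₁ hid₁
    (hT.mono fun ω hω => hω.mono fun n hn => hn.1)
  refine ⟨h1, ?_, fun i => ?_, fun i c j => ⟨?_, (hV.memLp_X hadm i).eval j,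
    hV.covariance_predError_X hadm i (hφξ i) c j⟩⟩
  -- The moment statement holds at almost every `ω` for all parameter sequences at once, so it can
  -- be used with the estimates `T₁ n ω` computed from the same sample.
  · filter_upwards [h1, hT, hV.ae_tendsto_empMoment_predict hφ hadm₁ hθ₁ hdom (hφξ 0)]
      with ω h2 h3 h4
    exact hV.tendsto_stage2 hadm hφ (hφξ 0) hΘ₂ hθ₂ hid₂
      (h4 _ (tendsto_nhdsWithin_iff.2 ⟨h2, h3.mono fun n hn => hn.1.1⟩))
      (h3.mono fun n hn => hn.2)
  · exact (hV.condPhi_ae_eq hadm hφ i fun c => ((hφξ i).eval c).integrable one_le_two).symm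
  · exact (SEMVariables.Follows.memLp_predError (hφξ i)).eval c
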